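/- Fix $0<\alpha\le\beta<1$, $A>0$, $B>0$, $T>0$. Let $\sigma(a)=a(1-a)$ and, for $0<\varrho<1$, $D>0$, $a\in[0,1]$, $M\in\mathbb R$, $$\mathfrak p_{\varrho,D}(a,M)=\frac1D\big\{(1-a)\,\varrho\, e^{M}-a\,(1-\varrho)\,e^{-M}\big\}.$$ Write $\nabla$ for the space derivative. Let $C^{m,n}([0,T]\times[0,1])$ be the space of functions with $m$ derivatives in time and $n$ derivatives in space that are continuous up to the boundary, and let $\mathcal H^1$ be the Sobolev space of functions in $L^2([0,1])$ with generalized derivative in $L^2([0,1])$; elements of $\mathcal H^1$ are identified with their continuous versions. Let $\gamma:[0,1]\to[0,1]$ be measurable and let $H\in C^{0,1}([0,T]\times[0,1])$. A weak solution of $$\begin{cases}\partial_t u=\Delta u-2\nabla\{\sigma(u)\nabla H\},\\ \nabla u_t(1)-2\sigma(u_t(1))\nabla H_t(1)=\mathfrak p_{\beta,B}(u_t(1),H_t(1)),\\ \nabla u_t(0)-2\sigma(u_t(0))\nabla H_t(0)=-\mathfrak p_{\alpha,A}(u_t(0),H_t(0)),\\ u(0,\cdot)=\gamma\end{cases}$$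 is a function $u\in L^2(0,T;\mathcal H^1)$, with $u_t\in L^2([0,1])$ given for every $t\in[0,T]$ and with $0\le u\le1$ a.e., such that $$\begin{aligned}&\int_0^1u_tG_t\,dx-\int_0^1\gamma\, G_0\,dx-\int_0^t\!\!\int_0^1u_s\,\partial_sG_s\,dx\,ds\\&\quad=\int_0^t\!\!\int_0^1\{-\nabla u_s\nabla G_s+2\sigma(u_s)\nabla H_s\nabla G_s\}\,dx\,ds+\int_0^t\{\mathfrak p_{\beta,B}(u_s(1),H_s(1))G_s(1)+\mathfrak p_{\alpha,A}(u_s(0),H_s(0))G_s(0)\}\,ds\end{aligned}$$ for every $0<t\le T$ and every $G\in C^{1,2}([0,T]\times[0,1])$. Then there exists a unique weak solution: a weak solution exists, and any two weak solutions $u,v$ satisfy $u_t=v_t$ a.e. on $[0,1]$ for every $0<t\le T$. -/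

import Mathlib

open Set MeasureTheory
open scoped ContDiff

noncomputable section

namespace RobinWASEP

/-- Lebesgue measure on `[0,1]`. -/
def unitMeasure : Measure ℝ := volume.restrict (Icc 0 1)

/-- The cylinder `[0,T] × [0,1]`; a function on it is written `u t x`, time first. -/
def cylinder (T : ℝ) : Set (ℝ × ℝ) := Icc 0 T ×ˢ Icc 0 1

/-- The class `C^{m,n}([0,T] × [0,1])`: `m` derivatives in time and `n` derivatives in space, all
of them continuous on the closed cylinder (one-sided derivatives at the boundary). -/
structure IsC (T : ℝ) (m n : ℕ) (G : ℝ → ℝ → ℝ) : Prop where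
  time_contDiff : ∀ x ∈ Icc (0 : ℝ) 1, ContDiffOn ℝ m (fun t => G t x) (Icc 0 T)
  space_contDiff : ∀ t ∈ Icc (0 : ℝ) T, ContDiffOn ℝ n (G t) (Icc 0 1)
  time_continuous : ∀ j ≤ m, ContinuousOn
    (fun p : ℝ × ℝ => iteratedDerivWithin j (fun t => G t p.2) (Icc 0 T) p.1) (cylinder T)
  space_continuous : ∀ k ≤ n, ContinuousOn
    (fun p : ℝ × ℝ => iteratedDerivWithin k (G p.1) (Icc 0 1) p.2) (cylinder T)

/-- The time derivative `∂_t G (t,x)`, one-sided at `t = 0` and `t = T`. -/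
def timeDeriv (T : ℝ) (G : ℝ → ℝ → ℝ) (t x : ℝ) : ℝ :=
  derivWithin (fun s => G s x) (Icc 0 T) t

/-- The space derivative `∇ G (t,x)`, one-sided at `x = 0` and `x = 1`. -/
def spaceDeriv (G : ℝ → ℝ → ℝ) (t x : ℝ) : ℝ :=
  derivWithin (G t) (Icc 0 1) x

/-- `g` is a generalized derivative of `f` on `(0,1)`. -/
def HasWeakDeriv (f g : ℝ → ℝ) : Prop :=
  ∀ φ : ℝ → ℝ, ContDiff ℝ ∞ φ → HasCompactSupport φ → tsupport φ ⊆ Ioo 0 1 →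
    ∫ x, f x * deriv φ x ∂unitMeasure = - ∫ x, g x * φ x ∂unitMeasure

/-- `f` is (the continuous version of) an element of the Sobolev space `H¹` of `[0,1]`, with
generalized derivative `g`. -/
structure IsH1 (f g : ℝ → ℝ) : Prop where
  memLp : MemLp f 2 unitMeasure
  memLp_deriv : MemLp g 2 unitMeasure
  hasWeakDeriv : HasWeakDeriv f g
  continuousOn : ContinuousOn f (Icc 0 1)

/-- `u` belongs to `L²(0,T; H¹)`, with generalized space derivative `g = ∇u`. For almost every `t`
the function `u t` is the continuous version, so that `u t 0` and `u t 1` are its boundary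
values. -/
structure IsL2H1 (T : ℝ) (u g : ℝ → ℝ → ℝ) : Prop where
  memLp : MemLp (fun p : ℝ × ℝ => u p.1 p.2) 2 (volume.restrict (cylinder T))
  memLp_deriv : MemLp (fun p : ℝ × ℝ => g p.1 p.2) 2 (volume.restrict (cylinder T))
  isH1 : ∀ᵐ t ∂(volume.restrict (Icc 0 T)), IsH1 (u t) (g t)

/-- The mobility `σ(a) = a (1 - a)`. -/
def mobility (a : ℝ) : ℝ := a * (1 - a)

/-- `𝔭_{ϱ,D}(a,M) = D⁻¹ { (1 - a) ϱ e^M - a (1 - ϱ) e^{-M} }`. -/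
def boundaryFlux (ϱ D a M : ℝ) : ℝ :=
  D⁻¹ * ((1 - a) * ϱ * Real.exp M - a * (1 - ϱ) * Real.exp (-M))

/-- The integral identity at time `t` with test function `G`, for a function `u` with generalized
space derivative `g`. -/
def WeakIdentity (α β A B T : ℝ) (H : ℝ → ℝ → ℝ) (γ : ℝ → ℝ) (u g : ℝ → ℝ → ℝ)
    (t : ℝ) (G : ℝ → ℝ → ℝ) : Prop :=
  (∫ x, u t x * G t x ∂unitMeasure) - (∫ x, γ x * G 0 x ∂unitMeasure)
      - (∫ s in (0 : ℝ)..t, ∫ x, u s x * timeDeriv T G s x ∂unitMeasure)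
    = (∫ s in (0 : ℝ)..t, ∫ x, (- (g s x * spaceDeriv G s x)
          + 2 * mobility (u s x) * spaceDeriv H s x * spaceDeriv G s x) ∂unitMeasure)
      + ∫ s in (0 : ℝ)..t, (boundaryFlux β B (u s 1) (H s 1) * G s 1
          + boundaryFlux α A (u s 0) (H s 0) * G s 0)

/-- Weak (generalized) solutions in `[0,T] × [0,1]` of `∂_t u = Δu - 2 ∇(σ(u) ∇H)` with
`∇u - 2 σ(u) ∇H` equal to `𝔭_{β,B}(u,H)` at `x = 1` and to `-𝔭_{α,A}(u,H)` at `x = 0`, and with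
initial condition `γ`. The field `memLp` gives a meaning to the profile `u t` at each time. -/
structure IsWeakSolution (α β A B T : ℝ) (H : ℝ → ℝ → ℝ) (γ : ℝ → ℝ)
    (u : ℝ → ℝ → ℝ) : Prop where
  memLp : ∀ t ∈ Icc 0 T, MemLp (u t) 2 unitMeasure
  mem_Icc : ∀ᵐ p ∂(volume.restrict (cylinder T)), u p.1 p.2 ∈ Icc (0 : ℝ) 1
  weak : ∃ g : ℝ → ℝ → ℝ, IsL2H1 T u g ∧
    ∀ t ∈ Ioc 0 T, ∀ G : ℝ → ℝ → ℝ, IsC T 1 2 G → WeakIdentity α β A B T H γ u g t G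

end RobinWASEP

end

/-!
For existence, the mobility is truncated outside `[0,1]`, which makes the drift Lipschitz. With
`u = e^{r² t} v` the resulting problem becomes `v_t + r² v = ∂_x (∂_x v - b(r v))` with
dissipative Robin conditions. In the weak form the jet of `v` (the multiple `r v`, the derivative
`∂_x v` and the two boundary values) is paired with test functions `G` vanishing at time `T`. The
linear part paired with `v = G` is coercive, because `-∫ G ∂_t G ≥ 0`, so Lions' projection lemma
applies to it; for large `r` the Lipschitz constant of `b` is below the coercivity constant, and the
contraction principle gives a solution. The mobility vanishes at `0` and `1`, so the truncated
solution stays in `[0,1]` by an energy inequality for a convex function of `u` that vanishes there;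
hence it solves the original problem, first for test functions vanishing at time `T`. A modification
on a null set of times gives the identity at each time: the right-hand side of the identity is a
bounded functional of `G_t`, hence represented by a function in `L²`.

For uniqueness, the difference `w` of two solutions has a flux with `f - ∂_x w = O(w)`, because the
mobility is Lipschitz on `[0,1]`, and its boundary fluxes are dissipative. The energy inequality for
`w²`, integrated in time against `e^{-Kt}` with `K` large, gives `w = 0` at almost every time, and
the identity then gives it at every time.

Since `∂_t w` is only a distribution, the energy inequality for a convex `Φ` is obtained from
`Φ(w_t) - Φ(w_{t-h}) ≤ Φ'(w_t) (w_t - w_{t-h})`: the increment `w_t - w_{t-h}` is the space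
derivative of the flux integrated over `[t-h, t]`, so it can be paired with `Φ'(w_t)` by parts, and
one divides by `h` and lets `h → 0`.
-/

noncomputable section

namespace RobinWASEP

open Filter Topology
open scoped NNReal

section HilbertSpace

variable {Φ E E' : Type*} [AddCommGroup Φ] [Module ℝ Φ] [NormedAddCommGroup E]
  [InnerProductSpace ℝ E] [CompleteSpace E] [NormedAddCommGroup E'] [InnerProductSpace ℝ E']
  [CompleteSpace E']

-- `l` and `i` factor through `K` as bounded operators `L` and `J` on the closure of its range, and
-- the equation becomes the fixed point problem `u = L† 1 + J† (N u)`.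
theorem exists_inner_eq_of_lipschitzWith {K : Φ →ₗ[ℝ] E} {i : Φ →ₗ[ℝ] E'} {l : Φ →ₗ[ℝ] ℝ}
    {N : E → E'} {C q : ℝ≥0} {C' : ℝ} (hi : ∀ φ, ‖i φ‖ ≤ C * ‖K φ‖)
    (hl : ∀ φ, ‖l φ‖ ≤ C' * ‖K φ‖) (hN : LipschitzWith q N) (hCq : C * q < 1) :
    ∃ u, ∀ φ, inner ℝ u (K φ) = l φ + inner ℝ (N u) (i φ) := by
  let R := (LinearMap.range K).topologicalClosure
  have hR : ∀ φ, K φ ∈ R := fun φ =>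
    (LinearMap.range K).le_topologicalClosure (LinearMap.mem_range_self K φ)
  let K' : Φ →ₗ[ℝ] R := K.codRestrict R hR
  have : CompleteSpace R := (LinearMap.range K).isClosed_topologicalClosure.completeSpace_coe
  have hdense : DenseRange K' := by
    refine Subtype.dense_iff.2 fun x hx => closure_mono ?_ hx
    rintro _ ⟨φ, rfl⟩
    exact ⟨K' φ, mem_range_self φ, rfl⟩
  let L := l.extendOfNorm K'
  let J := i.extendOfNorm K'
  have hL : ∀ φ, L (K' φ) = l φ := LinearMap.extendOfNorm_eq hdense ⟨C', hl⟩
  have hJ : ∀ φ, J (K' φ) = i φ := LinearMap.extendOfNorm_eq hdense ⟨C, hi⟩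
  have hJC : ‖J.adjoint‖₊ ≤ C := by
    rw [← NNReal.coe_le_coe, coe_nnnorm, LinearIsometryEquiv.norm_map]
    exact LinearMap.opNorm_extendOfNorm_le hdense C.2 hi
  have hcontr : ContractingWith (C * q) fun u : R => L.adjoint 1 + J.adjoint (N u) := by
    have hlip := (J.adjoint.lipschitz.weaken hJC).comp
      (hN.comp (LipschitzWith.subtype_val (R : Set E)))
    rw [mul_one] at hlip
    exact ⟨hCq, LipschitzWith.of_dist_le_mul fun u v =>
      (dist_add_left _ _ _).trans_le (hlip.dist_le_mul u v)⟩
  let u := hcontr.fixedPoint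
  have hu : L.adjoint 1 + J.adjoint (N u) = u := hcontr.fixedPoint_isFixedPt
  refine ⟨u, fun φ => ?_⟩
  calc inner ℝ (u : E) (K φ) = inner ℝ u (K' φ) := rfl
    _ = inner ℝ (L.adjoint 1 + J.adjoint (N u)) (K' φ) := by rw [hu]
    _ = l φ + inner ℝ (N u) (i φ) := by
      rw [inner_add_left, ContinuousLinearMap.adjoint_inner_left,
        ContinuousLinearMap.adjoint_inner_left, hL, hJ]
      simp

/-- A semilinear form of Lions' projection theorem: `Φ` is the space of test functions, `i` its
inclusion into the energy space and `k` the transposed operator. -/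
theorem exists_mem_closure_inner_eq_of_coercive {i k : Φ →ₗ[ℝ] E} {l : Φ →ₗ[ℝ] ℝ} {N : E → E}
    {κ C : ℝ} {q : ℝ≥0} (hC : 0 ≤ C) (hqκ : q < κ)
    (hcoercive : ∀ φ, κ * ‖i φ‖ ^ 2 ≤ inner ℝ (i φ) (k φ))
    (hl : ∀ φ, l φ ^ 2 ≤ C * inner ℝ (i φ) (k φ)) (hN : LipschitzWith q N) :
    ∃ u ∈ (LinearMap.range i).topologicalClosure,
      ∀ φ, inner ℝ u (k φ) = l φ + inner ℝ (N u) (i φ) := by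
  have hκ : 0 < κ := q.2.trans_lt hqκ
  let F := (LinearMap.range i).topologicalClosure
  have : CompleteSpace F := (LinearMap.range i).isClosed_topologicalClosure.completeSpace_coe
  let K : Φ →ₗ[ℝ] F := F.orthogonalProjectionOnto.toLinearMap.comp k
  have hK : ∀ (u : F) φ, inner ℝ u (K φ) = inner ℝ (u : E) (k φ) := fun u φ =>
    F.inner_orthogonalProjectionOnto_eq_of_mem_left u (k φ)
  have hiK : ∀ φ, inner ℝ (i φ) (k φ) ≤ ‖i φ‖ * ‖K φ‖ := fun φ => by
    have hφ : i φ ∈ F := (LinearMap.range i).le_topologicalClosure (LinearMap.mem_range_self i φ)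
    exact (hK ⟨i φ, hφ⟩ φ).symm.le.trans (real_inner_le_norm _ _)
  have hi_le : ∀ φ, ‖i φ‖ ≤ κ⁻¹ * ‖K φ‖ := fun φ => by
    rw [inv_mul_eq_div, le_div_iff₀ hκ]
    rcases (norm_nonneg (i φ)).eq_or_lt with h0 | h0
    · rw [← h0, zero_mul]; exact norm_nonneg _
    · refine le_of_mul_le_mul_left ?_ h0
      linarith [(hcoercive φ).trans (hiK φ)]
  have hl_le : ∀ φ, ‖l φ‖ ≤ √(C * κ⁻¹) * ‖K φ‖ := fun φ => by
    rw [Real.norm_eq_abs, ← Real.sqrt_sq_eq_abs, ← Real.sqrt_sq (norm_nonneg (K φ)),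
      ← Real.sqrt_mul (by positivity)]
    refine Real.sqrt_le_sqrt ((hl φ).trans ?_)
    rw [mul_assoc]
    refine mul_le_mul_of_nonneg_left ((hiK φ).trans ?_) hC
    rw [sq, ← mul_assoc]
    exact mul_le_mul_of_nonneg_right (hi_le φ) (norm_nonneg _)
  obtain ⟨u, hu⟩ := exists_inner_eq_of_lipschitzWith (C := ⟨κ⁻¹, (inv_pos.2 hκ).le⟩) hi_le hl_le
    (hN.comp (LipschitzWith.subtype_val (F : Set E))) (by
      rw [mul_one, ← NNReal.coe_lt_coe]
      exact (inv_mul_lt_one₀ hκ).2 hqκ)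
  exact ⟨u, u.2, fun φ => (hK u φ).symm.trans (hu φ)⟩

end HilbertSpace

section SquareIntegrable

variable {α β : Type*} [MeasurableSpace α] [MeasurableSpace β] {μ : Measure α} {ν : Measure β}

theorem sq_integral_le_integral_sq [IsProbabilityMeasure μ] {f : α → ℝ} (hf : MemLp f 2 μ) :
    (∫ x, f x ∂μ) ^ 2 ≤ ∫ x, f x ^ 2 ∂μ := by
  have h := ProbabilityTheory.variance_nonneg f μ
  rwa [ProbabilityTheory.variance_eq_sub hf, sub_nonneg] at h

theorem ae_memLp_slice [SFinite μ] [SFinite ν] {f : α × β → ℝ} (hf : MemLp f 2 (μ.prod ν)) :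
    ∀ᵐ t ∂μ, MemLp (fun x => f (t, x)) 2 ν := by
  filter_upwards [hf.1.prodMk_left, hf.integrable_sq.prod_right_ae] with t hm h_int
  exact (memLp_two_iff_integrable_sq hm).2 h_int

variable [SFinite μ] [IsProbabilityMeasure ν] {F : α → β → ℝ}

theorem integrable_sq_integral_of_memLp
    (hF : MemLp (fun p : α × β => F p.1 p.2) 2 (μ.prod ν)) :
    Integrable (fun t => (∫ y, F t y ∂ν) ^ 2) μ :=
  hF.integrable_sq.integral_prod_left.mono' (hF.1.integral_prod_right'.pow 2)
    ((ae_memLp_slice hF).mono fun t ht => by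
      rw [Real.norm_eq_abs, abs_of_nonneg (sq_nonneg _)]
      exact sq_integral_le_integral_sq ht)

theorem memLp_integral_of_memLp (hF : MemLp (fun p : α × β => F p.1 p.2) 2 (μ.prod ν)) :
    MemLp (fun t => ∫ y, F t y ∂ν) 2 μ :=
  (memLp_two_iff_integrable_sq hF.1.integral_prod_right').2 (integrable_sq_integral_of_memLp hF)

theorem integral_sq_integral_le (hF : MemLp (fun p : α × β => F p.1 p.2) 2 (μ.prod ν)) :
    ∫ t, (∫ y, F t y ∂ν) ^ 2 ∂μ ≤ ∫ p, F p.1 p.2 ^ 2 ∂(μ.prod ν) := by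
  rw [integral_prod _ hF.integrable_sq]
  exact integral_mono_ae (integrable_sq_integral_of_memLp hF) hF.integrable_sq.integral_prod_left
    ((ae_memLp_slice hF).mono fun t ht => sq_integral_le_integral_sq ht)

end SquareIntegrable

section Moments

variable {a b : ℝ} {h : ℝ → ℝ}

theorem integral_mul_eq_zero_of_moments_eq_zero (hh : IntegrableOn h (Icc a b))
    (hmoments : ∀ n : ℕ, ∫ x in Icc a b, x ^ n * h x = 0) {f : ℝ → ℝ}
    (hf : ContinuousOn f (Icc a b)) : ∫ x in Icc a b, f x * h x = 0 := by
  have hpoly : ∀ p : Polynomial ℝ, ∫ x in Icc a b, p.eval x * h x = 0 := fun p => by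
    simp_rw [Polynomial.eval_eq_sum_range, Finset.sum_mul]
    rw [integral_finsetSum _ fun n _ =>
      hh.continuousOn_mul (by fun_prop : Continuous _).continuousOn isCompact_Icc]
    refine Finset.sum_eq_zero fun n _ => ?_
    simp_rw [mul_assoc]
    rw [integral_const_mul, hmoments, mul_zero]
  have happrox : ∀ ε > 0, |∫ x in Icc a b, f x * h x| ≤ ε * ∫ x in Icc a b, |h x| :=
    fun ε hε => by
    obtain ⟨p, hp⟩ := exists_polynomial_near_of_continuousOn a b f hf ε hε
    have hfp : ∫ x in Icc a b, f x * h x = ∫ x in Icc a b, (f x - p.eval x) * h x := by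
      simp_rw [sub_mul]
      rw [integral_sub (hh.continuousOn_mul hf isCompact_Icc)
        (hh.continuousOn_mul p.continuous.continuousOn isCompact_Icc), hpoly, sub_zero]
    rw [hfp, ← integral_const_mul]
    refine norm_integral_le_of_norm_le (f := fun x => (f x - p.eval x) * h x)
      (Integrable.const_mul (Integrable.abs hh) ε) ?_
    filter_upwards [ae_restrict_mem measurableSet_Icc] with x hx
    rw [Real.norm_eq_abs, abs_mul, abs_sub_comm]
    exact mul_le_mul_of_nonneg_right (hp x hx).le (abs_nonneg _)
  have hlim : Tendsto (fun ε => ε * ∫ x in Icc a b, |h x|) (𝓝[>] 0) (𝓝 0) := by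
    have := (continuous_mul_const (∫ x in Icc a b, |h x|)).tendsto 0
    rw [zero_mul] at this
    exact this.mono_left nhdsWithin_le_nhds
  exact abs_nonpos_iff.1 (ge_of_tendsto hlim (eventually_mem_nhdsWithin.mono happrox))

theorem ae_eq_zero_of_moments_eq_zero (hh : IntegrableOn h (Icc a b))
    (hmoments : ∀ n : ℕ, ∫ x in Icc a b, x ^ n * h x = 0) :
    ∀ᵐ x ∂(volume.restrict (Icc a b)), h x = 0 :=
  ae_eq_zero_of_integral_contDiff_smul_eq_zero hh.locallyIntegrable fun _ hf _ =>
    integral_mul_eq_zero_of_moments_eq_zero hh hmoments hf.continuous.continuousOn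

end Moments

section DuBoisReymond

theorem exists_Icc_subset_Ioo_of_isCompact {a b : ℝ} (hab : a < b) {K : Set ℝ} (hK : IsCompact K)
    (hKab : K ⊆ Ioo a b) : ∃ c d, a < c ∧ d < b ∧ K ⊆ Icc c d := by
  rcases K.eq_empty_or_nonempty with rfl | hne
  · exact ⟨b, a, hab, hab, empty_subset _⟩
  · exact ⟨sInf K, sSup K, (hKab (hK.sInf_mem hne)).1, (hKab (hK.sSup_mem hne)).2, fun x hx =>
      ⟨csInf_le hK.bddBelow hx, le_csSup hK.bddAbove hx⟩⟩

theorem intervalIntegral_eq_integral_of_tsupport_subset_Ioo {a b : ℝ} {f : ℝ → ℝ}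
    (hf : tsupport f ⊆ Ioo a b) : ∫ x in a..b, f x = ∫ x, f x :=
  intervalIntegral.integral_eq_integral_of_support_subset <|
    (subset_tsupport f).trans (hf.trans Ioo_subset_Ioc_self)

theorem exists_deriv_eq_of_integral_eq_zero {a b : ℝ} (hab : a < b) {η : ℝ → ℝ}
    (hη : ContDiff ℝ ∞ η) (hc : HasCompactSupport η) (hs : tsupport η ⊆ Ioo a b)
    (h0 : ∫ x, η x = 0) :
    ∃ φ : ℝ → ℝ, ContDiff ℝ ∞ φ ∧ HasCompactSupport φ ∧ tsupport φ ⊆ Ioo a b ∧ deriv φ = η := by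
  obtain ⟨c, d, hac, hdb, hcd⟩ := exists_Icc_subset_Ioo_of_isCompact hab hc hs
  have hz : ∀ x, x ∉ Icc c d → η x = 0 := fun x hx =>
    image_eq_zero_of_notMem_tsupport fun h => hx (hcd h)
  have hintegral : ∀ x y, IntervalIntegrable η volume x y := fun x y =>
    hη.continuous.intervalIntegrable x y
  let φ : ℝ → ℝ := fun x => ∫ y in a..x, η y
  have hd : ∀ x, HasDerivAt φ (η x) x := fun x =>
    intervalIntegral.integral_hasDerivAt_right (hintegral _ _)
      (hη.continuous.stronglyMeasurableAtFilter _ _) hη.continuous.continuousAt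
  have hderiv : deriv φ = η := funext fun x => (hd x).deriv
  have hleft : ∀ x < c, φ x = 0 := fun x hx =>
    intervalIntegral.integral_zero_ae <| Eventually.of_forall fun y hy => hz y fun hy' =>
      (hy'.1.trans hy.2).not_gt (max_lt hac hx)
  have hright : ∀ x > d, φ x = 0 := fun x hx => by
    have hsplit : φ x = (∫ y in a..b, η y) + ∫ y in b..x, η y :=
      (intervalIntegral.integral_add_adjacent_intervals (hintegral _ _) (hintegral _ _)).symm
    rw [hsplit, intervalIntegral_eq_integral_of_tsupport_subset_Ioo hs, h0, zero_add]
    exact intervalIntegral.integral_zero_ae <| Eventually.of_forall fun y hy => hz y fun hy' =>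
      (hy.1.trans_le hy'.2).not_ge (le_min hdb.le hx.le)
  have htsub : tsupport φ ⊆ Icc c d := closure_minimal
    (fun x hx => ⟨not_lt.1 fun h => hx (hleft x h), not_lt.1 fun h => hx (hright x h)⟩)
    isClosed_Icc
  refine ⟨φ, ?_, ?_, fun x hx => ⟨hac.trans_le (htsub hx).1, (htsub hx).2.trans_lt hdb⟩, hderiv⟩
  · rw [contDiff_infty_iff_deriv, hderiv]
    exact ⟨fun x => (hd x).differentiableAt, hη⟩
  · exact isCompact_Icc.of_isClosed_subset (isClosed_tsupport φ) htsub

theorem exists_contDiff_integral_eq_one {a b : ℝ} (hab : a < b) :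
    ∃ θ : ℝ → ℝ, ContDiff ℝ ∞ θ ∧ HasCompactSupport θ ∧ tsupport θ ⊆ Ioo a b ∧ ∫ x, θ x = 1 := by
  let bump : ContDiffBump ((a + b) / 2) :=
    ⟨(b - a) / 8, (b - a) / 4, by linarith, by linarith⟩
  refine ⟨bump.normed volume, bump.contDiff_normed, bump.hasCompactSupport_normed, ?_,
    bump.integral_normed⟩
  rw [bump.tsupport_normed_eq, Real.closedBall_eq_Icc]
  intro x hx
  simp only [bump, mem_Icc] at hx
  constructor <;> linarith [hx.1, hx.2]

theorem integrable_mul_of_tsupport_subset {s : Set ℝ} {h η : ℝ → ℝ}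
    (hh : LocallyIntegrableOn h s) (hη : Continuous η) (hc : HasCompactSupport η)
    (hs : tsupport η ⊆ s) : Integrable fun x => h x * η x := by
  rw [← integrableOn_iff_integrable_of_support_subset
    ((Function.support_mul_subset_right h η).trans (subset_tsupport η))]
  exact (hh.integrableOn_compact_subset hs hc).mul_continuousOn hη.continuousOn hc

-- `η - (∫ η) θ` is a derivative for every test function `η`, once `θ` is one with integral `1`.
theorem exists_ae_eq_const_of_forall_integral_mul_deriv_eq_zero {a b : ℝ} (hab : a < b)
    {h : ℝ → ℝ} (hh : LocallyIntegrableOn h (Ioo a b))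
    (hderiv : ∀ φ : ℝ → ℝ, ContDiff ℝ ∞ φ → HasCompactSupport φ → tsupport φ ⊆ Ioo a b →
      ∫ x, h x * deriv φ x = 0) :
    ∃ c, ∀ᵐ x, x ∈ Ioo a b → h x = c := by
  obtain ⟨θ, hθ, hθc, hθs, hθ1⟩ := exists_contDiff_integral_eq_one hab
  refine ⟨∫ x, h x * θ x, ?_⟩
  have hzero := isOpen_Ioo.ae_eq_zero_of_integral_contDiff_smul_eq_zero
    (f := fun x => h x - ∫ x, h x * θ x) (hh.sub (continuousOn_const.locallyIntegrableOn
      measurableSet_Ioo)) fun η hη hηc hηs => ?_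
  · filter_upwards [hzero] with x hx hxab using sub_eq_zero.1 (hx hxab)
  have hθ_int := hθ.continuous.integrable_of_hasCompactSupport hθc (μ := volume)
  have hη_int := hη.continuous.integrable_of_hasCompactSupport hηc (μ := volume)
  have hhθ := integrable_mul_of_tsupport_subset hh hθ.continuous hθc hθs
  have hhη := integrable_mul_of_tsupport_subset hh hη.continuous hηc hηs
  obtain ⟨φ, hφ, hφc, hφs, hφη⟩ := exists_deriv_eq_of_integral_eq_zero hab
    (η := fun x => η x - (∫ y, η y) * θ x) (hη.sub (contDiff_const.mul hθ))
    (hηc.sub (hθc.mul_left (f := fun _ => ∫ y, η y)))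
    ((tsupport_sub _ _).trans (union_subset hηs
      ((tsupport_mul_subset_right (f := fun _ => ∫ y, η y)).trans hθs)))
    (by rw [integral_sub hη_int (hθ_int.const_mul _), integral_const_mul, hθ1, mul_one, sub_self])
  have horth := hderiv φ hφ hφc hφs
  simp only [hφη, mul_sub, mul_left_comm (h _)] at horth
  rw [integral_sub hhη (hhθ.const_mul _), integral_const_mul] at horth
  simp only [smul_eq_mul, mul_sub, mul_comm (η _) (h _)]
  rw [integral_sub hhη (hη_int.mul_const _), integral_mul_const, horth]

end DuBoisReymond

section Translation

theorem continuous_integral_mul_translate {A B : ℝ × ℝ → ℝ} (hA : MemLp A 2 volume)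
    (hB : MemLp B 2 volume) :
    Continuous fun r : ℝ => ∫ p : ℝ × ℝ, A p * B (p.1 - r, p.2) := by
  have : Fact ((2 : ENNReal) ≠ ⊤) := ⟨by simp⟩
  have hinner : Continuous fun r : ℝ =>
      inner ℝ (hA.toLp A) (DomAddAct.mk ((-r, 0) : ℝ × ℝ) +ᵥ hB.toLp B) := by
    have hmk : Continuous fun r : ℝ => DomAddAct.mk ((-r, 0) : ℝ × ℝ) :=
      DomAddAct.continuous_mk.comp (by fun_prop)
    exact continuous_const.inner (continuous_vadd.comp (hmk.prodMk continuous_const))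
  refine hinner.congr fun r => ?_
  rw [L2.inner_def, DomAddAct.mk_vadd_toLp]
  refine integral_congr_ae ?_
  filter_upwards [hA.coeFn_toLp, MemLp.coeFn_toLp
    (hB.comp_measurePreserving (measurePreserving_vadd ((-r, 0) : ℝ × ℝ) volume))] with p hAp hBp
  have hshift : ((-r, 0) : ℝ × ℝ) + p = (p.1 - r, p.2) := by ext <;> simp [sub_eq_neg_add]
  rw [hAp]
  refine (congrArg (inner ℝ (A p)) hBp).trans ?_
  simp [hshift, mul_comm]

end Translation

section Measures

/-- Lebesgue measure on `[0,T]`. -/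
def timeMeasure (T : ℝ) : Measure ℝ := volume.restrict (Icc 0 T)

instance : IsProbabilityMeasure unitMeasure :=
  ⟨by simp [unitMeasure]⟩

instance (T : ℝ) : IsFiniteMeasure (timeMeasure T) :=
  ⟨by simp [timeMeasure]⟩

theorem restrict_cylinder (T : ℝ) :
    (volume : Measure (ℝ × ℝ)).restrict (cylinder T) = (timeMeasure T).prod unitMeasure := by
  rw [cylinder, timeMeasure, unitMeasure, Measure.prod_restrict, Measure.volume_eq_prod]

theorem ae_unitMeasure_mem : ∀ᵐ x ∂unitMeasure, x ∈ Icc (0 : ℝ) 1 :=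
  ae_restrict_mem measurableSet_Icc

theorem ae_timeMeasure_mem (T : ℝ) : ∀ᵐ t ∂timeMeasure T, t ∈ Icc (0 : ℝ) T :=
  ae_restrict_mem measurableSet_Icc

theorem intervalIntegral_eq_setIntegral_timeMeasure {T t : ℝ} (ht : t ∈ Icc 0 T) (f : ℝ → ℝ) :
    ∫ s in (0 : ℝ)..t, f s = ∫ s in Iic t, f s ∂timeMeasure T := by
  have hset : Iic t ∩ Icc 0 T = Icc 0 t := by
    rw [← Ici_inter_Iic, ← Ici_inter_Iic, inter_left_comm, Iic_inter_Iic, min_eq_left ht.2]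
  rw [intervalIntegral.integral_of_le ht.1, timeMeasure,
    Measure.restrict_restrict measurableSet_Iic, ← integral_Icc_eq_integral_Ioc, hset]

theorem integral_timeMeasure {T : ℝ} (hT : 0 ≤ T) (f : ℝ → ℝ) :
    ∫ s, f s ∂timeMeasure T = ∫ s in (0 : ℝ)..T, f s := by
  rw [intervalIntegral.integral_of_le hT, timeMeasure, integral_Icc_eq_integral_Ioc]

theorem integral_unitMeasure (f : ℝ → ℝ) : ∫ x, f x ∂unitMeasure = ∫ x in (0 : ℝ)..1, f x :=
  integral_timeMeasure zero_le_one f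

theorem intervalIntegrable_of_integrable_timeMeasure {T t : ℝ} (ht : t ∈ Icc 0 T) {f : ℝ → ℝ}
    (hf : Integrable f (timeMeasure T)) : IntervalIntegrable f volume 0 t := by
  rw [intervalIntegrable_iff_integrableOn_Icc_of_le ht.1]
  exact IntegrableOn.mono_set hf (Icc_subset_Icc_right ht.2)

theorem intervalIntegrable_of_integrable_unitMeasure {g : ℝ → ℝ} (hg : Integrable g unitMeasure)
    {x : ℝ} (hx : x ∈ Icc (0 : ℝ) 1) : IntervalIntegrable g volume 0 x :=
  intervalIntegrable_of_integrable_timeMeasure hx hg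

theorem intervalIntegral_congr_timeMeasure {T t : ℝ} (ht : t ∈ Icc 0 T) {f g : ℝ → ℝ}
    (h : ∀ᵐ s ∂timeMeasure T, f s = g s) :
    ∫ s in (0 : ℝ)..t, f s = ∫ s in (0 : ℝ)..t, g s := by
  simp_rw [intervalIntegral_eq_setIntegral_timeMeasure ht]
  exact integral_congr_ae (ae_restrict_of_ae h)

theorem intervalIntegral_integral_swap {T t : ℝ} (ht : t ∈ Icc 0 T) {F : ℝ → ℝ → ℝ}
    (hF : Integrable (fun p : ℝ × ℝ => F p.1 p.2) ((timeMeasure T).prod unitMeasure)) :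
    Integrable (fun y => ∫ s in (0 : ℝ)..t, F s y) unitMeasure ∧
    ∫ s in (0 : ℝ)..t, ∫ y, F s y ∂unitMeasure
      = ∫ y, (∫ s in (0 : ℝ)..t, F s y) ∂unitMeasure := by
  have hF_past : Integrable (fun p : ℝ × ℝ => F p.1 p.2)
      (((timeMeasure T).restrict (Iic t)).prod unitMeasure) :=
    hF.mono_measure (Measure.prod_mono Measure.restrict_le_self le_rfl)
  simp_rw [intervalIntegral_eq_setIntegral_timeMeasure ht]
  exact ⟨hF_past.integral_prod_right, integral_integral_swap hF_past⟩

end Measures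

section Primitive

/-- The Volterra kernel `1_{y ≤ x}`; writing primitives through it makes them jointly measurable
and lets Fubini's theorem stand in for integration by parts. -/
def leKernel (x y : ℝ) : ℝ := if y ≤ x then 1 else 0

theorem measurable_leKernel : Measurable fun p : ℝ × ℝ => leKernel p.1 p.2 :=
  Measurable.ite (measurableSet_le measurable_snd measurable_fst) measurable_const measurable_const

theorem abs_leKernel_le (x y : ℝ) : |leKernel x y| ≤ 1 := by
  unfold leKernel; split_ifs <;> simp

/-- The primitive on `[0,1]` that vanishes at `0`. -/
def primitive (g : ℝ → ℝ) (x : ℝ) : ℝ := ∫ y, leKernel x y * g y ∂unitMeasure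

/-- The integral of `D` from `y` to `1`, the adjoint of `primitive`. -/
def tailIntegral (D : ℝ → ℝ) (y : ℝ) : ℝ := ∫ x, leKernel x y * D x ∂unitMeasure

theorem primitive_eq_intervalIntegral (g : ℝ → ℝ) {x : ℝ} (hx : x ∈ Icc (0 : ℝ) 1) :
    primitive g x = ∫ y in (0 : ℝ)..x, g y := by
  have hkernel : ∀ y, leKernel x y * g y = (Iic x).indicator g y := fun y => by
    simp [leKernel, indicator_apply]
  simp_rw [primitive, hkernel]
  rw [integral_indicator measurableSet_Iic]
  exact (intervalIntegral_eq_setIntegral_timeMeasure hx g).symm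

theorem tailIntegral_eq_intervalIntegral (D : ℝ → ℝ) {y : ℝ} (hy : y ∈ Icc (0 : ℝ) 1) :
    tailIntegral D y = ∫ x in y..1, D x := by
  have hkernel : ∀ x, leKernel x y * D x = (Ici y).indicator D x := fun x => by
    simp [leKernel, indicator_apply]
  have hset : Ici y ∩ Icc 0 1 = Icc y 1 := by
    rw [← Ici_inter_Iic, ← Ici_inter_Iic, ← inter_assoc, Ici_inter_Ici, max_eq_left hy.1]
  simp_rw [tailIntegral, hkernel]
  rw [intervalIntegral.integral_of_le hy.2, unitMeasure, ← integral_Icc_eq_integral_Ioc,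
    integral_indicator measurableSet_Ici, Measure.restrict_restrict measurableSet_Ici,
    hset]

theorem primitive_zero (g : ℝ → ℝ) : primitive g 0 = 0 := by
  rw [primitive_eq_intervalIntegral g (left_mem_Icc.2 zero_le_one), intervalIntegral.integral_same]

theorem primitive_one (g : ℝ → ℝ) : primitive g 1 = ∫ x, g x ∂unitMeasure := by
  rw [primitive_eq_intervalIntegral g (right_mem_Icc.2 zero_le_one), integral_unitMeasure]

theorem primitive_congr {g g' : ℝ → ℝ} (h : g =ᵐ[unitMeasure] g') (x : ℝ) :
    primitive g x = primitive g' x :=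
  integral_congr_ae (h.mono fun y hy => by simp only [hy])

theorem integrable_leKernel_mul {g : ℝ → ℝ} (hg : Integrable g unitMeasure) (x : ℝ) :
    Integrable (fun y => leKernel x y * g y) unitMeasure :=
  hg.bdd_mul (c := 1) (measurable_leKernel.comp measurable_prodMk_left).aestronglyMeasurable
    (Eventually.of_forall fun y => abs_leKernel_le x y)

theorem continuousOn_primitive {g : ℝ → ℝ} (hg : Integrable g unitMeasure) :
    ContinuousOn (primitive g) (Icc 0 1) := by
  have hcont := intervalIntegral.continuousOn_primitive_interval (a := 0) (b := 1) (f := g)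
    (μ := volume) (by rwa [uIcc_of_le zero_le_one])
  rw [uIcc_of_le zero_le_one] at hcont
  exact hcont.congr fun x hx => primitive_eq_intervalIntegral g hx

theorem integral_mul_primitive {D ξ : ℝ → ℝ} (hD : Integrable D unitMeasure)
    (hξ : Integrable ξ unitMeasure) :
    ∫ x, D x * primitive ξ x ∂unitMeasure = ∫ y, ξ y * tailIntegral D y ∂unitMeasure := by
  have h_int : Integrable (Function.uncurry fun x y => leKernel x y * (D x * ξ y))
      (unitMeasure.prod unitMeasure) :=
    (hD.mul_prod hξ).bdd_mul (c := 1) measurable_leKernel.aestronglyMeasurable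
      (Eventually.of_forall fun p => abs_leKernel_le p.1 p.2)
  calc ∫ x, D x * primitive ξ x ∂unitMeasure
      = ∫ x, (∫ y, leKernel x y * (D x * ξ y) ∂unitMeasure) ∂unitMeasure := by
        simp only [primitive, ← integral_const_mul, mul_left_comm]
    _ = ∫ y, (∫ x, leKernel x y * (D x * ξ y) ∂unitMeasure) ∂unitMeasure :=
        integral_integral_swap h_int
    _ = ∫ y, ξ y * tailIntegral D y ∂unitMeasure := by
        simp only [tailIntegral, ← integral_const_mul, ← mul_assoc, mul_comm]

theorem memLp_leKernel_mul {α : Type*} [MeasurableSpace α] {ν : Measure α}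
    {F : (α × ℝ) × ℝ → ℝ} (hF : MemLp F 2 ((ν.prod unitMeasure).prod unitMeasure)) :
    MemLp (fun z => leKernel z.1.2 z.2 * F z) 2 ((ν.prod unitMeasure).prod unitMeasure) := by
  have hk : Measurable fun z : (α × ℝ) × ℝ => leKernel z.1.2 z.2 :=
    measurable_leKernel.comp ((measurable_snd.comp measurable_fst).prodMk measurable_snd)
  refine hF.of_le (hk.aestronglyMeasurable.mul hF.1) (Eventually.of_forall fun z => ?_)
  rw [norm_mul]
  exact mul_le_of_le_one_left (norm_nonneg _) (abs_leKernel_le _ _)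

theorem measurePreserving_forget_middle {α : Type*} [MeasurableSpace α] {ν : Measure α}
    [SFinite ν] :
    MeasurePreserving (fun z : (α × ℝ) × ℝ => (z.1.1, z.2))
      ((ν.prod unitMeasure).prod unitMeasure) (ν.prod unitMeasure) :=
  measurePreserving_fst.prod (MeasurePreserving.id unitMeasure)

theorem memLp_primitive {α : Type*} [MeasurableSpace α] {ν : Measure α} [IsFiniteMeasure ν]
    {F : α → ℝ → ℝ} (hF : MemLp (fun p : α × ℝ => F p.1 p.2) 2 (ν.prod unitMeasure)) :
    MemLp (fun p : α × ℝ => primitive (F p.1) p.2) 2 (ν.prod unitMeasure) :=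
  memLp_integral_of_memLp (F := fun (p : α × ℝ) y => leKernel p.2 y * F p.1 y)
    (memLp_leKernel_mul (hF.comp_measurePreserving measurePreserving_forget_middle))

theorem integral_sq_primitive_le {α : Type*} [MeasurableSpace α] {ν : Measure α}
    [IsFiniteMeasure ν] {F : α → ℝ → ℝ}
    (hF : MemLp (fun p : α × ℝ => F p.1 p.2) 2 (ν.prod unitMeasure)) :
    ∫ p, primitive (F p.1) p.2 ^ 2 ∂(ν.prod unitMeasure)
      ≤ ∫ p, F p.1 p.2 ^ 2 ∂(ν.prod unitMeasure) := by
  have hmp := measurePreserving_forget_middle (ν := ν)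
  have hF3 := hF.comp_measurePreserving hmp
  have hkF3 := memLp_leKernel_mul hF3
  calc ∫ p, primitive (F p.1) p.2 ^ 2 ∂(ν.prod unitMeasure)
      ≤ ∫ z, (leKernel z.1.2 z.2 * F z.1.1 z.2) ^ 2 ∂((ν.prod unitMeasure).prod unitMeasure) :=
        integral_sq_integral_le (F := fun (p : α × ℝ) y => leKernel p.2 y * F p.1 y) hkF3
    _ ≤ ∫ z, F z.1.1 z.2 ^ 2 ∂((ν.prod unitMeasure).prod unitMeasure) := by
        refine integral_mono hkF3.integrable_sq hF3.integrable_sq fun z => ?_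
        simp only [mul_pow]
        exact mul_le_of_le_one_left (sq_nonneg _)
          ((sq_le_one_iff_abs_le_one _).2 (abs_leKernel_le _ _))
    _ = ∫ p, F p.1 p.2 ^ 2 ∂(ν.prod unitMeasure) := by
        have hF_sq : AEStronglyMeasurable (fun p : α × ℝ => F p.1 p.2 ^ 2)
            (((ν.prod unitMeasure).prod unitMeasure).map fun z => (z.1.1, z.2)) := by
          rw [hmp.map_eq]
          exact hF.1.pow 2
        rw [← integral_map hmp.aemeasurable hF_sq, hmp.map_eq]

end Primitive

section Convex

variable {ρ : ℝ → ℝ}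

/-- The primitive of `ρ` vanishing at `0`. -/
def firstPrim (ρ : ℝ → ℝ) (a : ℝ) : ℝ := ∫ s in (0 : ℝ)..a, ρ s

/-- The second primitive of `ρ`, vanishing at `0` with its derivative; for `0 ≤ ρ` it is the convex
function measured by the energy inequality. -/
def secondPrim (ρ : ℝ → ℝ) (a : ℝ) : ℝ := ∫ s in (0 : ℝ)..a, firstPrim ρ s

theorem hasDerivAt_firstPrim (hρ : Continuous ρ) (a : ℝ) : HasDerivAt (firstPrim ρ) (ρ a) a :=
  hρ.integral_hasStrictDerivAt 0 a |>.hasDerivAt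

theorem continuous_firstPrim (hρ : Continuous ρ) : Continuous (firstPrim ρ) :=
  continuous_iff_continuousAt.2 fun a => (hasDerivAt_firstPrim hρ a).continuousAt

theorem continuous_secondPrim (hρ : Continuous ρ) : Continuous (secondPrim ρ) :=
  continuous_firstPrim (continuous_firstPrim hρ)

theorem firstPrim_sub (hρ : Continuous ρ) (a b : ℝ) :
    firstPrim ρ a - firstPrim ρ b = ∫ s in b..a, ρ s :=
  intervalIntegral.integral_interval_sub_left (hρ.intervalIntegrable _ _)
    (hρ.intervalIntegrable _ _)

theorem abs_firstPrim_sub_le (hρ : Continuous ρ) {C : ℝ} (hC : ∀ a, |ρ a| ≤ C) (a b : ℝ) :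
    |firstPrim ρ a - firstPrim ρ b| ≤ C * |a - b| := by
  rw [firstPrim_sub hρ]
  exact intervalIntegral.norm_integral_le_of_norm_le_const (f := ρ) fun x _ => hC x

theorem firstPrim_zero : firstPrim ρ 0 = 0 := intervalIntegral.integral_same

theorem abs_firstPrim_le (hρ : Continuous ρ) {C : ℝ} (hC : ∀ a, |ρ a| ≤ C) (a : ℝ) :
    |firstPrim ρ a| ≤ C * |a| := by
  simpa [firstPrim_zero] using abs_firstPrim_sub_le hρ hC a 0

theorem monotone_firstPrim (hρ : Continuous ρ) (h0 : ∀ a, 0 ≤ ρ a) : Monotone (firstPrim ρ) :=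
  fun a b hab => by
    rw [← sub_nonneg, firstPrim_sub hρ]
    exact intervalIntegral.integral_nonneg hab fun x _ => h0 x

theorem secondPrim_sub_le (hρ : Continuous ρ) (h0 : ∀ a, 0 ≤ ρ a) (a b : ℝ) :
    secondPrim ρ a - secondPrim ρ b ≤ firstPrim ρ a * (a - b) := by
  have hc := continuous_firstPrim hρ
  have hmono := monotone_firstPrim hρ h0
  have hsub : secondPrim ρ a - secondPrim ρ b = ∫ s in b..a, firstPrim ρ s := firstPrim_sub hc a b
  rw [hsub]
  rcases le_total b a with hba | hab
  · have h := intervalIntegral.integral_mono_on hba (hc.intervalIntegrable b a)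
      (intervalIntegrable_const (μ := volume)) fun x hx => hmono hx.2
    rw [intervalIntegral.integral_const, smul_eq_mul] at h
    linarith
  · have h := intervalIntegral.integral_mono_on hab (intervalIntegrable_const (μ := volume))
      (hc.intervalIntegrable a b) fun x hx => hmono hx.1
    rw [intervalIntegral.integral_const, smul_eq_mul] at h
    rw [intervalIntegral.integral_symm]
    linarith

theorem secondPrim_zero : secondPrim ρ 0 = 0 := intervalIntegral.integral_same

theorem secondPrim_nonneg (hρ : Continuous ρ) (h0 : ∀ a, 0 ≤ ρ a) (a : ℝ) :
    0 ≤ secondPrim ρ a := by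
  have h := secondPrim_sub_le hρ h0 0 a
  rw [firstPrim_zero, secondPrim_zero] at h
  linarith

theorem secondPrim_le_mul_sq (hρ : Continuous ρ) (h0 : ∀ a, 0 ≤ ρ a) {C : ℝ}
    (hC : ∀ a, |ρ a| ≤ C) (a : ℝ) : secondPrim ρ a ≤ C * a ^ 2 :=
  calc secondPrim ρ a ≤ firstPrim ρ a * a := by
        simpa [secondPrim_zero] using secondPrim_sub_le hρ h0 a 0
    _ ≤ |firstPrim ρ a| * |a| := (le_abs_self _).trans_eq (abs_mul _ _)
    _ ≤ C * |a| * |a| := by gcongr; exact abs_firstPrim_le hρ hC a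
    _ = C * a ^ 2 := by rw [mul_assoc, ← sq, sq_abs]

end Convex

section ChainRule

theorem absolutelyContinuousOnInterval_comp_of_abs_sub_le {φ f : ℝ → ℝ} {a b C : ℝ}
    (hφ : ∀ x y, |φ x - φ y| ≤ C * |x - y|) (hf : AbsolutelyContinuousOnInterval f a b) :
    AbsolutelyContinuousOnInterval (fun x => φ (f x)) a b := by
  rw [absolutelyContinuousOnInterval_iff] at hf ⊢
  intro ε hε
  obtain ⟨δ, hδ, h⟩ := hf (ε / (|C| + 1)) (by positivity)
  refine ⟨δ, hδ, fun E hE hEδ => ?_⟩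
  calc ∑ i ∈ Finset.range E.1, dist (φ (f (E.2 i).1)) (φ (f (E.2 i).2))
      ≤ ∑ i ∈ Finset.range E.1, (|C| + 1) * dist (f (E.2 i).1) (f (E.2 i).2) :=
        Finset.sum_le_sum fun i _ => (hφ _ _).trans <| by
          rw [Real.dist_eq]; gcongr; linarith [le_abs_self C]
    _ < ε := by
        rw [← Finset.mul_sum, mul_comm, ← lt_div_iff₀ (by positivity)]
        exact h E hE hEδ

theorem firstPrim_comp_primitive {ρ : ℝ → ℝ} (hρ : Continuous ρ) {C : ℝ} (hC : ∀ a, |ρ a| ≤ C)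
    {g w : ℝ → ℝ} (hg : Integrable g unitMeasure)
    (hw : ∀ x ∈ Icc (0 : ℝ) 1, w x = w 0 + primitive g x) :
    ∀ x ∈ Icc (0 : ℝ) 1,
      firstPrim ρ (w x) = firstPrim ρ (w 0) + primitive (fun y => ρ (w y) * g y) x := by
  intro x hx
  have hgx := intervalIntegrable_of_integrable_unitMeasure hg hx
  let W : ℝ → ℝ := fun y => w 0 + ∫ v in (0 : ℝ)..y, g v
  have hWw : ∀ y ∈ Icc (0 : ℝ) 1, W y = w y := fun y hy => by
    rw [hw y hy, primitive_eq_intervalIntegral g hy]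
  have hac : AbsolutelyContinuousOnInterval (fun y => firstPrim ρ (W y)) 0 x :=
    absolutelyContinuousOnInterval_comp_of_abs_sub_le (φ := fun a => firstPrim ρ (w 0 + a))
      (fun a b => by simpa using abs_firstPrim_sub_le hρ hC (w 0 + a) (w 0 + b))
      (hgx.absolutelyContinuousOnInterval_intervalIntegral left_mem_uIcc)
  have hderiv : ∀ᵐ y, y ∈ uIoc 0 x → deriv (fun y => firstPrim ρ (W y)) y = ρ (w y) * g y := by
    filter_upwards [hgx.ae_hasDerivAt_integral] with y hy hyx
    have hy1 : y ∈ Icc (0 : ℝ) 1 := by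
      rw [uIoc_of_le hx.1] at hyx
      exact ⟨hyx.1.le, hyx.2.trans hx.2⟩
    have hW : HasDerivAt W (g y) y := (hy (uIoc_subset_uIcc hyx) 0 left_mem_uIcc).const_add _
    rw [← hWw y hy1]
    exact ((hasDerivAt_firstPrim hρ (W y)).comp y hW).deriv
  have hftc := hac.integral_deriv_eq_sub
  rw [intervalIntegral.integral_congr_ae hderiv, hWw x hx,
    hWw 0 (left_mem_Icc.2 zero_le_one)] at hftc
  rw [primitive_eq_intervalIntegral _ hx, hftc, add_sub_cancel]

end ChainRule

section WeakDerivative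

theorem hasWeakDeriv_primitive {w g : ℝ → ℝ} (hg : Integrable g unitMeasure)
    (hw : ∀ x ∈ Icc (0 : ℝ) 1, w x = w 0 + primitive g x) : HasWeakDeriv w g := by
  intro φ hφ _ hsupp
  have hz : ∀ x, x ∉ Ioo (0 : ℝ) 1 → φ x = 0 := fun x hx =>
    image_eq_zero_of_notMem_tsupport fun h => hx (hsupp h)
  have hdc : Continuous (deriv φ) := hφ.continuous_deriv (by simp)
  have hdi : Integrable (deriv φ) unitMeasure :=
    hdc.continuousOn.integrableOn_compact isCompact_Icc
  have htail : ∀ y ∈ Icc (0 : ℝ) 1, tailIntegral (deriv φ) y = - φ y := fun y hy => by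
    rw [tailIntegral_eq_intervalIntegral _ hy, intervalIntegral.integral_deriv_eq_sub
      (fun x _ => hφ.differentiable (by simp) x) (hdc.intervalIntegrable _ _), hz 1 (by simp),
      zero_sub]
  have hmean : ∫ x, deriv φ x ∂unitMeasure = 0 := by
    rw [integral_unitMeasure, ← tailIntegral_eq_intervalIntegral _ (left_mem_Icc.2 zero_le_one),
      htail 0 (left_mem_Icc.2 zero_le_one), hz 0 (by simp), neg_zero]
  have hpi : Integrable (fun x => deriv φ x * primitive g x) unitMeasure :=
    (hdc.continuousOn.mul (continuousOn_primitive hg)).integrableOn_compact isCompact_Icc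
  calc ∫ x, w x * deriv φ x ∂unitMeasure
      = ∫ x, (w 0 * deriv φ x + deriv φ x * primitive g x) ∂unitMeasure :=
        integral_congr_ae (ae_unitMeasure_mem.mono fun x hx => by simp only [hw x hx]; ring)
    _ = ∫ y, g y * tailIntegral (deriv φ) y ∂unitMeasure := by
        rw [integral_add (hdi.const_mul _) hpi, integral_const_mul, hmean, mul_zero, zero_add,
          integral_mul_primitive hdi hg]
    _ = -∫ y, g y * φ y ∂unitMeasure := by
        rw [← integral_neg]
        exact integral_congr_ae (ae_unitMeasure_mem.mono fun x hx => by
          simp only [htail x hx, mul_neg])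

theorem isH1_of_eq_primitive {w g : ℝ → ℝ} (hg : MemLp g 2 unitMeasure)
    (hw : ∀ x ∈ Icc (0 : ℝ) 1, w x = w 0 + primitive g x) : IsH1 w g := by
  have hgi := hg.integrable one_le_two
  have hc : ContinuousOn w (Icc 0 1) :=
    (continuousOn_const.add (continuousOn_primitive hgi)).congr hw
  obtain ⟨C, hC⟩ := isCompact_Icc.exists_bound_of_continuousOn hc
  exact ⟨MemLp.of_bound (hc.aestronglyMeasurable measurableSet_Icc) C
    (ae_unitMeasure_mem.mono hC), hg, hasWeakDeriv_primitive hgi hw, hc⟩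

theorem eq_apply_zero_of_hasWeakDeriv_zero {h : ℝ → ℝ} (hc : ContinuousOn h (Icc 0 1))
    (hh : HasWeakDeriv h 0) : ∀ x ∈ Icc (0 : ℝ) 1, h x = h 0 := by
  obtain ⟨c, hconst⟩ := exists_ae_eq_const_of_forall_integral_mul_deriv_eq_zero zero_lt_one
    (hc.mono Ioo_subset_Icc_self |>.locallyIntegrableOn measurableSet_Ioo) fun φ hφ hφc hφs => by
      have hsupp : ∀ x ∉ Icc (0 : ℝ) 1, h x * deriv φ x = 0 := fun x hx => by
        have hx' := fun h => hx (Ioo_subset_Icc_self (hφs (support_deriv_subset h)))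
        rw [Function.notMem_support.1 hx', mul_zero]
      rw [← setIntegral_eq_integral_of_forall_compl_eq_zero hsupp]
      exact (hh φ hφ hφc hφs).trans (by simp)
  have hae : h =ᵐ[volume.restrict (Icc 0 1)] fun _ => c := by
    rw [← Measure.restrict_congr_set Ioo_ae_eq_Icc]
    exact (ae_restrict_iff' measurableSet_Ioo).2 hconst
  have heq := Measure.eqOn_Icc_of_ae_eq volume zero_ne_one hae hc continuousOn_const
  exact fun x hx => (heq hx).trans (heq (left_mem_Icc.2 zero_le_one)).symm

theorem IsH1.eq_primitive {w g : ℝ → ℝ} (h : IsH1 w g) :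
    ∀ x ∈ Icc (0 : ℝ) 1, w x = w 0 + primitive g x := by
  have hgi := h.memLp_deriv.integrable one_le_two
  have hP := continuousOn_primitive hgi
  have hweak : HasWeakDeriv (fun x => w x - primitive g x) 0 := fun φ hφ hφc hφs => by
    have hdc : ContinuousOn (deriv φ) (Icc 0 1) := (hφ.continuous_deriv (by simp)).continuousOn
    have hPφ := hasWeakDeriv_primitive (w := primitive g) hgi
      (fun x _ => by rw [primitive_zero, zero_add]) φ hφ hφc hφs
    simp only [sub_mul, Pi.zero_apply, zero_mul, integral_zero, neg_zero]
    have hw_int : Integrable (fun x => w x * deriv φ x) unitMeasure :=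
      (h.continuousOn.mul hdc).integrableOn_compact isCompact_Icc
    have hP_int : Integrable (fun x => primitive g x * deriv φ x) unitMeasure :=
      (hP.mul hdc).integrableOn_compact isCompact_Icc
    rw [integral_sub hw_int hP_int, h.hasWeakDeriv φ hφ hφc hφs, hPφ, sub_self]
  intro x hx
  have hconst := eq_apply_zero_of_hasWeakDeriv_zero (h.continuousOn.sub hP) hweak x hx
  rw [Pi.sub_apply, Pi.sub_apply, primitive_zero] at hconst
  linarith

end WeakDerivative

section FluxSolution

/-- A function `w` on `[0,T] × [0,1]` with generalized space derivative `g` that solves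
`∂_t w = ∂_x f` weakly, with fluxes `q₁`, `q₀` into `[0,1]` through the end points and with
initial value `w₀`, tested against monomials. -/
structure IsFluxSolution (T : ℝ) (w g f : ℝ → ℝ → ℝ) (q₀ q₁ w₀ : ℝ → ℝ) : Prop where
  memLp : MemLp (fun p : ℝ × ℝ => w p.1 p.2) 2 ((timeMeasure T).prod unitMeasure)
  memLp_deriv : MemLp (fun p : ℝ × ℝ => g p.1 p.2) 2 ((timeMeasure T).prod unitMeasure)
  memLp_flux : MemLp (fun p : ℝ × ℝ => f p.1 p.2) 2 ((timeMeasure T).prod unitMeasure)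
  memLp_left : MemLp q₀ 2 (timeMeasure T)
  memLp_right : MemLp q₁ 2 (timeMeasure T)
  memLp_init : MemLp w₀ 2 unitMeasure
  eq_primitive : ∀ᵐ t ∂timeMeasure T, ∀ x ∈ Icc (0 : ℝ) 1, w t x = w t 0 + primitive (g t) x
  moments : ∀ᵐ t ∂timeMeasure T, ∀ m : ℕ, ∫ x, (w t x - w₀ x) * x ^ m ∂unitMeasure
    = ∫ s in (0 : ℝ)..t, (-(∫ x, f s x * (m * x ^ (m - 1)) ∂unitMeasure) + q₁ s + q₀ s * 0 ^ m)

theorem primitive_pow (n : ℕ) {x : ℝ} (hx : x ∈ Icc (0 : ℝ) 1) :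
    primitive (fun y => (n + 1) * y ^ n) x = x ^ (n + 1) := by
  rw [primitive_eq_intervalIntegral _ hx, intervalIntegral.integral_const_mul, integral_pow]
  have hn : (n : ℝ) + 1 ≠ 0 := by positivity
  field_simp
  simp

theorem memLp_pow (n : ℕ) : MemLp (fun x : ℝ => x ^ n) 2 unitMeasure :=
  MemLp.of_bound (by fun_prop) 1 (ae_unitMeasure_mem.mono fun x hx => by
    rw [norm_pow, Real.norm_eq_abs, abs_of_nonneg hx.1]
    exact pow_le_one₀ hx.1 hx.2)

theorem integrable_pow_mul (n : ℕ) {F : ℝ → ℝ} (hF : Integrable F unitMeasure) :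
    Integrable (fun x => x ^ n * F x) unitMeasure :=
  IntegrableOn.continuousOn_mul (continuous_pow n).continuousOn hF isCompact_Icc

section Trace

variable {α : Type*} [MeasurableSpace α] {ν : Measure α} [IsFiniteMeasure ν] {w g : α → ℝ → ℝ}

theorem memLp_trace_zero (hw : MemLp (fun p : α × ℝ => w p.1 p.2) 2 (ν.prod unitMeasure))
    (hg : MemLp (fun p : α × ℝ => g p.1 p.2) 2 (ν.prod unitMeasure))
    (hwg : ∀ᵐ t ∂ν, ∀ x ∈ Icc (0 : ℝ) 1, w t x = w t 0 + primitive (g t) x) :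
    MemLp (fun t => w t 0) 2 ν := by
  have hmean := memLp_integral_of_memLp (F := fun t x => w t x - primitive (g t) x)
    (hw.sub (memLp_primitive hg))
  refine hmean.ae_eq (hwg.mono fun t ht => ?_)
  calc ∫ y, (w t y - primitive (g t) y) ∂unitMeasure = ∫ _, w t 0 ∂unitMeasure :=
        integral_congr_ae (ae_unitMeasure_mem.mono fun x hx => by
          simp only [ht x hx, add_sub_cancel_right])
    _ = w t 0 := by simp

theorem memLp_trace_one (hw : MemLp (fun p : α × ℝ => w p.1 p.2) 2 (ν.prod unitMeasure))
    (hg : MemLp (fun p : α × ℝ => g p.1 p.2) 2 (ν.prod unitMeasure))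
    (hwg : ∀ᵐ t ∂ν, ∀ x ∈ Icc (0 : ℝ) 1, w t x = w t 0 + primitive (g t) x) :
    MemLp (fun t => w t 1) 2 ν := by
  refine ((memLp_trace_zero hw hg hwg).add (memLp_integral_of_memLp hg)).ae_eq ?_
  filter_upwards [hwg] with t ht
  rw [ht 1 (right_mem_Icc.2 zero_le_one), primitive_one]
  rfl

end Trace

section TailIntegral

variable {D : ℝ → ℝ}

theorem tailIntegral_sub {E : ℝ → ℝ} (hD : Integrable D unitMeasure)
    (hE : Integrable E unitMeasure) (y : ℝ) :
    tailIntegral (fun x => D x - E x) y = tailIntegral D y - tailIntegral E y := by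
  have hk : ∀ {F : ℝ → ℝ}, Integrable F unitMeasure →
      Integrable (fun x => leKernel x y * F x) unitMeasure := fun hF =>
    hF.bdd_mul (c := 1) (measurable_leKernel.comp measurable_prodMk_right).aestronglyMeasurable
      (Eventually.of_forall fun x => abs_leKernel_le x y)
  simp only [tailIntegral, mul_sub]
  exact integral_sub (hk hD) (hk hE)

theorem continuousOn_tailIntegral (hD : Integrable D unitMeasure) :
    ContinuousOn (tailIntegral D) (Icc 0 1) := by
  refine (continuousOn_const.sub (continuousOn_primitive hD)).congr
    (f := fun y => (∫ x in (0 : ℝ)..1, D x) - primitive D y) fun y hy => ?_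
  beta_reduce
  rw [tailIntegral_eq_intervalIntegral D hy, primitive_eq_intervalIntegral D hy,
    intervalIntegral.integral_interval_sub_left
      (intervalIntegrable_of_integrable_unitMeasure hD (right_mem_Icc.2 zero_le_one))
      (intervalIntegrable_of_integrable_unitMeasure hD hy)]

theorem integral_mul_pow_succ (hD : Integrable D unitMeasure) (n : ℕ) :
    ∫ x, D x * x ^ (n + 1) ∂unitMeasure = (n + 1) * ∫ y, y ^ n * tailIntegral D y ∂unitMeasure := by
  have hpow : Integrable (fun y : ℝ => ((n : ℝ) + 1) * y ^ n) unitMeasure :=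
    ((memLp_pow n).integrable one_le_two).const_mul _
  have h := integral_mul_primitive hD hpow
  simp only [mul_assoc, integral_const_mul] at h
  rw [← h]
  exact integral_congr_ae (ae_unitMeasure_mem.mono fun x hx => by simp only [primitive_pow n hx])

end TailIntegral

theorem neg_integral_mul_deriv_pow_add (n : ℕ) {F : ℝ → ℝ} (hF : Integrable F unitMeasure)
    (q : ℝ) :
    -(∫ x, F x * ((n + 1) * x ^ n) ∂unitMeasure) + q
      = (n + 1) * ∫ y, y ^ n * (q - F y) ∂unitMeasure := by
  have hq : ∫ y, y ^ n * q ∂unitMeasure = q / (n + 1) := by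
    rw [integral_mul_const, integral_unitMeasure, integral_pow]
    simp [inv_mul_eq_div]
  have hF_mul : ∫ x, F x * ((n + 1) * x ^ n) ∂unitMeasure
      = (n + 1) * ∫ x, x ^ n * F x ∂unitMeasure := by
    rw [← integral_const_mul]
    exact integral_congr_ae (Eventually.of_forall fun x => by simp only; ring)
  simp_rw [mul_sub]
  rw [integral_sub (integrable_pow_mul n (integrable_const _)) (integrable_pow_mul n hF), hq,
    hF_mul]
  field_simp
  ring

variable {T : ℝ} {w g f : ℝ → ℝ → ℝ} {q₀ q₁ w₀ : ℝ → ℝ}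

theorem IsFluxSolution.memLp_right_sub_flux (h : IsFluxSolution T w g f q₀ q₁ w₀) :
    MemLp (fun p : ℝ × ℝ => q₁ p.1 - f p.1 p.2) 2 ((timeMeasure T).prod unitMeasure) :=
  (h.memLp_right.comp_fst unitMeasure).sub h.memLp_flux

theorem IsFluxSolution.integral_eq (h : IsFluxSolution T w g f q₀ q₁ w₀) :
    ∀ᵐ t ∂timeMeasure T, ∫ x, (w t x - w₀ x) ∂unitMeasure
      = ∫ s in (0 : ℝ)..t, (q₁ s + q₀ s) := by
  filter_upwards [h.moments] with t ht
  simpa using ht 0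

theorem IsFluxSolution.moments_succ (h : IsFluxSolution T w g f q₀ q₁ w₀) :
    ∀ᵐ t ∂timeMeasure T, ∀ n : ℕ, ∫ x, (w t x - w₀ x) * x ^ (n + 1) ∂unitMeasure
      = (n + 1) * ∫ y, y ^ n * (∫ s in (0 : ℝ)..t, (q₁ s - f s y)) ∂unitMeasure := by
  filter_upwards [h.moments, ae_timeMeasure_mem T] with t hmoments htT n
  have hpow_int : Integrable (fun p : ℝ × ℝ => p.2 ^ n * (q₁ p.1 - f p.1 p.2))
      ((timeMeasure T).prod unitMeasure) :=
    ((memLp_pow n).comp_snd (timeMeasure T)).integrable_mul h.memLp_right_sub_flux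
  calc ∫ x, (w t x - w₀ x) * x ^ (n + 1) ∂unitMeasure
      = ∫ s in (0 : ℝ)..t, (n + 1) * ∫ y, y ^ n * (q₁ s - f s y) ∂unitMeasure := by
        rw [hmoments (n + 1)]
        refine intervalIntegral_congr_timeMeasure htT ?_
        filter_upwards [ae_memLp_slice h.memLp_flux] with s hs
        rw [← neg_integral_mul_deriv_pow_add n (hs.integrable one_le_two)]
        simp
    _ = (n + 1) * ∫ y, y ^ n * (∫ s in (0 : ℝ)..t, (q₁ s - f s y)) ∂unitMeasure := by
        rw [intervalIntegral.integral_const_mul, (intervalIntegral_integral_swap htT hpow_int).2]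
        simp only [intervalIntegral.integral_const_mul]

theorem IsFluxSolution.tailIntegral_eq (h : IsFluxSolution T w g f q₀ q₁ w₀) :
    ∀ᵐ t ∂timeMeasure T, ∀ᵐ y ∂unitMeasure, tailIntegral (fun x => w t x - w₀ x) y
      = ∫ s in (0 : ℝ)..t, (q₁ s - f s y) := by
  filter_upwards [h.moments_succ, ae_timeMeasure_mem T, ae_memLp_slice h.memLp]
    with t hmoments htT hwt
  have hD : Integrable (fun x => w t x - w₀ x) unitMeasure :=
    (hwt.sub h.memLp_init).integrable one_le_two
  have hflux_int := (intervalIntegral_integral_swap htT (F := fun s y => q₁ s - f s y)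
    (h.memLp_right_sub_flux.integrable one_le_two)).1
  have htail_int : Integrable (tailIntegral fun x => w t x - w₀ x) unitMeasure :=
    (continuousOn_tailIntegral hD).integrableOn_compact isCompact_Icc
  have hzero := ae_eq_zero_of_moments_eq_zero (htail_int.sub hflux_int) fun n => by
    have hn := hmoments n
    rw [integral_mul_pow_succ hD] at hn
    simp only [Pi.sub_apply, mul_sub]
    exact (integral_sub (integrable_pow_mul n htail_int) (integrable_pow_mul n hflux_int)).trans
      (sub_eq_zero.2 (mul_left_cancel₀ (by positivity) hn))
  exact hzero.mono fun y hy => sub_eq_zero.1 hy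

end FluxSolution

section Shift

theorem measurableSet_cylinder (T : ℝ) : MeasurableSet (cylinder T) :=
  measurableSet_Icc.prod measurableSet_Icc

theorem measurePreserving_shift (r : ℝ) :
    MeasurePreserving (fun p : ℝ × ℝ => (p.1 - r, p.2)) volume volume := by
  rw [Measure.volume_eq_prod]
  exact (measurePreserving_sub_right volume r).prod (MeasurePreserving.id volume)

theorem integrable_mul_translate {A B : ℝ × ℝ → ℝ} (hA : MemLp A 2 volume)
    (hB : MemLp B 2 volume) (ν : Measure ℝ) [IsFiniteMeasure ν] :
    Integrable (Function.uncurry fun (r : ℝ) (p : ℝ × ℝ) => A p * B (p.1 - r, p.2))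
      (ν.prod volume) := by
  have hmp : MeasurePreserving (fun z : ℝ × (ℝ × ℝ) => (z.1, ((z.2.1 - z.1, z.2.2) : ℝ × ℝ)))
      (ν.prod volume) (ν.prod volume) :=
    (MeasurePreserving.id ν).skew_product
      (g := fun (r : ℝ) (p : ℝ × ℝ) => ((p.1 - r, p.2) : ℝ × ℝ))
      (by fun_prop) (Eventually.of_forall fun r => (measurePreserving_shift r).map_eq)
  exact (hA.comp_snd ν).integrable_mul ((hB.comp_snd ν).comp_measurePreserving hmp)

theorem integral_mul_intervalIntegral_translate {A B : ℝ × ℝ → ℝ} (hA : MemLp A 2 volume)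
    (hB : MemLp B 2 volume) {h : ℝ} (hh : 0 ≤ h) :
    Integrable (fun p => A p * ∫ r in (0 : ℝ)..h, B (p.1 - r, p.2)) volume ∧
    ∫ p, A p * ∫ r in (0 : ℝ)..h, B (p.1 - r, p.2)
      = ∫ r in (0 : ℝ)..h, ∫ p : ℝ × ℝ, A p * B (p.1 - r, p.2) := by
  have h_int := integrable_mul_translate hA hB (volume.restrict (Ioc 0 h))
  simp_rw [intervalIntegral.integral_of_le hh, ← integral_const_mul]
  exact ⟨h_int.integral_prod_right, (integral_integral_swap h_int).symm⟩

theorem memLp_indicator_cylinder {T : ℝ} {F : ℝ × ℝ → ℝ}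
    (hF : MemLp F 2 ((timeMeasure T).prod unitMeasure)) :
    MemLp ((cylinder T).indicator F) 2 volume := by
  rw [memLp_indicator_iff_restrict (measurableSet_cylinder T), restrict_cylinder]
  exact hF

theorem integral_cylinder_eq {T : ℝ} (F : ℝ × ℝ → ℝ) :
    ∫ p, F p ∂((timeMeasure T).prod unitMeasure) = ∫ p, (cylinder T).indicator F p := by
  rw [integral_indicator (measurableSet_cylinder T), restrict_cylinder]

theorem ae_prod_mem_cylinder (T : ℝ) :
    ∀ᵐ p ∂((timeMeasure T).prod unitMeasure), p ∈ cylinder T := by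
  rw [← restrict_cylinder]
  exact ae_restrict_mem (measurableSet_cylinder T)

end Shift

section TimeCorrelation

/-- The integral of `b` over the time window `[t - r, t]`, with `b` extended by zero outside
`[0,T] × [0,1]`. -/
def windowIntegral (T : ℝ) (b : ℝ × ℝ → ℝ) (r : ℝ) (p : ℝ × ℝ) : ℝ :=
  ∫ s in (0 : ℝ)..r, (cylinder T).indicator b (p.1 - s, p.2)

/-- The correlation `∫ a(t,x) b(t - r,x)` of two functions on `[0,T] × [0,1]` extended by zero,
as a function of the time lag `r`. -/
def timeCorrelation (T : ℝ) (a b : ℝ × ℝ → ℝ) (r : ℝ) : ℝ :=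
  ∫ p : ℝ × ℝ, (cylinder T).indicator a p * (cylinder T).indicator b (p.1 - r, p.2)

variable {T : ℝ} {a b : ℝ × ℝ → ℝ}

theorem continuous_timeCorrelation (ha : MemLp a 2 ((timeMeasure T).prod unitMeasure))
    (hb : MemLp b 2 ((timeMeasure T).prod unitMeasure)) : Continuous (timeCorrelation T a b) :=
  continuous_integral_mul_translate (memLp_indicator_cylinder ha) (memLp_indicator_cylinder hb)

theorem timeCorrelation_zero (T : ℝ) (a b : ℝ × ℝ → ℝ) :
    timeCorrelation T a b 0 = ∫ p, a p * b p ∂((timeMeasure T).prod unitMeasure) := by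
  simp only [timeCorrelation, sub_zero, integral_cylinder_eq, Prod.mk.eta]
  exact integral_congr_ae (Eventually.of_forall fun p => (congrFun (indicator_mul _ a b) p).symm)

theorem integrable_mul_windowIntegral (ha : MemLp a 2 ((timeMeasure T).prod unitMeasure))
    (hb : MemLp b 2 ((timeMeasure T).prod unitMeasure)) {r : ℝ} (hr : 0 ≤ r) :
    Integrable (fun p => a p * windowIntegral T b r p) ((timeMeasure T).prod unitMeasure) := by
  have h_int := (integral_mul_intervalIntegral_translate (memLp_indicator_cylinder ha)
    (memLp_indicator_cylinder hb) hr).1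
  rw [← restrict_cylinder]
  refine h_int.integrableOn.congr_fun (fun p hp => ?_) (measurableSet_cylinder T)
  simp only [indicator_of_mem hp, windowIntegral]

theorem intervalIntegral_timeCorrelation (ha : MemLp a 2 ((timeMeasure T).prod unitMeasure))
    (hb : MemLp b 2 ((timeMeasure T).prod unitMeasure)) {r : ℝ} (hr : 0 ≤ r) :
    ∫ s in (0 : ℝ)..r, timeCorrelation T a b s
      = ∫ p, a p * windowIntegral T b r p ∂((timeMeasure T).prod unitMeasure) := by
  rw [integral_cylinder_eq]
  refine (integral_mul_intervalIntegral_translate (memLp_indicator_cylinder ha)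
    (memLp_indicator_cylinder hb) hr).2.symm.trans (integral_congr_ae (Eventually.of_forall
      fun p => ?_))
  exact (indicator_mul_left (cylinder T) a (windowIntegral T b r)).symm

theorem indicator_cylinder_of_mem {y : ℝ} (hy : y ∈ Icc (0 : ℝ) 1) (b : ℝ × ℝ → ℝ) (s : ℝ) :
    (cylinder T).indicator b (s, y) = (Icc 0 T).indicator (fun s => b (s, y)) s := by
  by_cases hs : s ∈ Icc 0 T
  · rw [indicator_of_mem hs, indicator_of_mem (show (s, y) ∈ cylinder T from ⟨hs, hy⟩)]
  · rw [indicator_of_notMem hs, indicator_of_notMem fun h => hs h.1]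

theorem ae_integrable_indicator_cylinder
    (hb : Integrable b ((timeMeasure T).prod unitMeasure)) :
    ∀ᵐ y ∂unitMeasure, Integrable fun s => (cylinder T).indicator b (s, y) := by
  filter_upwards [hb.swap.prod_right_ae, ae_unitMeasure_mem] with y hy hy_mem
  simp_rw [indicator_cylinder_of_mem hy_mem]
  exact (integrable_indicator_iff measurableSet_Icc).2 hy

theorem sub_mem_cylinder_iff {p : ℝ × ℝ} (hp : p ∈ cylinder T) {r : ℝ} (hr : 0 ≤ r) :
    (p.1 - r, p.2) ∈ cylinder T ↔ r ≤ p.1 :=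
  ⟨fun h => sub_nonneg.1 h.1.1,
    fun h => ⟨⟨sub_nonneg.2 h, (sub_le_self _ hr).trans hp.1.2⟩, hp.2⟩⟩

theorem integral_indicator_shift_le (hb : Integrable b ((timeMeasure T).prod unitMeasure))
    (hb0 : ∀ p, 0 ≤ b p) (r : ℝ) :
    ∫ p, (cylinder T).indicator b (p.1 - r, p.2) ∂((timeMeasure T).prod unitMeasure)
      ≤ ∫ p, b p ∂((timeMeasure T).prod unitMeasure) := by
  have hmp := measurePreserving_shift r
  have hb_int : Integrable ((cylinder T).indicator b) volume := by
    rwa [integrable_indicator_iff (measurableSet_cylinder T), IntegrableOn, restrict_cylinder]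
  calc ∫ p, (cylinder T).indicator b (p.1 - r, p.2) ∂((timeMeasure T).prod unitMeasure)
      ≤ ∫ p : ℝ × ℝ, (cylinder T).indicator b (p.1 - r, p.2) := by
        rw [← restrict_cylinder]
        exact setIntegral_le_integral (hmp.integrable_comp_of_integrable hb_int)
          (Eventually.of_forall fun p => indicator_nonneg (fun _ _ => hb0 _) _)
    _ = ∫ p, (cylinder T).indicator b p :=
        (hmp.hasLaw (X := fun p : ℝ × ℝ => (p.1 - r, p.2))).integral_comp
          hb_int.aestronglyMeasurable
    _ = ∫ p, b p ∂((timeMeasure T).prod unitMeasure) := (integral_cylinder_eq b).symm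

theorem mul_le_of_forall_one_sub_exp_mul_le {Γ : ℝ → ℝ} (hΓ : Continuous Γ) {K Y : ℝ}
    (h : ∀ r > 0, (1 - Real.exp (-(K * r))) * Y ≤ ∫ s in (0 : ℝ)..r, Γ s) : K * Y ≤ Γ 0 := by
  have hintegral : HasDerivAt (fun r => ∫ s in (0 : ℝ)..r, Γ s) (Γ 0) 0 :=
    intervalIntegral.integral_hasDerivAt_right (hΓ.intervalIntegrable _ _)
      (hΓ.stronglyMeasurableAtFilter _ _) hΓ.continuousAt
  have hexp : HasDerivAt (fun r : ℝ => Real.exp (-(K * r))) (-K) 0 := by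
    simpa using ((hasDerivAt_id (0 : ℝ)).const_mul K).neg.exp
  have hslope := (hintegral.fun_sub ((hexp.const_sub 1).mul_const Y)).hasDerivWithinAt (s := Ioi 0)
  rw [hasDerivWithinAt_iff_tendsto_slope' (by simp)] at hslope
  have hnonneg : 0 ≤ Γ 0 - -(-K) * Y := by
    refine ge_of_tendsto hslope (eventually_mem_nhdsWithin.mono fun r hr => ?_)
    simp only [slope_def_field, intervalIntegral.integral_same, mul_zero, neg_zero, Real.exp_zero,
      sub_self, zero_mul, sub_zero]
    exact div_nonneg (sub_nonneg.2 (h r hr)) (mem_Ioi.1 hr).le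
  linarith

end TimeCorrelation

section Increment

variable {T : ℝ} {w g f : ℝ → ℝ → ℝ} {q₀ q₁ w₀ : ℝ → ℝ}

/-- The function `w` extended by its initial value to negative times. -/
def pastExtension (w : ℝ → ℝ → ℝ) (w₀ : ℝ → ℝ) (t x : ℝ) : ℝ := if t < 0 then w₀ x else w t x

theorem pastExtension_of_neg {t : ℝ} (ht : t < 0) : pastExtension w w₀ t = w₀ :=
  funext fun _ => if_pos ht

theorem pastExtension_of_nonneg {t : ℝ} (ht : 0 ≤ t) : pastExtension w w₀ t = w t :=
  funext fun _ => if_neg ht.not_gt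

theorem intervalIntegral_indicator_of_neg {t : ℝ} (ht : t < 0) (b : ℝ → ℝ) :
    ∫ s in (0 : ℝ)..t, (Icc 0 T).indicator b s = 0 := by
  refine intervalIntegral.integral_zero_ae ((Measure.ae_ne volume 0).mono fun s hs0 hs => ?_)
  rw [uIoc_of_ge ht.le] at hs
  exact indicator_of_notMem (fun h => hs0 (le_antisymm hs.2 h.1)) _

theorem intervalIntegral_indicator_of_mem {t : ℝ} (ht : t ∈ Icc 0 T) (b : ℝ → ℝ) :
    ∫ s in (0 : ℝ)..t, (Icc 0 T).indicator b s = ∫ s in (0 : ℝ)..t, b s := by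
  refine intervalIntegral.integral_congr fun s hs => ?_
  rw [uIcc_of_le ht.1] at hs
  exact indicator_of_mem (show s ∈ Icc 0 T from ⟨hs.1, hs.2.trans ht.2⟩) _

theorem intervalIntegral_sub_eq_integral_comp_sub {b : ℝ → ℝ} (hb : Integrable b) (t r : ℝ) :
    (∫ s in (0 : ℝ)..t, b s) - ∫ s in (0 : ℝ)..(t - r), b s = ∫ s in (0 : ℝ)..r, b (t - s) := by
  rw [intervalIntegral.integral_comp_sub_left, sub_zero]
  exact intervalIntegral.integral_interval_sub_left hb.intervalIntegrable hb.intervalIntegrable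

theorem IsFluxSolution.pastExtension_eq (h : IsFluxSolution T w g f q₀ q₁ w₀) :
    ∀ᵐ t : ℝ, t ≤ T → Integrable (pastExtension w w₀ t) unitMeasure ∧
      (∫ x, (pastExtension w w₀ t x - w₀ x) ∂unitMeasure
        = ∫ s in (0 : ℝ)..t, (Icc 0 T).indicator (fun s => q₁ s + q₀ s) s) ∧
      ∀ᵐ y ∂unitMeasure, tailIntegral (fun x => pastExtension w w₀ t x - w₀ x) y
        = ∫ s in (0 : ℝ)..t, (cylinder T).indicator (fun p => q₁ p.1 - f p.1 p.2) (s, y) := by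
  have hmass := h.integral_eq
  have htail := h.tailIntegral_eq
  have hslice := ae_memLp_slice h.memLp
  rw [timeMeasure, ae_restrict_iff' measurableSet_Icc] at hmass htail hslice
  filter_upwards [hmass, htail, hslice] with t hmass htail hslice htT
  rcases lt_or_ge t 0 with ht | ht
  · rw [pastExtension_of_neg ht, intervalIntegral_indicator_of_neg ht]
    refine ⟨h.memLp_init.integrable one_le_two, by simp, ?_⟩
    filter_upwards [ae_unitMeasure_mem] with y hy
    simp_rw [indicator_cylinder_of_mem hy]
    rw [intervalIntegral_indicator_of_neg ht]
    simp [tailIntegral]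
  · have ht_mem : t ∈ Icc 0 T := ⟨ht, htT⟩
    rw [pastExtension_of_nonneg ht, intervalIntegral_indicator_of_mem ht_mem]
    refine ⟨(hslice ht_mem).integrable one_le_two, hmass ht_mem, ?_⟩
    filter_upwards [ae_unitMeasure_mem, htail ht_mem] with y hy htail
    simp_rw [indicator_cylinder_of_mem hy]
    rw [intervalIntegral_indicator_of_mem ht_mem, htail]

theorem IsFluxSolution.increment_eq (h : IsFluxSolution T w g f q₀ q₁ w₀) {r : ℝ} (hr : 0 < r) :
    ∀ᵐ t ∂timeMeasure T, Integrable (fun x => w t x - pastExtension w w₀ (t - r) x) unitMeasure ∧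
      (∫ x, (w t x - pastExtension w w₀ (t - r) x) ∂unitMeasure
        = ∫ s in (0 : ℝ)..r, (Icc 0 T).indicator (fun s => q₁ s + q₀ s) (t - s)) ∧
      ∀ᵐ y ∂unitMeasure, tailIntegral (fun x => w t x - pastExtension w w₀ (t - r) x) y
        = windowIntegral T (fun p => q₁ p.1 - f p.1 p.2) r (t, y) := by
  have hflux := ae_integrable_indicator_cylinder (h.memLp_right_sub_flux.integrable one_le_two)
  have hboundary : Integrable ((Icc 0 T).indicator fun s => q₁ s + q₀ s) volume :=
    (integrable_indicator_iff measurableSet_Icc).2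
      ((h.memLp_right.add h.memLp_left).integrable one_le_two)
  have hinit := h.memLp_init.integrable one_le_two
  have hpast := (measurePreserving_sub_right volume r).quasiMeasurePreserving.ae h.pastExtension_eq
  rw [timeMeasure, ae_restrict_iff' measurableSet_Icc]
  filter_upwards [h.pastExtension_eq, hpast] with t hnow hpast ht
  obtain ⟨hnow_int, hnow_mass, hnow_tail⟩ := hnow ht.2
  obtain ⟨hpast_int, hpast_mass, hpast_tail⟩ := hpast (by linarith [ht.2])
  rw [pastExtension_of_nonneg ht.1] at hnow_int hnow_mass hnow_tail
  have hnow_sub : Integrable (fun x => w t x - w₀ x) unitMeasure := hnow_int.sub hinit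
  have hpast_sub : Integrable (fun x => pastExtension w w₀ (t - r) x - w₀ x) unitMeasure :=
    hpast_int.sub hinit
  have hsplit : (fun x => w t x - pastExtension w w₀ (t - r) x)
      = fun x => (w t x - w₀ x) - (pastExtension w w₀ (t - r) x - w₀ x) := by
    ext x; ring
  refine ⟨hnow_int.sub hpast_int, ?_, ?_⟩
  · rw [hsplit, integral_sub hnow_sub hpast_sub, hnow_mass, hpast_mass,
      intervalIntegral_sub_eq_integral_comp_sub hboundary]
  · filter_upwards [hnow_tail, hpast_tail, hflux] with y hnow_tail hpast_tail hflux
    rw [hsplit, tailIntegral_sub hnow_sub hpast_sub, hnow_tail, hpast_tail,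
      intervalIntegral_sub_eq_integral_comp_sub hflux]
    rfl

end Increment

section Energy

variable {T : ℝ} {w g f : ℝ → ℝ → ℝ} {q₀ q₁ w₀ ρ : ℝ → ℝ} {C K : ℝ}

theorem integrable_comp_mul_of_bounded {α : Type*} [TopologicalSpace α] [MeasurableSpace α]
    [OpensMeasurableSpace α] {s : Set α} (hs : MeasurableSet s) {μ : Measure α} {v G : α → ℝ}
    (hρ : Continuous ρ) (hC : ∀ a, |ρ a| ≤ C) (hv : ContinuousOn v s)
    (hG : Integrable G (μ.restrict s)) : Integrable (fun y => ρ (v y) * G y) (μ.restrict s) :=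
  hG.bdd_mul ((hρ.comp_continuousOn hv).aestronglyMeasurable hs)
    (Eventually.of_forall fun _ => hC _)

theorem integral_mul_firstPrim_comp {D v G : ℝ → ℝ} (hρ : Continuous ρ) (hC : ∀ a, |ρ a| ≤ C)
    (hD : Integrable D unitMeasure) (hG : Integrable G unitMeasure)
    (hv : ∀ x ∈ Icc (0 : ℝ) 1, v x = v 0 + primitive G x) :
    ∫ x, firstPrim ρ (v x) * D x ∂unitMeasure
      = ∫ y, (firstPrim ρ (v 0) * (∫ x, D x ∂unitMeasure)
          + ρ (v y) * G y * tailIntegral D y) ∂unitMeasure := by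
  have hv_cont : ContinuousOn v (Icc 0 1) :=
    (continuousOn_const.add (continuousOn_primitive hG)).congr hv
  have hξ : Integrable (fun y => ρ (v y) * G y) unitMeasure :=
    integrable_comp_mul_of_bounded measurableSet_Icc hρ hC hv_cont hG
  have hD_primitive : Integrable (fun x => D x * primitive (fun y => ρ (v y) * G y) x)
      unitMeasure := by
    simp_rw [mul_comm (D _)]
    exact IntegrableOn.continuousOn_mul (continuousOn_primitive hξ) hD isCompact_Icc
  have hξ_tail : Integrable (fun y => ρ (v y) * G y * tailIntegral D y) unitMeasure := by
    simp_rw [mul_comm (ρ _ * G _)]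
    exact IntegrableOn.continuousOn_mul (continuousOn_tailIntegral hD) hξ isCompact_Icc
  calc ∫ x, firstPrim ρ (v x) * D x ∂unitMeasure
      = ∫ x, (firstPrim ρ (v 0) * D x
          + D x * primitive (fun y => ρ (v y) * G y) x) ∂unitMeasure :=
        integral_congr_ae (ae_unitMeasure_mem.mono fun x hx => by
          simp only [firstPrim_comp_primitive hρ hC hG hv x hx]; ring)
    _ = _ := by
        rw [integral_add (hD.const_mul _) hD_primitive, integral_const_mul,
          integral_mul_primitive hD hξ, integral_add (integrable_const _) hξ_tail]
        simp

theorem IsFluxSolution.integral_firstPrim_mul_increment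
    (h : IsFluxSolution T w g f q₀ q₁ w₀) (hρ : Continuous ρ) (hC : ∀ a, |ρ a| ≤ C) {r : ℝ}
    (hr : 0 < r) :
    ∀ᵐ t ∂timeMeasure T,
      ∫ x, firstPrim ρ (w t x) * (w t x - pastExtension w w₀ (t - r) x) ∂unitMeasure
      = ∫ y, (firstPrim ρ (w t 0) * windowIntegral T (fun p => q₁ p.1 + q₀ p.1) r (t, y)
          + ρ (w t y) * g t y * windowIntegral T (fun p => q₁ p.1 - f p.1 p.2) r (t, y))
          ∂unitMeasure := by
  filter_upwards [h.increment_eq hr, h.eq_primitive, ae_memLp_slice h.memLp_deriv]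
    with t ⟨h_int, hmass, htail⟩ hprim hg
  rw [integral_mul_firstPrim_comp hρ hC h_int (hg.integrable one_le_two) hprim, hmass]
  refine integral_congr_ae ?_
  filter_upwards [ae_unitMeasure_mem, htail] with y hy htail
  simp only [htail, windowIntegral, indicator_cylinder_of_mem hy]

theorem memLp_firstPrim_comp {α : Type*} [MeasurableSpace α] {μ : Measure α} {F : α → ℝ}
    (hρ : Continuous ρ) (hC : ∀ a, |ρ a| ≤ C) (hF : MemLp F 2 μ) :
    MemLp (fun p => firstPrim ρ (F p)) 2 μ :=
  hF.of_le_mul ((continuous_firstPrim hρ).comp_aestronglyMeasurable hF.1)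
    (Eventually.of_forall fun _ => abs_firstPrim_le hρ hC _)

theorem integrable_secondPrim_comp {α : Type*} [MeasurableSpace α] {μ : Measure α} {F : α → ℝ}
    (hρ : Continuous ρ) (h0 : ∀ a, 0 ≤ ρ a) (hC : ∀ a, |ρ a| ≤ C) (hF : MemLp F 2 μ) :
    Integrable (fun p => secondPrim ρ (F p)) μ :=
  (hF.integrable_sq.const_mul C).mono' ((continuous_secondPrim hρ).comp_aestronglyMeasurable hF.1)
    (Eventually.of_forall fun p => by
      rw [Real.norm_eq_abs, abs_of_nonneg (secondPrim_nonneg hρ h0 _)]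
      exact secondPrim_le_mul_sq hρ h0 hC _)

theorem ae_norm_exp_le_one (T : ℝ) (hK : 0 ≤ K) :
    ∀ᵐ p ∂((timeMeasure T).prod unitMeasure), ‖Real.exp (-(K * p.1))‖ ≤ 1 := by
  filter_upwards [ae_prod_mem_cylinder T] with p hp
  rw [Real.norm_eq_abs, Real.abs_exp, Real.exp_le_one_iff, neg_nonpos]
  exact mul_nonneg hK hp.1.1

theorem memLp_exp_mul (hK : 0 ≤ K) {F : ℝ × ℝ → ℝ}
    (hF : MemLp F 2 ((timeMeasure T).prod unitMeasure)) :
    MemLp (fun p => Real.exp (-(K * p.1)) * F p) 2 ((timeMeasure T).prod unitMeasure) :=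
  hF.of_le (AEStronglyMeasurable.mul (by fun_prop) hF.1) ((ae_norm_exp_le_one T hK).mono fun p hp =>
    (norm_mul _ _).trans_le (mul_le_of_le_one_left (norm_nonneg _) hp))

theorem integrable_exp_mul (hK : 0 ≤ K) {F : ℝ × ℝ → ℝ}
    (hF : Integrable F ((timeMeasure T).prod unitMeasure)) :
    Integrable (fun p => Real.exp (-(K * p.1)) * F p) ((timeMeasure T).prod unitMeasure) :=
  hF.bdd_mul (by fun_prop) (ae_norm_exp_le_one T hK)

theorem memLp_pastExtension_shift (hw : MemLp (fun p : ℝ × ℝ => w p.1 p.2) 2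
    ((timeMeasure T).prod unitMeasure)) (hw₀ : MemLp w₀ 2 unitMeasure) {r : ℝ} (hr : 0 ≤ r) :
    MemLp (fun p : ℝ × ℝ => pastExtension w w₀ (p.1 - r) p.2) 2
      ((timeMeasure T).prod unitMeasure) := by
  have hlate : MemLp (fun p : ℝ × ℝ => (cylinder T).indicator (fun p => w p.1 p.2)
      (p.1 - r, p.2)) 2 ((timeMeasure T).prod unitMeasure) := by
    rw [← restrict_cylinder]
    exact ((memLp_indicator_cylinder hw).comp_measurePreserving
      (measurePreserving_shift r)).restrict _
  have hearly : MemLp ({p : ℝ × ℝ | p.1 < r}.indicator fun p => w₀ p.2) 2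
      ((timeMeasure T).prod unitMeasure) :=
    (hw₀.comp_snd (timeMeasure T)).indicator (measurableSet_lt measurable_fst measurable_const)
  refine (hlate.add hearly).ae_eq ?_
  filter_upwards [ae_prod_mem_cylinder T] with p hp
  rcases lt_or_ge p.1 r with hpr | hpr
  · simp [pastExtension, hpr, mt (sub_mem_cylinder_iff hp hr).1 hpr.not_ge]
  · simp [pastExtension, hpr.not_gt, (sub_mem_cylinder_iff hp hr).2 hpr]

theorem integral_exp_mul_comp_pastExtension_le {Ψ : ℝ → ℝ} (hΨ : ∀ a, 0 ≤ Ψ a)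
    (h_int : Integrable (fun p : ℝ × ℝ => Real.exp (-(K * p.1)) * Ψ (w p.1 p.2))
      ((timeMeasure T).prod unitMeasure))
    (hinit : ∀ᵐ x ∂unitMeasure, Ψ (w₀ x) = 0) {r : ℝ} (hr : 0 ≤ r) :
    ∫ p, Real.exp (-(K * p.1)) * Ψ (pastExtension w w₀ (p.1 - r) p.2)
        ∂((timeMeasure T).prod unitMeasure)
      ≤ Real.exp (-(K * r)) * ∫ p, Real.exp (-(K * p.1)) * Ψ (w p.1 p.2)
        ∂((timeMeasure T).prod unitMeasure) := by
  have hinit_prod : ∀ᵐ p ∂((timeMeasure T).prod unitMeasure), Ψ (w₀ p.2) = 0 :=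
    Measure.quasiMeasurePreserving_snd.ae hinit
  calc ∫ p, Real.exp (-(K * p.1)) * Ψ (pastExtension w w₀ (p.1 - r) p.2)
        ∂((timeMeasure T).prod unitMeasure)
      = ∫ p, Real.exp (-(K * r)) * (cylinder T).indicator
          (fun p => Real.exp (-(K * p.1)) * Ψ (w p.1 p.2)) (p.1 - r, p.2)
          ∂((timeMeasure T).prod unitMeasure) := by
        refine integral_congr_ae ?_
        filter_upwards [ae_prod_mem_cylinder T, hinit_prod] with p hp hp_init
        rcases lt_or_ge p.1 r with hpr | hpr
        · simp [pastExtension, hpr, mt (sub_mem_cylinder_iff hp hr).1 hpr.not_ge, hp_init]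
        · rw [indicator_of_mem ((sub_mem_cylinder_iff hp hr).2 hpr),
            pastExtension_of_nonneg (sub_nonneg.2 hpr), ← mul_assoc, ← Real.exp_add]
          ring_nf
    _ ≤ _ := by
        rw [integral_const_mul]
        exact mul_le_mul_of_nonneg_left (integral_indicator_shift_le h_int
          (fun p => mul_nonneg (Real.exp_pos _).le (hΨ _)) r) (Real.exp_pos _).le

theorem IsFluxSolution.integrable_exp_mul_firstPrim_mul_increment
    (h : IsFluxSolution T w g f q₀ q₁ w₀) (hρ : Continuous ρ) (hC : ∀ a, |ρ a| ≤ C)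
    (hK : 0 ≤ K) {r : ℝ} (hr : 0 ≤ r) :
    Integrable (fun p : ℝ × ℝ => Real.exp (-(K * p.1)) *
        (firstPrim ρ (w p.1 p.2) * (w p.1 p.2 - pastExtension w w₀ (p.1 - r) p.2)))
      ((timeMeasure T).prod unitMeasure) :=
  integrable_exp_mul hK ((memLp_firstPrim_comp hρ hC h.memLp).integrable_mul
    (h.memLp.sub (memLp_pastExtension_shift h.memLp h.memLp_init hr)))

theorem IsFluxSolution.discrete_energy_le (h : IsFluxSolution T w g f q₀ q₁ w₀)
    (hρ : Continuous ρ) (h0 : ∀ a, 0 ≤ ρ a) (hC : ∀ a, |ρ a| ≤ C)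
    (hinit : ∀ᵐ x ∂unitMeasure, secondPrim ρ (w₀ x) = 0) (hK : 0 ≤ K) {r : ℝ} (hr : 0 ≤ r) :
    (1 - Real.exp (-(K * r))) * ∫ p, Real.exp (-(K * p.1)) * secondPrim ρ (w p.1 p.2)
        ∂((timeMeasure T).prod unitMeasure)
      ≤ ∫ p, Real.exp (-(K * p.1)) *
          (firstPrim ρ (w p.1 p.2) * (w p.1 p.2 - pastExtension w w₀ (p.1 - r) p.2))
        ∂((timeMeasure T).prod unitMeasure) := by
  have hnow := integrable_exp_mul hK (integrable_secondPrim_comp hρ h0 hC h.memLp)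
  have hpast := integrable_exp_mul hK (integrable_secondPrim_comp hρ h0 hC
    (memLp_pastExtension_shift h.memLp h.memLp_init hr))
  have hconvex : ∫ p, (Real.exp (-(K * p.1)) * secondPrim ρ (w p.1 p.2)
        - Real.exp (-(K * p.1)) * secondPrim ρ (pastExtension w w₀ (p.1 - r) p.2))
        ∂((timeMeasure T).prod unitMeasure)
      ≤ ∫ p, Real.exp (-(K * p.1)) *
          (firstPrim ρ (w p.1 p.2) * (w p.1 p.2 - pastExtension w w₀ (p.1 - r) p.2))
        ∂((timeMeasure T).prod unitMeasure) := by
    refine integral_mono (hnow.sub hpast)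
      (h.integrable_exp_mul_firstPrim_mul_increment hρ hC hK hr) fun p => ?_
    simp only [← mul_sub]
    exact mul_le_mul_of_nonneg_left (secondPrim_sub_le hρ h0 _ _) (Real.exp_pos _).le
  have hpast_le := integral_exp_mul_comp_pastExtension_le (secondPrim_nonneg hρ h0) hnow hinit hr
  rw [integral_sub hnow hpast] at hconvex
  linarith

theorem IsFluxSolution.memLp_comp_mul_deriv (h : IsFluxSolution T w g f q₀ q₁ w₀)
    (hρ : Continuous ρ) (hC : ∀ a, |ρ a| ≤ C) :
    MemLp (fun p : ℝ × ℝ => ρ (w p.1 p.2) * g p.1 p.2) 2 ((timeMeasure T).prod unitMeasure) :=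
  h.memLp_deriv.of_le_mul ((hρ.comp_aestronglyMeasurable h.memLp.1).mul h.memLp_deriv.1)
    (Eventually.of_forall fun _ =>
      (norm_mul _ _).trans_le (mul_le_mul_of_nonneg_right (hC _) (norm_nonneg _)))

theorem IsFluxSolution.memLp_firstPrim_zero (h : IsFluxSolution T w g f q₀ q₁ w₀)
    (hρ : Continuous ρ) (hC : ∀ a, |ρ a| ≤ C) :
    MemLp (fun p : ℝ × ℝ => firstPrim ρ (w p.1 0)) 2 ((timeMeasure T).prod unitMeasure) :=
  memLp_firstPrim_comp hρ hC
    ((memLp_trace_zero h.memLp h.memLp_deriv h.eq_primitive).comp_fst unitMeasure)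

theorem IsFluxSolution.memLp_firstPrim_one (h : IsFluxSolution T w g f q₀ q₁ w₀)
    (hρ : Continuous ρ) (hC : ∀ a, |ρ a| ≤ C) :
    MemLp (fun p : ℝ × ℝ => firstPrim ρ (w p.1 1)) 2 ((timeMeasure T).prod unitMeasure) :=
  memLp_firstPrim_comp hρ hC
    ((memLp_trace_one h.memLp h.memLp_deriv h.eq_primitive).comp_fst unitMeasure)

theorem IsFluxSolution.memLp_right_add_left (h : IsFluxSolution T w g f q₀ q₁ w₀) :
    MemLp (fun p : ℝ × ℝ => q₁ p.1 + q₀ p.1) 2 ((timeMeasure T).prod unitMeasure) :=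
  (h.memLp_right.comp_fst unitMeasure).add (h.memLp_left.comp_fst unitMeasure)

theorem IsFluxSolution.integral_exp_mul_firstPrim_mul_increment
    (h : IsFluxSolution T w g f q₀ q₁ w₀) (hρ : Continuous ρ) (hC : ∀ a, |ρ a| ≤ C)
    (hK : 0 ≤ K) {r : ℝ} (hr : 0 < r) :
    ∫ p, Real.exp (-(K * p.1)) *
        (firstPrim ρ (w p.1 p.2) * (w p.1 p.2 - pastExtension w w₀ (p.1 - r) p.2))
        ∂((timeMeasure T).prod unitMeasure)
      = ∫ s in (0 : ℝ)..r,
        (timeCorrelation T (fun p => Real.exp (-(K * p.1)) * firstPrim ρ (w p.1 0))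
            (fun p => q₁ p.1 + q₀ p.1) s
          + timeCorrelation T (fun p => Real.exp (-(K * p.1)) * (ρ (w p.1 p.2) * g p.1 p.2))
            (fun p => q₁ p.1 - f p.1 p.2) s) := by
  have hzero := memLp_exp_mul hK (h.memLp_firstPrim_zero hρ hC)
  have hderiv := memLp_exp_mul hK (h.memLp_comp_mul_deriv hρ hC)
  have hzero_int := integrable_mul_windowIntegral hzero h.memLp_right_add_left hr.le
  have hderiv_int := integrable_mul_windowIntegral hderiv h.memLp_right_sub_flux hr.le
  rw [intervalIntegral.integral_add
      ((continuous_timeCorrelation hzero h.memLp_right_add_left).intervalIntegrable _ _)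
      ((continuous_timeCorrelation hderiv h.memLp_right_sub_flux).intervalIntegrable _ _),
    intervalIntegral_timeCorrelation hzero h.memLp_right_add_left hr.le,
    intervalIntegral_timeCorrelation hderiv h.memLp_right_sub_flux hr.le,
    ← integral_add hzero_int hderiv_int]
  refine (integral_prod _
    (h.integrable_exp_mul_firstPrim_mul_increment hρ hC hK hr.le)).trans
      (Eq.trans (integral_congr_ae ?_) (integral_prod _ (hzero_int.add hderiv_int)).symm)
  filter_upwards [h.integral_firstPrim_mul_increment hρ hC hr] with t ht
  simp only [integral_const_mul, ht, Pi.add_apply, mul_assoc, ← mul_add]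

theorem IsFluxSolution.integral_exp_mul_comp_mul_deriv_sub_eq_zero
    (h : IsFluxSolution T w g f q₀ q₁ w₀) (hρ : Continuous ρ) (hC : ∀ a, |ρ a| ≤ C)
    (hK : 0 ≤ K) :
    ∫ p, Real.exp (-(K * p.1)) * (q₁ p.1 * (ρ (w p.1 p.2) * g p.1 p.2
        - (firstPrim ρ (w p.1 1) - firstPrim ρ (w p.1 0)))) ∂((timeMeasure T).prod unitMeasure)
      = 0 := by
  have h_int := integrable_exp_mul hK ((h.memLp_right.comp_fst unitMeasure).integrable_mul
    ((h.memLp_comp_mul_deriv hρ hC).sub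
      ((h.memLp_firstPrim_one hρ hC).sub (h.memLp_firstPrim_zero hρ hC))))
  refine (integral_prod _ h_int).trans (integral_eq_zero_of_ae ?_)
  filter_upwards [h.eq_primitive, ae_memLp_slice h.memLp_deriv,
    ae_memLp_slice (h.memLp_comp_mul_deriv hρ hC)] with t hprim hg hξ
  have hchain := firstPrim_comp_primitive hρ hC (hg.integrable one_le_two) hprim 1
    (right_mem_Icc.2 zero_le_one)
  rw [primitive_one] at hchain
  simp only [integral_const_mul, Pi.mul_apply, Pi.sub_apply]
  rw [integral_sub (hξ.integrable one_le_two) (integrable_const _), hchain]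
  simp

theorem IsFluxSolution.integrable_exp_mul_dissipation (h : IsFluxSolution T w g f q₀ q₁ w₀)
    (hρ : Continuous ρ) (hC : ∀ a, |ρ a| ≤ C) (hK : 0 ≤ K) :
    Integrable (fun p : ℝ × ℝ => Real.exp (-(K * p.1)) * (q₁ p.1 * firstPrim ρ (w p.1 1)
      + q₀ p.1 * firstPrim ρ (w p.1 0) - f p.1 p.2 * (ρ (w p.1 p.2) * g p.1 p.2)))
      ((timeMeasure T).prod unitMeasure) :=
  integrable_exp_mul hK
    ((((h.memLp_right.comp_fst unitMeasure).integrable_mul (h.memLp_firstPrim_one hρ hC)).add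
      ((h.memLp_left.comp_fst unitMeasure).integrable_mul (h.memLp_firstPrim_zero hρ hC))).sub
        (h.memLp_flux.integrable_mul (h.memLp_comp_mul_deriv hρ hC)))

theorem IsFluxSolution.energy_le (h : IsFluxSolution T w g f q₀ q₁ w₀)
    (hρ : Continuous ρ) (h0 : ∀ a, 0 ≤ ρ a) (hC : ∀ a, |ρ a| ≤ C)
    (hinit : ∀ᵐ x ∂unitMeasure, secondPrim ρ (w₀ x) = 0) (hK : 0 ≤ K) :
    K * ∫ p, Real.exp (-(K * p.1)) * secondPrim ρ (w p.1 p.2) ∂((timeMeasure T).prod unitMeasure)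
      ≤ ∫ p, Real.exp (-(K * p.1)) * (q₁ p.1 * firstPrim ρ (w p.1 1)
          + q₀ p.1 * firstPrim ρ (w p.1 0) - f p.1 p.2 * (ρ (w p.1 p.2) * g p.1 p.2))
        ∂((timeMeasure T).prod unitMeasure) := by
  have hzero := h.memLp_firstPrim_zero hρ hC
  have hone := h.memLp_firstPrim_one hρ hC
  have hderiv := h.memLp_comp_mul_deriv hρ hC
  have hright := h.memLp_right.comp_fst unitMeasure
  have hchain_int := integrable_exp_mul hK
    (hright.integrable_mul (hderiv.sub (hone.sub hzero)))
  refine (mul_le_of_forall_one_sub_exp_mul_le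
    ((continuous_timeCorrelation (memLp_exp_mul hK hzero) h.memLp_right_add_left).add
      (continuous_timeCorrelation (memLp_exp_mul hK hderiv) h.memLp_right_sub_flux))
    fun r hr => (h.discrete_energy_le hρ h0 hC hinit hK hr.le).trans_eq
      (h.integral_exp_mul_firstPrim_mul_increment hρ hC hK hr)).trans_eq ?_
  have hsum := integral_add
    ((memLp_exp_mul hK hzero).integrable_mul h.memLp_right_add_left)
    ((memLp_exp_mul hK hderiv).integrable_mul h.memLp_right_sub_flux)
  have hsplit := integral_add (h.integrable_exp_mul_dissipation hρ hC hK) hchain_int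
  have hchain := h.integral_exp_mul_comp_mul_deriv_sub_eq_zero hρ hC hK
  simp only [Pi.mul_apply, Pi.sub_apply] at hsum hsplit
  rw [Pi.add_apply, timeCorrelation_zero, timeCorrelation_zero, ← hsum]
  exact (integral_congr_ae (Eventually.of_forall fun p => by ring)).trans
    (hsplit.trans (by rw [hchain, add_zero]))

theorem IsFluxSolution.ae_secondPrim_eq_zero (h : IsFluxSolution T w g f q₀ q₁ w₀)
    (hρ : Continuous ρ) (h0 : ∀ a, 0 ≤ ρ a) (hC : ∀ a, |ρ a| ≤ C)
    (hinit : ∀ᵐ x ∂unitMeasure, secondPrim ρ (w₀ x) = 0) {L : ℝ} (hL : 0 ≤ L)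
    (hle : ∀ᵐ p ∂((timeMeasure T).prod unitMeasure), q₁ p.1 * firstPrim ρ (w p.1 1)
      + q₀ p.1 * firstPrim ρ (w p.1 0) - f p.1 p.2 * (ρ (w p.1 p.2) * g p.1 p.2)
      ≤ L * secondPrim ρ (w p.1 p.2)) :
    ∀ᵐ p ∂((timeMeasure T).prod unitMeasure), secondPrim ρ (w p.1 p.2) = 0 := by
  have hK : 0 ≤ L + 1 := by positivity
  have h_int := integrable_exp_mul hK (integrable_secondPrim_comp hρ h0 hC h.memLp)
  have hnonneg (p : ℝ × ℝ) : 0 ≤ Real.exp (-((L + 1) * p.1)) * secondPrim ρ (w p.1 p.2) :=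
    mul_nonneg (Real.exp_pos _).le (secondPrim_nonneg hρ h0 _)
  have henergy := (h.energy_le hρ h0 hC hinit hK).trans (integral_mono_ae
    (h.integrable_exp_mul_dissipation hρ hC hK) (h_int.const_mul L) (hle.mono fun p hp => by
      simp only [mul_left_comm L]
      exact mul_le_mul_of_nonneg_left hp (Real.exp_pos _).le))
  rw [integral_const_mul] at henergy
  have hzero := (integral_eq_zero_iff_of_nonneg hnonneg h_int).1
    (le_antisymm (by linarith) (integral_nonneg hnonneg))
  exact hzero.mono fun p hp => (mul_eq_zero.1 hp).resolve_left (Real.exp_pos _).ne'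

end Energy

section Cylinder

variable {T : ℝ}

theorem isCompact_cylinder (T : ℝ) : IsCompact (cylinder T) := isCompact_Icc.prod isCompact_Icc

theorem exists_bound_of_continuousOn_cylinder {F : ℝ × ℝ → ℝ}
    (hF : ContinuousOn F (cylinder T)) :
    ∃ C, 0 ≤ C ∧ ∀ p ∈ cylinder T, |F p| ≤ C := by
  obtain ⟨C, hC⟩ := (isCompact_cylinder T).exists_bound_of_continuousOn hF
  exact ⟨max C 0, le_max_right _ _, fun p hp => (hC p hp).trans (le_max_left _ _)⟩

theorem memLp_restrict_of_continuousOn {α : Type*} [TopologicalSpace α] [T2Space α]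
    [MeasurableSpace α] [BorelSpace α] {μ : Measure α} [IsFiniteMeasureOnCompacts μ] {K : Set α}
    (hK : IsCompact K) {F : α → ℝ} (hF : ContinuousOn F K) : MemLp F 2 (μ.restrict K) := by
  have : IsFiniteMeasure (μ.restrict K) := ⟨by simpa using hK.measure_lt_top⟩
  obtain ⟨C, hC⟩ := hK.exists_bound_of_continuousOn hF
  exact MemLp.of_bound (hF.aestronglyMeasurable_of_isCompact hK hK.measurableSet) C
    ((ae_restrict_mem hK.measurableSet).mono hC)

theorem memLp_of_continuousOn_cylinder {F : ℝ × ℝ → ℝ} (hF : ContinuousOn F (cylinder T)) :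
    MemLp F 2 ((timeMeasure T).prod unitMeasure) := by
  rw [← restrict_cylinder]
  exact memLp_restrict_of_continuousOn (isCompact_cylinder T) hF

theorem continuousOn_slice_left {F : ℝ × ℝ → ℝ} (hF : ContinuousOn F (cylinder T)) {t : ℝ}
    (ht : t ∈ Icc 0 T) : ContinuousOn (fun x => F (t, x)) (Icc 0 1) :=
  hF.comp (by fun_prop) fun _ hx => ⟨ht, hx⟩

theorem continuousOn_slice_right {F : ℝ × ℝ → ℝ} (hF : ContinuousOn F (cylinder T)) {x : ℝ}
    (hx : x ∈ Icc (0 : ℝ) 1) : ContinuousOn (fun t => F (t, x)) (Icc 0 T) :=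
  hF.comp (by fun_prop) fun _ ht => ⟨ht, hx⟩

theorem IsC.continuousOn {m n : ℕ} {G : ℝ → ℝ → ℝ} (h : IsC T m n G) :
    ContinuousOn (fun p : ℝ × ℝ => G p.1 p.2) (cylinder T) := by
  simpa using h.space_continuous 0 (Nat.zero_le _)

theorem IsC.continuousOn_spaceDeriv {m n : ℕ} {G : ℝ → ℝ → ℝ} (h : IsC T m n G) (hn : 1 ≤ n) :
    ContinuousOn (fun p : ℝ × ℝ => spaceDeriv G p.1 p.2) (cylinder T) := by
  have := h.space_continuous 1 hn
  simp only [iteratedDerivWithin_one] at this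
  exact this

theorem IsC.continuousOn_timeDeriv {m n : ℕ} {G : ℝ → ℝ → ℝ} (h : IsC T m n G) (hm : 1 ≤ m) :
    ContinuousOn (fun p : ℝ × ℝ => timeDeriv T G p.1 p.2) (cylinder T) := by
  have := h.time_continuous 1 hm
  simp only [iteratedDerivWithin_one] at this
  exact this

theorem IsC.hasDerivWithinAt_time {m n : ℕ} {G : ℝ → ℝ → ℝ} (h : IsC T m n G) (hm : 1 ≤ m)
    {t x : ℝ} (ht : t ∈ Icc 0 T) (hx : x ∈ Icc (0 : ℝ) 1) :
    HasDerivWithinAt (fun s => G s x) (timeDeriv T G t x) (Icc 0 T) t :=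
  (((h.time_contDiff x hx).differentiableOn
    (by exact_mod_cast Nat.one_le_iff_ne_zero.1 hm)) t ht).hasDerivWithinAt

theorem IsC.hasDerivWithinAt_space {m n : ℕ} {G : ℝ → ℝ → ℝ} (h : IsC T m n G) (hn : 1 ≤ n)
    {t x : ℝ} (ht : t ∈ Icc 0 T) (hx : x ∈ Icc (0 : ℝ) 1) :
    HasDerivWithinAt (G t) (spaceDeriv G t x) (Icc 0 1) x :=
  (((h.space_contDiff t ht).differentiableOn
    (by exact_mod_cast Nat.one_le_iff_ne_zero.1 hn)) x hx).hasDerivWithinAt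

theorem IsC.eq_primitive {m n : ℕ} {G : ℝ → ℝ → ℝ} (h : IsC T m n G) (hn : 1 ≤ n) {t : ℝ}
    (ht : t ∈ Icc 0 T) : ∀ x ∈ Icc (0 : ℝ) 1, G t x = G t 0 + primitive (spaceDeriv G t) x := by
  intro x hx
  have hc := continuousOn_slice_left (h.continuousOn_spaceDeriv hn) ht
  have hsub : Icc 0 x ⊆ Icc (0 : ℝ) 1 := Icc_subset_Icc_right hx.2
  rw [primitive_eq_intervalIntegral _ hx, intervalIntegral.integral_eq_sub_of_hasDerivAt_of_le hx.1
    (f := G t)]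
  · ring
  · exact ((h.space_contDiff t ht).continuousOn).mono hsub
  · intro y hy
    exact (h.hasDerivWithinAt_space hn ht (hsub (Ioo_subset_Icc_self hy))).hasDerivAt
      (Icc_mem_nhds hy.1 (hy.2.trans_le hx.2))
  · exact ContinuousOn.intervalIntegrable (by rw [uIcc_of_le hx.1]; exact hc.mono hsub)

theorem isC_pow {k l : ℕ} (m : ℕ) : IsC T k l fun _ x => x ^ m := by
  refine ⟨fun x _ => contDiffOn_const, fun t _ => (contDiff_id.pow m).contDiffOn, ?_, ?_⟩
  · intro j _
    simp only [iteratedDerivWithin_const]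
    split_ifs
    · fun_prop
    · exact continuousOn_const
  · intro k _
    have h := (ContDiffOn.continuousOn_iteratedDerivWithin (m := k) (n := k)
      ((contDiff_id.pow m).contDiffOn (s := Icc (0 : ℝ) 1)) le_rfl (uniqueDiffOn_Icc one_pos))
    exact h.comp (by fun_prop) fun p hp => hp.2

theorem timeDeriv_const (G : ℝ → ℝ) (t x : ℝ) : timeDeriv T (fun _ x => G x) t x = 0 := by
  simp [timeDeriv]

theorem spaceDeriv_pow (m : ℕ) (t : ℝ) {x : ℝ} (hx : x ∈ Icc (0 : ℝ) 1) :
    spaceDeriv (fun _ x => x ^ m) t x = m * x ^ (m - 1) :=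
  (hasDerivAt_pow m x).hasDerivWithinAt.derivWithin (uniqueDiffOn_Icc one_pos x hx)

end Cylinder

section Rate

variable {T : ℝ} {u g f : ℝ → ℝ → ℝ} {q₀ q₁ γ : ℝ → ℝ}

/-- The time derivative of `∫ u_s G_s` prescribed by the weak form of a conservation law with flux
`-f` and boundary fluxes `q₀`, `q₁`. -/
def weakRate (T : ℝ) (u f : ℝ → ℝ → ℝ) (q₀ q₁ : ℝ → ℝ) (G : ℝ → ℝ → ℝ) (s : ℝ) : ℝ :=
  (∫ x, u s x * timeDeriv T G s x ∂unitMeasure) - (∫ x, f s x * spaceDeriv G s x ∂unitMeasure)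
    + (q₁ s * G s 1 + q₀ s * G s 0)

theorem integral_sub_mul_of_memLp {α : Type*} [MeasurableSpace α] {μ : Measure α}
    {a b φ : α → ℝ} (ha : MemLp a 2 μ) (hb : MemLp b 2 μ) (hφ : MemLp φ 2 μ) :
    ∫ x, (a x - b x) * φ x ∂μ = ∫ x, a x * φ x ∂μ - ∫ x, b x * φ x ∂μ := by
  simp only [sub_mul]
  exact integral_sub (ha.integrable_mul hφ) (hb.integrable_mul hφ)

theorem integrable_boundary (hq₀ : MemLp q₀ 2 (timeMeasure T)) (hq₁ : MemLp q₁ 2 (timeMeasure T))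
    {m n : ℕ} {G : ℝ → ℝ → ℝ} (hG : IsC T m n G) :
    Integrable (fun s => q₁ s * G s 1 + q₀ s * G s 0) (timeMeasure T) :=
  (hq₁.integrable_mul (memLp_restrict_of_continuousOn isCompact_Icc
      (continuousOn_slice_right hG.continuousOn (right_mem_Icc.2 zero_le_one)))).add
    (hq₀.integrable_mul (memLp_restrict_of_continuousOn isCompact_Icc
      (continuousOn_slice_right hG.continuousOn (left_mem_Icc.2 zero_le_one))))

theorem integrable_mul_timeDeriv
    (hu : MemLp (fun p : ℝ × ℝ => u p.1 p.2) 2 ((timeMeasure T).prod unitMeasure))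
    {G : ℝ → ℝ → ℝ} {m n : ℕ} (hG : IsC T m n G) (hm : 1 ≤ m) :
    Integrable (fun p : ℝ × ℝ => u p.1 p.2 * timeDeriv T G p.1 p.2)
      ((timeMeasure T).prod unitMeasure) :=
  hu.integrable_mul (memLp_of_continuousOn_cylinder (hG.continuousOn_timeDeriv hm))

theorem integrable_mul_spaceDeriv
    (hf : MemLp (fun p : ℝ × ℝ => f p.1 p.2) 2 ((timeMeasure T).prod unitMeasure))
    {G : ℝ → ℝ → ℝ} {m n : ℕ} (hG : IsC T m n G) (hn : 1 ≤ n) :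
    Integrable (fun p : ℝ × ℝ => f p.1 p.2 * spaceDeriv G p.1 p.2)
      ((timeMeasure T).prod unitMeasure) :=
  hf.integrable_mul (memLp_of_continuousOn_cylinder (hG.continuousOn_spaceDeriv hn))

theorem integrable_weakRate
    (hu : MemLp (fun p : ℝ × ℝ => u p.1 p.2) 2 ((timeMeasure T).prod unitMeasure))
    (hf : MemLp (fun p : ℝ × ℝ => f p.1 p.2) 2 ((timeMeasure T).prod unitMeasure))
    (hq₀ : MemLp q₀ 2 (timeMeasure T)) (hq₁ : MemLp q₁ 2 (timeMeasure T))
    {G : ℝ → ℝ → ℝ} (hG : IsC T 1 2 G) :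
    Integrable (weakRate T u f q₀ q₁ G) (timeMeasure T) :=
  ((integrable_mul_timeDeriv hu hG le_rfl).integral_prod_left.sub
    (integrable_mul_spaceDeriv hf hG one_le_two).integral_prod_left).add
      (integrable_boundary hq₀ hq₁ hG)

/-- The full flux `∇u - 2 σ(u) ∇H`. -/
def driftFlux (H u g : ℝ → ℝ → ℝ) (s x : ℝ) : ℝ :=
  g s x - 2 * mobility (u s x) * spaceDeriv H s x

theorem weakIdentity_iff {α β A B : ℝ} {H : ℝ → ℝ → ℝ}
    (hu : MemLp (fun p : ℝ × ℝ => u p.1 p.2) 2 ((timeMeasure T).prod unitMeasure))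
    (hf : MemLp (fun p : ℝ × ℝ => driftFlux H u g p.1 p.2) 2 ((timeMeasure T).prod unitMeasure))
    (hq₀ : MemLp (fun s => boundaryFlux α A (u s 0) (H s 0)) 2 (timeMeasure T))
    (hq₁ : MemLp (fun s => boundaryFlux β B (u s 1) (H s 1)) 2 (timeMeasure T))
    {G : ℝ → ℝ → ℝ} (hG : IsC T 1 2 G) {t : ℝ} (ht : t ∈ Icc 0 T) :
    WeakIdentity α β A B T H γ u g t G ↔
      (∫ x, u t x * G t x ∂unitMeasure) - (∫ x, γ x * G 0 x ∂unitMeasure)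
        = ∫ s in (0 : ℝ)..t, weakRate T u (driftFlux H u g)
          (fun s => boundaryFlux α A (u s 0) (H s 0)) (fun s => boundaryFlux β B (u s 1) (H s 1))
          G s := by
  have i1 := intervalIntegrable_of_integrable_timeMeasure ht
    (integrable_mul_timeDeriv hu hG le_rfl).integral_prod_left
  have i2 := intervalIntegrable_of_integrable_timeMeasure ht
    (integrable_mul_spaceDeriv hf hG one_le_two).integral_prod_left
  have i3 := intervalIntegrable_of_integrable_timeMeasure ht (integrable_boundary hq₀ hq₁ hG)
  have e : ∀ s x, -(g s x * spaceDeriv G s x)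
      + 2 * mobility (u s x) * spaceDeriv H s x * spaceDeriv G s x
      = -(driftFlux H u g s x * spaceDeriv G s x) := fun s x => by
    rw [driftFlux]; ring
  simp only [WeakIdentity, weakRate, e, integral_neg]
  rw [intervalIntegral.integral_add (i1.sub i2) i3, intervalIntegral.integral_sub i1 i2,
    intervalIntegral.integral_neg]
  constructor <;> intro h <;> linarith

theorem weakRate_pow (m : ℕ) (s : ℝ) :
    weakRate T u f q₀ q₁ (fun _ x => x ^ m) s
      = -(∫ x, f s x * (m * x ^ (m - 1)) ∂unitMeasure) + q₁ s + q₀ s * 0 ^ m := by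
  have : ∫ x, f s x * spaceDeriv (fun _ x => x ^ m) s x ∂unitMeasure
      = ∫ x, f s x * (m * x ^ (m - 1)) ∂unitMeasure :=
    integral_congr_ae (ae_unitMeasure_mem.mono fun x hx => by simp only [spaceDeriv_pow m s hx])
  rw [weakRate, this]
  simp only [timeDeriv_const, mul_zero, integral_zero, one_pow, mul_one]
  ring

theorem isFluxSolution_of_weakRate
    (hu : MemLp (fun p : ℝ × ℝ => u p.1 p.2) 2 ((timeMeasure T).prod unitMeasure))
    (hg : MemLp (fun p : ℝ × ℝ => g p.1 p.2) 2 ((timeMeasure T).prod unitMeasure))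
    (hf : MemLp (fun p : ℝ × ℝ => f p.1 p.2) 2 ((timeMeasure T).prod unitMeasure))
    (hq₀ : MemLp q₀ 2 (timeMeasure T)) (hq₁ : MemLp q₁ 2 (timeMeasure T))
    (hγ : MemLp γ 2 unitMeasure)
    (hp : ∀ᵐ t ∂timeMeasure T, ∀ x ∈ Icc (0 : ℝ) 1, u t x = u t 0 + primitive (g t) x)
    (hG : ∀ G, IsC T 1 2 G → ∀ᵐ t ∂timeMeasure T,
      (∫ x, u t x * G t x ∂unitMeasure) - (∫ x, γ x * G 0 x ∂unitMeasure)
        = ∫ s in (0 : ℝ)..t, weakRate T u f q₀ q₁ G s) :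
    IsFluxSolution T u g f q₀ q₁ γ := by
  refine ⟨hu, hg, hf, hq₀, hq₁, hγ, hp, ?_⟩
  have h := ae_all_iff.2 fun m : ℕ => hG _ (isC_pow m)
  filter_upwards [h, ae_memLp_slice hu] with t ht hut m
  simp_rw [← weakRate_pow (T := T) (u := u)]
  rw [← ht m, integral_sub_mul_of_memLp hut hγ (memLp_pow m)]

theorem primitive_sub {φ ψ : ℝ → ℝ} (hφ : Integrable φ unitMeasure)
    (hψ : Integrable ψ unitMeasure) (x : ℝ) :
    primitive (fun y => φ y - ψ y) x = primitive φ x - primitive ψ x := by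
  simp only [primitive, mul_sub]
  exact integral_sub (integrable_leKernel_mul hφ x) (integrable_leKernel_mul hψ x)

theorem IsFluxSolution.moments_sub {v g' f' : ℝ → ℝ → ℝ} {p₀ p₁ γ' : ℝ → ℝ}
    (h : IsFluxSolution T u g f q₀ q₁ γ) (h' : IsFluxSolution T v g' f' p₀ p₁ γ') :
    ∀ᵐ t ∂timeMeasure T, ∀ m : ℕ, ∫ x, (u t x - v t x - (γ x - γ' x)) * x ^ m ∂unitMeasure
      = ∫ s in (0 : ℝ)..t, (-(∫ x, (f s x - f' s x) * (m * x ^ (m - 1)) ∂unitMeasure)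
          + (q₁ s - p₁ s) + (q₀ s - p₀ s) * 0 ^ m) := by
  filter_upwards [h.moments, h'.moments, ae_memLp_slice h.memLp, ae_memLp_slice h'.memLp,
    ae_timeMeasure_mem T] with t hmom hmom' hu hv ht m
  have hrate := integrable_weakRate h.memLp h.memLp_flux h.memLp_left h.memLp_right (isC_pow m)
  have hrate' :=
    integrable_weakRate h'.memLp h'.memLp_flux h'.memLp_left h'.memLp_right (isC_pow m)
  rw [funext (weakRate_pow m)] at hrate hrate'
  have hpow := (memLp_pow (m - 1)).const_mul (m : ℝ)
  calc ∫ x, (u t x - v t x - (γ x - γ' x)) * x ^ m ∂unitMeasure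
      = ∫ x, ((u t x - γ x) - (v t x - γ' x)) * x ^ m ∂unitMeasure := by
        simp only [sub_sub_sub_comm]
    _ = ∫ x, (u t x - γ x) * x ^ m ∂unitMeasure - ∫ x, (v t x - γ' x) * x ^ m ∂unitMeasure :=
        integral_sub_mul_of_memLp (hu.sub h.memLp_init) (hv.sub h'.memLp_init) (memLp_pow m)
    _ = _ := by
        rw [hmom m, hmom' m, ← intervalIntegral.integral_sub
          (intervalIntegrable_of_integrable_timeMeasure ht hrate)
          (intervalIntegrable_of_integrable_timeMeasure ht hrate')]
        refine intervalIntegral_congr_timeMeasure ht ?_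
        filter_upwards [ae_memLp_slice h.memLp_flux, ae_memLp_slice h'.memLp_flux] with s hf hf'
        rw [integral_sub_mul_of_memLp hf hf' hpow]
        ring

theorem IsFluxSolution.sub {v g' f' : ℝ → ℝ → ℝ} {p₀ p₁ γ' : ℝ → ℝ}
    (h : IsFluxSolution T u g f q₀ q₁ γ) (h' : IsFluxSolution T v g' f' p₀ p₁ γ') :
    IsFluxSolution T (fun t x => u t x - v t x) (fun t x => g t x - g' t x)
      (fun t x => f t x - f' t x) (fun t => q₀ t - p₀ t) (fun t => q₁ t - p₁ t)
      (fun x => γ x - γ' x) where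
  memLp := h.memLp.sub h'.memLp
  memLp_deriv := h.memLp_deriv.sub h'.memLp_deriv
  memLp_flux := h.memLp_flux.sub h'.memLp_flux
  memLp_left := h.memLp_left.sub h'.memLp_left
  memLp_right := h.memLp_right.sub h'.memLp_right
  memLp_init := h.memLp_init.sub h'.memLp_init
  eq_primitive := by
    filter_upwards [h.eq_primitive, h'.eq_primitive, ae_memLp_slice h.memLp_deriv,
      ae_memLp_slice h'.memLp_deriv] with t hu hv hg hg' x hx
    rw [hu x hx, hv x hx, primitive_sub (hg.integrable one_le_two) (hg'.integrable one_le_two)]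
    ring
  moments := h.moments_sub h'

end Rate

section BoundaryFlux

/-- The coefficient of `-a` in the affine map `a ↦ 𝔭_{ϱ,D}(a,M)`; its sign makes the boundary
conditions dissipative. -/
def boundaryRate (ϱ D M : ℝ) : ℝ := D⁻¹ * (ϱ * Real.exp M + (1 - ϱ) * Real.exp (-M))

theorem boundaryFlux_eq (ϱ D a M : ℝ) :
    boundaryFlux ϱ D a M = D⁻¹ * ϱ * Real.exp M - boundaryRate ϱ D M * a := by
  rw [boundaryFlux, boundaryRate]; ring

theorem boundaryFlux_sub (ϱ D a b M : ℝ) :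
    boundaryFlux ϱ D a M - boundaryFlux ϱ D b M = -(boundaryRate ϱ D M * (a - b)) := by
  rw [boundaryFlux_eq, boundaryFlux_eq]; ring

theorem boundaryRate_nonneg {ϱ D : ℝ} (hϱ : ϱ ∈ Icc (0 : ℝ) 1) (hD : 0 ≤ D) (M : ℝ) :
    0 ≤ boundaryRate ϱ D M :=
  mul_nonneg (inv_nonneg.2 hD) (add_nonneg (mul_nonneg hϱ.1 (Real.exp_nonneg _))
    (mul_nonneg (sub_nonneg.2 hϱ.2) (Real.exp_nonneg _)))

theorem memLp_continuousOn_mul {T : ℝ} {k a : ℝ → ℝ} (hk : ContinuousOn k (Icc 0 T))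
    (ha : MemLp a 2 (timeMeasure T)) : MemLp (fun s => k s * a s) 2 (timeMeasure T) := by
  obtain ⟨C, hC⟩ := isCompact_Icc.exists_bound_of_continuousOn hk
  refine ha.of_le_mul (c := C) ((hk.aestronglyMeasurable measurableSet_Icc).mul ha.1) ?_
  filter_upwards [ae_timeMeasure_mem T] with s hs
  rw [norm_mul]
  exact mul_le_mul_of_nonneg_right (hC s hs) (norm_nonneg _)

theorem continuousOn_boundaryRate {T ϱ D : ℝ} {M : ℝ → ℝ} (hM : ContinuousOn M (Icc 0 T)) :
    ContinuousOn (fun s => boundaryRate ϱ D (M s)) (Icc 0 T) := by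
  unfold boundaryRate
  fun_prop

theorem memLp_boundaryFlux {T ϱ D : ℝ} {a M : ℝ → ℝ} (ha : MemLp a 2 (timeMeasure T))
    (hM : ContinuousOn M (Icc 0 T)) :
    MemLp (fun s => boundaryFlux ϱ D (a s) (M s)) 2 (timeMeasure T) := by
  simp_rw [boundaryFlux_eq]
  exact (memLp_restrict_of_continuousOn isCompact_Icc (by fun_prop)).sub
    (memLp_continuousOn_mul (continuousOn_boundaryRate hM) ha)

theorem memLp_of_forall_mem_Icc {γ : ℝ → ℝ} (hγm : AEMeasurable γ (volume.restrict (Icc 0 1)))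
    (hγ : ∀ x ∈ Icc (0 : ℝ) 1, γ x ∈ Icc (0 : ℝ) 1) : MemLp γ 2 unitMeasure :=
  MemLp.of_bound hγm.aestronglyMeasurable 1 (ae_unitMeasure_mem.mono fun x hx => by
    rw [Real.norm_eq_abs, abs_of_nonneg (hγ x hx).1]; exact (hγ x hx).2)

theorem memLp_driftFlux {T : ℝ} {H u g : ℝ → ℝ → ℝ} (hH : IsC T 0 1 H)
    (hu : MemLp (fun p : ℝ × ℝ => u p.1 p.2) 2 ((timeMeasure T).prod unitMeasure))
    (hg : MemLp (fun p : ℝ × ℝ => g p.1 p.2) 2 ((timeMeasure T).prod unitMeasure))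
    (h : ∀ᵐ p ∂((timeMeasure T).prod unitMeasure), u p.1 p.2 ∈ Icc (0 : ℝ) 1) :
    MemLp (fun p : ℝ × ℝ => driftFlux H u g p.1 p.2) 2 ((timeMeasure T).prod unitMeasure) := by
  have hH' := memLp_of_continuousOn_cylinder (hH.continuousOn_spaceDeriv le_rfl)
  refine hg.sub (hH'.of_le_mul (c := 2) ?_ ?_)
  · have hm : Continuous mobility := by unfold mobility; fun_prop
    exact ((hm.comp_aestronglyMeasurable hu.1).const_mul 2).mul hH'.1
  · filter_upwards [h] with p hp
    rw [norm_mul, norm_mul, Real.norm_ofNat]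
    refine mul_le_mul_of_nonneg_right ?_ (norm_nonneg _)
    refine mul_le_of_le_one_right zero_le_two ?_
    rw [mobility, norm_mul, Real.norm_eq_abs, Real.norm_eq_abs, abs_of_nonneg hp.1,
      abs_of_nonneg (by linarith [hp.2])]
    nlinarith [hp.1, hp.2]

end BoundaryFlux

section Interval

variable {T : ℝ}

theorem ae_timeMeasure_mem_Ioc (T : ℝ) : ∀ᵐ t ∂timeMeasure T, t ∈ Ioc 0 T := by
  rw [timeMeasure, ← restrict_Ioc_eq_restrict_Icc]
  exact ae_restrict_mem measurableSet_Ioc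

theorem continuousOn_intervalIntegral (hT : 0 ≤ T) {R : ℝ → ℝ} (hR : Integrable R (timeMeasure T)) :
    ContinuousOn (fun t => ∫ s in (0 : ℝ)..t, R s) (Icc 0 T) := by
  rw [← uIcc_of_le hT]
  exact intervalIntegral.continuousOn_primitive_interval (by rw [uIcc_of_le hT]; exact hR)

theorem eq_zero_of_ae_eq_zero_of_eq_intervalIntegral (hT : 0 < T) {a R : ℝ → ℝ}
    (hR : Integrable R (timeMeasure T)) (ha : ∀ t ∈ Ioc 0 T, a t = ∫ s in (0 : ℝ)..t, R s)
    (hzero : ∀ᵐ t ∂timeMeasure T, a t = 0) : ∀ t ∈ Ioc 0 T, a t = 0 := by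
  have hR0 : ∀ᵐ t ∂timeMeasure T, ∫ s in (0 : ℝ)..t, R s = 0 := by
    filter_upwards [hzero, ae_timeMeasure_mem_Ioc T] with t h0 ht
    rw [← ha t ht, h0]
  have heq := Measure.eqOn_Icc_of_ae_eq volume hT.ne hR0 (continuousOn_intervalIntegral hT.le hR)
    continuousOn_const
  exact fun t ht => (ha t ht).trans (heq (Ioc_subset_Icc_self ht))

end Interval

section Uniqueness

variable {α β A B T : ℝ} {H : ℝ → ℝ → ℝ} {γ : ℝ → ℝ} {u v : ℝ → ℝ → ℝ}

theorem firstPrim_one (a : ℝ) : firstPrim (fun _ => 1) a = a := by simp [firstPrim]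

theorem secondPrim_one (a : ℝ) : secondPrim (fun _ => 1) a = a ^ 2 / 2 := by
  simp [secondPrim, firstPrim_one, integral_id]

theorem abs_mobility_sub_le {a b : ℝ} (ha : a ∈ Icc (0 : ℝ) 1) (hb : b ∈ Icc (0 : ℝ) 1) :
    |mobility a - mobility b| ≤ |a - b| := by
  have : mobility a - mobility b = (a - b) * (1 - a - b) := by unfold mobility; ring
  rw [this, abs_mul]
  refine mul_le_of_le_one_right (abs_nonneg _) (abs_le.2 ⟨?_, ?_⟩) <;>
    linarith [ha.1, ha.2, hb.1, hb.2]

theorem boundaryFlux_sub_mul_sub_nonpos {ϱ D : ℝ} (hϱ : ϱ ∈ Icc (0 : ℝ) 1) (hD : 0 ≤ D)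
    (a b M : ℝ) : (boundaryFlux ϱ D a M - boundaryFlux ϱ D b M) * (a - b) ≤ 0 := by
  rw [boundaryFlux_sub]
  nlinarith [mul_nonneg (boundaryRate_nonneg hϱ hD M) (sq_nonneg (a - b))]

theorem neg_driftFlux_sub_mul_le {g g' : ℝ → ℝ → ℝ} {s x C : ℝ} (hu : u s x ∈ Icc (0 : ℝ) 1)
    (hv : v s x ∈ Icc (0 : ℝ) 1) (hC : |spaceDeriv H s x| ≤ C) :
    -((driftFlux H u g s x - driftFlux H v g' s x) * (g s x - g' s x))
      ≤ C ^ 2 * (u s x - v s x) ^ 2 := by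
  set S := spaceDeriv H s x
  set d := g s x - g' s x
  have hdrift : ((mobility (u s x) - mobility (v s x)) * S) ^ 2 ≤ C ^ 2 * (u s x - v s x) ^ 2 := by
    rw [← sq_abs, abs_mul, mul_pow, mul_comm, ← sq_abs (u s x - v s x)]
    exact mul_le_mul (pow_le_pow_left₀ (abs_nonneg _) hC 2)
      (pow_le_pow_left₀ (abs_nonneg _) (abs_mobility_sub_le hu hv) 2) (by positivity)
      (by positivity)
  have hflux : driftFlux H u g s x - driftFlux H v g' s x
      = d - 2 * ((mobility (u s x) - mobility (v s x)) * S) := by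
    simp only [driftFlux, d, S]
    ring
  rw [hflux]
  nlinarith [sq_nonneg ((mobility (u s x) - mobility (v s x)) * S - d)]

theorem IsWeakSolution.exists_isFluxSolution (hH : IsC T 0 1 H)
    (hγ : MemLp γ 2 unitMeasure) (h : IsWeakSolution α β A B T H γ u) :
    ∃ g, IsFluxSolution T u g (driftFlux H u g) (fun s => boundaryFlux α A (u s 0) (H s 0))
        (fun s => boundaryFlux β B (u s 1) (H s 1)) γ ∧
      ∀ t ∈ Ioc 0 T, ∀ G, IsC T 1 2 G →
        (∫ x, u t x * G t x ∂unitMeasure) - (∫ x, γ x * G 0 x ∂unitMeasure)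
          = ∫ s in (0 : ℝ)..t, weakRate T u (driftFlux H u g)
            (fun s => boundaryFlux α A (u s 0) (H s 0))
            (fun s => boundaryFlux β B (u s 1) (H s 1)) G s := by
  obtain ⟨g, hL, hw⟩ := h.weak
  have hu := hL.memLp
  have hg := hL.memLp_deriv
  have hI := h.mem_Icc
  rw [restrict_cylinder] at hu hg hI
  have hprim : ∀ᵐ t ∂timeMeasure T, ∀ x ∈ Icc (0 : ℝ) 1, u t x = u t 0 + primitive (g t) x :=
    hL.isH1.mono fun t ht => ht.eq_primitive
  have hflux := memLp_driftFlux hH hu hg hI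
  have hleft := memLp_boundaryFlux (ϱ := α) (D := A) (memLp_trace_zero hu hg hprim)
    (continuousOn_slice_right hH.continuousOn (left_mem_Icc.2 zero_le_one))
  have hright := memLp_boundaryFlux (ϱ := β) (D := B) (memLp_trace_one hu hg hprim)
    (continuousOn_slice_right hH.continuousOn (right_mem_Icc.2 zero_le_one))
  have hrate (t : ℝ) (ht : t ∈ Ioc 0 T) (G : ℝ → ℝ → ℝ) (hG : IsC T 1 2 G) :=
    (weakIdentity_iff hu hflux hleft hright hG (Ioc_subset_Icc_self ht)).1 (hw t ht G hG)
  exact ⟨g, isFluxSolution_of_weakRate hu hg hflux hleft hright hγ hprim fun G hG =>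
    (ae_timeMeasure_mem_Ioc T).mono fun t ht => hrate t ht G hG, hrate⟩

theorem IsWeakSolution.ae_eq (hα : α ∈ Icc (0 : ℝ) 1) (hβ : β ∈ Icc (0 : ℝ) 1) (hA : 0 ≤ A)
    (hB : 0 ≤ B) (hH : IsC T 0 1 H) (hγ : MemLp γ 2 unitMeasure)
    (hu : IsWeakSolution α β A B T H γ u) (hv : IsWeakSolution α β A B T H γ v) :
    ∀ᵐ p ∂((timeMeasure T).prod unitMeasure), u p.1 p.2 = v p.1 p.2 := by
  obtain ⟨g, hfu, -⟩ := hu.exists_isFluxSolution hH hγ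
  obtain ⟨g', hfv, -⟩ := hv.exists_isFluxSolution hH hγ
  have huI := hu.mem_Icc
  have hvI := hv.mem_Icc
  rw [restrict_cylinder] at huI hvI
  obtain ⟨C, -, hC⟩ := exists_bound_of_continuousOn_cylinder (hH.continuousOn_spaceDeriv le_rfl)
  have hzero := (hfu.sub hfv).ae_secondPrim_eq_zero (ρ := fun _ => 1) (C := 1) continuous_const
    (fun _ => zero_le_one) (by simp) (by simp [secondPrim_one]) (L := 2 * C ^ 2) (by positivity) (by
      filter_upwards [huI, hvI, ae_prod_mem_cylinder T] with p hup hvp hp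
      simp only [firstPrim_one, secondPrim_one, one_mul]
      linarith [neg_driftFlux_sub_mul_le (g := g) (g' := g') hup hvp (hC p hp),
        boundaryFlux_sub_mul_sub_nonpos hβ hB (u p.1 1) (v p.1 1) (H p.1 1),
        boundaryFlux_sub_mul_sub_nonpos hα hA (u p.1 0) (v p.1 0) (H p.1 0)])
  filter_upwards [hzero] with p hp
  rw [secondPrim_one] at hp
  exact sub_eq_zero.1 (pow_eq_zero_iff two_ne_zero |>.1 (by linarith))

theorem IsWeakSolution.ae_eq_at (hα : α ∈ Icc (0 : ℝ) 1) (hβ : β ∈ Icc (0 : ℝ) 1) (hA : 0 ≤ A)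
    (hB : 0 ≤ B) (hT : 0 < T) (hH : IsC T 0 1 H) (hγ : MemLp γ 2 unitMeasure)
    (hu : IsWeakSolution α β A B T H γ u) (hv : IsWeakSolution α β A B T H γ v) :
    ∀ t ∈ Ioc 0 T, ∀ᵐ x ∂unitMeasure, u t x = v t x := by
  have hslice : ∀ᵐ t ∂timeMeasure T, ∀ᵐ x ∂unitMeasure, u t x = v t x :=
    Measure.ae_ae_of_ae_prod (hu.ae_eq hα hβ hA hB hH hγ hv)
  obtain ⟨g, hfu, hwu⟩ := hu.exists_isFluxSolution hH hγ
  obtain ⟨g', hfv, hwv⟩ := hv.exists_isFluxSolution hH hγ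
  have hmoments (m : ℕ) (t : ℝ) (ht : t ∈ Ioc 0 T) :
      ∫ x, (u t x - v t x) * x ^ m ∂unitMeasure = 0 := by
    have hRu := integrable_weakRate hfu.memLp hfu.memLp_flux hfu.memLp_left hfu.memLp_right
      (isC_pow m)
    have hRv := integrable_weakRate hfv.memLp hfv.memLp_flux hfv.memLp_left hfv.memLp_right
      (isC_pow m)
    refine eq_zero_of_ae_eq_zero_of_eq_intervalIntegral hT
      (a := fun s => ∫ x, (u s x - v s x) * x ^ m ∂unitMeasure) (hRu.sub hRv) (fun s hs => ?_)
      (hslice.mono fun s hs => integral_eq_zero_of_ae (hs.mono fun x hx => by simp [hx])) t ht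
    have hsI := Ioc_subset_Icc_self hs
    rw [integral_sub_mul_of_memLp (hu.memLp s hsI) (hv.memLp s hsI) (memLp_pow m)]
    simp only [Pi.sub_apply]
    rw [intervalIntegral.integral_sub (intervalIntegrable_of_integrable_timeMeasure hsI hRu)
      (intervalIntegrable_of_integrable_timeMeasure hsI hRv), ← hwu s hs _ (isC_pow m),
      ← hwv s hs _ (isC_pow m)]
    ring
  intro t ht
  have htI := Ioc_subset_Icc_self ht
  have hzero := ae_eq_zero_of_moments_eq_zero (a := 0) (b := 1) (h := fun x => u t x - v t x)
    (((hu.memLp t htI).sub (hv.memLp t htI)).integrable one_le_two) fun m => by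
      simp only [mul_comm (_ ^ m)]
      exact hmoments m t ht
  exact hzero.mono fun x hx => sub_eq_zero.1 hx

end Uniqueness

section TestFunctions

variable {T : ℝ} {m n : ℕ} {G G' : ℝ → ℝ → ℝ}

theorem IsC.add (hT : 0 < T) (h : IsC T m n G) (h' : IsC T m n G') : IsC T m n (G + G') := by
  refine ⟨fun x hx => (h.time_contDiff x hx).add (h'.time_contDiff x hx),
    fun t ht => (h.space_contDiff t ht).add (h'.space_contDiff t ht), fun j hj => ?_,
    fun k hk => ?_⟩
  · refine ((h.time_continuous j hj).add (h'.time_continuous j hj)).congr fun p hp => ?_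
    exact iteratedDerivWithin_fun_add hp.1 (uniqueDiffOn_Icc hT)
      ((h.time_contDiff p.2 hp.2 p.1 hp.1).of_le (by exact_mod_cast hj))
      ((h'.time_contDiff p.2 hp.2 p.1 hp.1).of_le (by exact_mod_cast hj))
  · refine ((h.space_continuous k hk).add (h'.space_continuous k hk)).congr fun p hp => ?_
    exact iteratedDerivWithin_fun_add hp.2 (uniqueDiffOn_Icc one_pos)
      ((h.space_contDiff p.1 hp.1 p.2 hp.2).of_le (by exact_mod_cast hk))
      ((h'.space_contDiff p.1 hp.1 p.2 hp.2).of_le (by exact_mod_cast hk))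

theorem IsC.const_smul (hT : 0 < T) (c : ℝ) (h : IsC T m n G) : IsC T m n (c • G) := by
  refine ⟨fun x hx => contDiffOn_const.mul (h.time_contDiff x hx),
    fun t ht => contDiffOn_const.mul (h.space_contDiff t ht), fun j hj => ?_, fun k hk => ?_⟩
  · refine ((continuousOn_const (c := c)).mul (h.time_continuous j hj)).congr fun p hp => ?_
    exact iteratedDerivWithin_const_mul hp.1 (uniqueDiffOn_Icc hT) c
      ((h.time_contDiff p.2 hp.2 p.1 hp.1).of_le (by exact_mod_cast hj))
  · refine ((continuousOn_const (c := c)).mul (h.space_continuous k hk)).congr fun p hp => ?_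
    exact iteratedDerivWithin_const_mul hp.2 (uniqueDiffOn_Icc one_pos) c
      ((h.space_contDiff p.1 hp.1 p.2 hp.2).of_le (by exact_mod_cast hk))

theorem isC_zero : IsC T m n 0 := by
  refine ⟨fun x _ => contDiffOn_const, fun t _ => contDiffOn_const, fun j _ => ?_, fun k _ => ?_⟩
  · simp only [Pi.zero_apply, iteratedDerivWithin_const]
    split_ifs <;> exact continuousOn_const
  · have : ∀ p : ℝ × ℝ, iteratedDerivWithin k ((0 : ℝ → ℝ → ℝ) p.1) (Icc 0 1) p.2 = 0 := fun p => by
      exact (iteratedDerivWithin_const (n := k) (c := (0 : ℝ))).trans (ite_self _)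
    simp_rw [this]
    exact continuousOn_const

theorem timeDeriv_add (h : IsC T 1 n G) (h' : IsC T 1 n G') {t x : ℝ} (hT : 0 < T)
    (ht : t ∈ Icc 0 T) (hx : x ∈ Icc (0 : ℝ) 1) :
    timeDeriv T (G + G') t x = timeDeriv T G t x + timeDeriv T G' t x :=
  ((h.hasDerivWithinAt_time le_rfl ht hx).add
    (h'.hasDerivWithinAt_time le_rfl ht hx)).derivWithin (uniqueDiffOn_Icc hT t ht)

theorem timeDeriv_smul (c : ℝ) (h : IsC T 1 n G) {t x : ℝ} (hT : 0 < T)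
    (ht : t ∈ Icc 0 T) (hx : x ∈ Icc (0 : ℝ) 1) :
    timeDeriv T (c • G) t x = c * timeDeriv T G t x :=
  ((h.hasDerivWithinAt_time le_rfl ht hx).const_mul c).derivWithin (uniqueDiffOn_Icc hT t ht)

theorem spaceDeriv_add (h : IsC T m n G) (hn : 1 ≤ n) (h' : IsC T m n G') {t x : ℝ}
    (ht : t ∈ Icc 0 T) (hx : x ∈ Icc (0 : ℝ) 1) :
    spaceDeriv (G + G') t x = spaceDeriv G t x + spaceDeriv G' t x :=
  ((h.hasDerivWithinAt_space hn ht hx).add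
    (h'.hasDerivWithinAt_space hn ht hx)).derivWithin (uniqueDiffOn_Icc one_pos x hx)

theorem spaceDeriv_smul (c : ℝ) (h : IsC T m n G) (hn : 1 ≤ n) {t x : ℝ}
    (ht : t ∈ Icc 0 T) (hx : x ∈ Icc (0 : ℝ) 1) :
    spaceDeriv (c • G) t x = c * spaceDeriv G t x :=
  ((h.hasDerivWithinAt_space hn ht hx).const_mul c).derivWithin
    (uniqueDiffOn_Icc one_pos x hx)

theorem timeDeriv_mul_time (h : IsC T 1 n G) {χ : ℝ → ℝ} (hχ : ContDiff ℝ ∞ χ) {t x : ℝ}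
    (hT : 0 < T) (ht : t ∈ Icc 0 T) (hx : x ∈ Icc (0 : ℝ) 1) :
    timeDeriv T (fun t x => χ t * G t x) t x = deriv χ t * G t x + χ t * timeDeriv T G t x :=
  ((hχ.differentiable (by simp) t).hasDerivAt.hasDerivWithinAt.fun_mul
    (h.hasDerivWithinAt_time le_rfl ht hx)).derivWithin (uniqueDiffOn_Icc hT t ht)

theorem spaceDeriv_mul_time (h : IsC T m n G) (hn : 1 ≤ n) (χ : ℝ → ℝ) {t x : ℝ}
    (ht : t ∈ Icc 0 T) (hx : x ∈ Icc (0 : ℝ) 1) :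
    spaceDeriv (fun t x => χ t * G t x) t x = χ t * spaceDeriv G t x :=
  ((h.hasDerivWithinAt_space hn ht hx).const_mul (χ t)).derivWithin
    (uniqueDiffOn_Icc one_pos x hx)

theorem IsC.mul_time (hT : 0 < T) (h : IsC T 1 n G) {χ : ℝ → ℝ} (hχ : ContDiff ℝ ∞ χ) :
    IsC T 1 n fun t x => χ t * G t x := by
  have hχc : Continuous χ := hχ.continuous
  have hχd : Continuous (deriv χ) := hχ.continuous_deriv (by simp)
  refine ⟨fun x hx => (hχ.of_le (by simp)).contDiffOn.mul (h.time_contDiff x hx),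
    fun t ht => contDiffOn_const.mul (h.space_contDiff t ht), fun j hj => ?_, fun k hk => ?_⟩
  · interval_cases j
    · simp only [iteratedDerivWithin_zero]
      exact (hχc.comp continuous_fst).continuousOn.mul h.continuousOn
    · simp only [iteratedDerivWithin_one]
      refine ContinuousOn.congr (((hχd.comp continuous_fst).continuousOn.mul h.continuousOn).add
        ((hχc.comp continuous_fst).continuousOn.mul (h.continuousOn_timeDeriv le_rfl)))
        fun p hp => ?_
      exact timeDeriv_mul_time h hχ hT hp.1 hp.2
  · refine ContinuousOn.congr ((hχc.comp continuous_fst).continuousOn.mul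
      (h.space_continuous k hk)) fun p hp => ?_
    exact iteratedDerivWithin_const_mul hp.2 (uniqueDiffOn_Icc one_pos) (χ p.1)
      ((h.space_contDiff p.1 hp.1 p.2 hp.2).of_le (by exact_mod_cast hk))

end TestFunctions

section TimeSlices

variable {T : ℝ} {u g f : ℝ → ℝ → ℝ} {q₀ q₁ γ : ℝ → ℝ}

theorem weakRate_mul_time (hT : 0 < T)
    (hu : MemLp (fun p : ℝ × ℝ => u p.1 p.2) 2 ((timeMeasure T).prod unitMeasure))
    {G : ℝ → ℝ → ℝ} (hG : IsC T 1 2 G) {χ : ℝ → ℝ} (hχ : ContDiff ℝ ∞ χ) :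
    ∀ᵐ s ∂timeMeasure T, weakRate T u f q₀ q₁ (fun t x => χ t * G t x) s
      = deriv χ s * (∫ x, u s x * G s x ∂unitMeasure) + χ s * weakRate T u f q₀ q₁ G s := by
  filter_upwards [ae_timeMeasure_mem T, ae_memLp_slice hu] with s hs hus
  have hG_int : Integrable (fun x => u s x * G s x) unitMeasure :=
    hus.integrable_mul (memLp_restrict_of_continuousOn isCompact_Icc
      (continuousOn_slice_left hG.continuousOn hs))
  have hG'_int : Integrable (fun x => u s x * timeDeriv T G s x) unitMeasure :=
    hus.integrable_mul (memLp_restrict_of_continuousOn isCompact_Icc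
      (continuousOn_slice_left (hG.continuousOn_timeDeriv le_rfl) hs))
  have htime : ∫ x, u s x * timeDeriv T (fun t x => χ t * G t x) s x ∂unitMeasure
      = deriv χ s * (∫ x, u s x * G s x ∂unitMeasure)
        + χ s * ∫ x, u s x * timeDeriv T G s x ∂unitMeasure := by
    rw [← integral_const_mul, ← integral_const_mul,
      ← integral_add (hG_int.const_mul _) (hG'_int.const_mul _)]
    refine integral_congr_ae (ae_unitMeasure_mem.mono fun x hx => ?_)
    simp only [timeDeriv_mul_time hG hχ hT hs hx]; ring
  have hspace : ∫ x, f s x * spaceDeriv (fun t x => χ t * G t x) s x ∂unitMeasure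
      = χ s * ∫ x, f s x * spaceDeriv G s x ∂unitMeasure := by
    rw [← integral_const_mul]
    refine integral_congr_ae (ae_unitMeasure_mem.mono fun x hx => ?_)
    simp only [spaceDeriv_mul_time hG one_le_two χ hs hx]; ring
  simp only [weakRate, htime, hspace]
  ring

theorem intervalIntegral_mul_primitive_eq (hT : 0 < T) {R : ℝ → ℝ}
    (hR : Integrable R (timeMeasure T)) (n : ℕ) :
    ∫ s in (0 : ℝ)..T, (T ^ (n + 1) - s ^ (n + 1)) * R s
      = ∫ s in (0 : ℝ)..T, ((n + 1) * s ^ n) * ∫ r in (0 : ℝ)..s, R r := by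
  have hRi := intervalIntegrable_of_integrable_timeMeasure (right_mem_Icc.2 hT.le) hR
  have hac := hRi.absolutelyContinuousOnInterval_intervalIntegral (c := 0) left_mem_uIcc
  have hχ : AbsolutelyContinuousOnInterval (fun s : ℝ => T ^ (n + 1) - s ^ (n + 1)) 0 T :=
    ContDiffOn.absolutelyContinuousOnInterval (by fun_prop)
  have hparts := hχ.integral_mul_deriv_eq_deriv_mul hac
  have hd : ∀ s : ℝ, deriv (fun s : ℝ => T ^ (n + 1) - s ^ (n + 1)) s = -((n + 1) * s ^ n) :=
    fun s => by simp
  have hderiv : ∫ s in (0 : ℝ)..T,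
        (T ^ (n + 1) - s ^ (n + 1)) * deriv (fun x => ∫ v in (0 : ℝ)..x, R v) s
      = ∫ s in (0 : ℝ)..T, (T ^ (n + 1) - s ^ (n + 1)) * R s := by
    refine intervalIntegral.integral_congr_ae ?_
    filter_upwards [hRi.ae_hasDerivAt_integral] with s hs hs'
    rw [(hs (uIoc_subset_uIcc hs') 0 left_mem_uIcc).deriv]
  rw [← hderiv, hparts]
  simp only [hd, sub_self, zero_mul, intervalIntegral.integral_same, mul_zero, neg_mul,
    intervalIntegral.integral_neg]
  ring

theorem ae_sub_eq_intervalIntegral_of_moments (hT : 0 < T) {c : ℝ} {h R : ℝ → ℝ}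
    (hh : Integrable h (timeMeasure T)) (hR : Integrable R (timeMeasure T))
    (hmom : ∀ n : ℕ, -(T ^ (n + 1) * c)
      = ∫ s in (0 : ℝ)..T, -((n + 1) * s ^ n) * h s + (T ^ (n + 1) - s ^ (n + 1)) * R s) :
    ∀ᵐ t ∂timeMeasure T, h t - c = ∫ s in (0 : ℝ)..t, R s := by
  have hT_mem := right_mem_Icc.2 hT.le
  have hmul : ∀ {F k : ℝ → ℝ}, Integrable F (timeMeasure T) → Continuous k →
      IntervalIntegrable (fun s => k s * F s) volume 0 T := fun hF hk =>
    intervalIntegrable_of_integrable_timeMeasure hT_mem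
      (IntegrableOn.continuousOn_mul hk.continuousOn hF isCompact_Icc)
  have hP : Integrable (fun t => ∫ s in (0 : ℝ)..t, R s) (timeMeasure T) :=
    (continuousOn_intervalIntegral hT.le hR).integrableOn_compact isCompact_Icc
  suffices hzero : ∀ᵐ t ∂timeMeasure T, h t - c - ∫ s in (0 : ℝ)..t, R s = 0 from
    hzero.mono fun t ht => sub_eq_zero.1 ht
  refine ae_eq_zero_of_moments_eq_zero ((hh.sub (integrable_const c)).sub hP) fun n => ?_
  have hn : (n : ℝ) + 1 ≠ 0 := by positivity
  have hsplit : ∫ t, t ^ n * (h t - c - ∫ s in (0 : ℝ)..t, R s) ∂timeMeasure T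
      = (∫ t in (0 : ℝ)..T, t ^ n * h t) - T ^ (n + 1) / (n + 1) * c
        - ∫ t in (0 : ℝ)..T, t ^ n * ∫ s in (0 : ℝ)..t, R s := by
    have hc : ∫ t in (0 : ℝ)..T, t ^ n * c = T ^ (n + 1) / (n + 1) * c := by simp
    rw [integral_timeMeasure hT.le, ← hc,
      ← intervalIntegral.integral_sub (hmul hh (continuous_pow n))
        (hmul (integrable_const c) (continuous_pow n)),
      ← intervalIntegral.integral_sub ((hmul hh (continuous_pow n)).sub
        (hmul (integrable_const c) (continuous_pow n))) (hmul hP (continuous_pow n))]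
    exact intervalIntegral.integral_congr fun s _ => by ring
  have hmom_n := hmom n
  rw [intervalIntegral.integral_add (hmul hh (by fun_prop)) (hmul hR (by fun_prop)),
    intervalIntegral_mul_primitive_eq hT hR n] at hmom_n
  simp only [mul_assoc, neg_mul, intervalIntegral.integral_const_mul,
    intervalIntegral.integral_neg] at hmom_n
  refine hsplit.trans ?_
  field_simp
  linarith

theorem ae_weakRate_of_forall_vanishing (hT : 0 < T)
    (hu : MemLp (fun p : ℝ × ℝ => u p.1 p.2) 2 ((timeMeasure T).prod unitMeasure))
    (hf : MemLp (fun p : ℝ × ℝ => f p.1 p.2) 2 ((timeMeasure T).prod unitMeasure))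
    (hq₀ : MemLp q₀ 2 (timeMeasure T)) (hq₁ : MemLp q₁ 2 (timeMeasure T))
    (h : ∀ G, IsC T 1 2 G → (∀ x ∈ Icc (0 : ℝ) 1, G T x = 0) →
      -(∫ x, γ x * G 0 x ∂unitMeasure) = ∫ s in (0 : ℝ)..T, weakRate T u f q₀ q₁ G s)
    {G : ℝ → ℝ → ℝ} (hG : IsC T 1 2 G) : ∀ᵐ t ∂timeMeasure T,
      (∫ x, u t x * G t x ∂unitMeasure) - (∫ x, γ x * G 0 x ∂unitMeasure)
        = ∫ s in (0 : ℝ)..t, weakRate T u f q₀ q₁ G s := by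
  have hpairing : Integrable (fun t => ∫ x, u t x * G t x ∂unitMeasure) (timeMeasure T) :=
    (hu.integrable_mul (memLp_of_continuousOn_cylinder hG.continuousOn)).integral_prod_left
  refine ae_sub_eq_intervalIntegral_of_moments hT hpairing
    (integrable_weakRate hu hf hq₀ hq₁ hG) fun n => ?_
  let χ : ℝ → ℝ := fun s => T ^ (n + 1) - s ^ (n + 1)
  have hχ : ContDiff ℝ ∞ χ := by fun_prop
  have hχ_deriv : ∀ s, deriv χ s = -((n + 1) * s ^ n) := fun s => by simp [χ]
  have hid := h _ (hG.mul_time hT hχ) fun x _ => by simp [χ]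
  rw [intervalIntegral_congr_timeMeasure (right_mem_Icc.2 hT.le)
    (weakRate_mul_time hT hu hG hχ)] at hid
  simp only [hχ_deriv] at hid
  rw [← hid, ← integral_const_mul]
  congr 1
  exact integral_congr_ae (Eventually.of_forall fun x => by simp only [χ]; ring)

end TimeSlices

section Truncation

/-- The projection of the real line onto `[0,1]`. -/
def unitClip (a : ℝ) : ℝ := projIcc 0 1 zero_le_one a

theorem unitClip_mem_Icc (a : ℝ) : unitClip a ∈ Icc (0 : ℝ) 1 := Subtype.coe_prop _

theorem unitClip_of_mem {a : ℝ} (ha : a ∈ Icc (0 : ℝ) 1) : unitClip a = a := by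
  rw [unitClip, projIcc_of_mem _ ha]

@[fun_prop]
theorem continuous_unitClip : Continuous unitClip :=
  continuous_subtype_val.comp continuous_projIcc

theorem abs_unitClip_sub_le (a b : ℝ) : |unitClip a - unitClip b| ≤ |a - b| :=
  abs_projIcc_sub_projIcc zero_le_one

/-- The mobility, extended by zero outside `[0,1]`. -/
def truncMobility (a : ℝ) : ℝ := mobility (unitClip a)

theorem truncMobility_of_mem {a : ℝ} (ha : a ∈ Icc (0 : ℝ) 1) : truncMobility a = mobility a := by
  rw [truncMobility, unitClip_of_mem ha]

theorem truncMobility_of_notMem {a : ℝ} (ha : a ∉ Icc (0 : ℝ) 1) : truncMobility a = 0 := by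
  rw [truncMobility, unitClip, mobility]
  rcases lt_or_ge a 0 with ha0 | ha0
  · rw [projIcc_of_le_left _ ha0.le, zero_mul]
  · rw [projIcc_of_right_le _ (not_le.1 fun ha1 => ha ⟨ha0, ha1⟩).le, sub_self, mul_zero]

theorem abs_truncMobility_le (a : ℝ) : |truncMobility a| ≤ 1 := by
  obtain ⟨h0, h1⟩ := unitClip_mem_Icc a
  rw [truncMobility, mobility, abs_le]
  constructor <;> nlinarith

theorem abs_truncMobility_sub_le (a b : ℝ) : |truncMobility a - truncMobility b| ≤ |a - b| :=
  (abs_mobility_sub_le (unitClip_mem_Icc a) (unitClip_mem_Icc b)).trans (abs_unitClip_sub_le a b)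

theorem continuous_truncMobility : Continuous truncMobility := by
  unfold truncMobility mobility; fun_prop

/-- The spatial flux of the equation with the mobility replaced by its truncation, as a function of
the density `u` and its space derivative `g`. -/
def truncFlux (H u g : ℝ → ℝ → ℝ) (s x : ℝ) : ℝ :=
  g s x - 2 * truncMobility (u s x) * spaceDeriv H s x

theorem memLp_truncFlux {T : ℝ} {H u g : ℝ → ℝ → ℝ} (hH : IsC T 0 1 H)
    (hu : MemLp (fun p : ℝ × ℝ => u p.1 p.2) 2 ((timeMeasure T).prod unitMeasure))
    (hg : MemLp (fun p : ℝ × ℝ => g p.1 p.2) 2 ((timeMeasure T).prod unitMeasure)) :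
    MemLp (fun p : ℝ × ℝ => truncFlux H u g p.1 p.2) 2 ((timeMeasure T).prod unitMeasure) := by
  have hH' := memLp_of_continuousOn_cylinder (hH.continuousOn_spaceDeriv le_rfl)
  refine hg.sub (hH'.of_le_mul (c := 2) ?_ (Eventually.of_forall fun p => ?_))
  · exact ((continuous_truncMobility.comp_aestronglyMeasurable hu.1).const_mul 2).mul hH'.1
  · rw [norm_mul, norm_mul, Real.norm_ofNat]
    refine mul_le_mul_of_nonneg_right ?_ (norm_nonneg _)
    exact mul_le_of_le_one_right zero_le_two (abs_truncMobility_le _)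

end Truncation

section MaximumPrinciple

variable {ρ : ℝ → ℝ}

theorem firstPrim_eq_zero_of_eqOn_zero (hz : ∀ a ∈ Icc (0 : ℝ) 1, ρ a = 0) {a : ℝ}
    (ha : a ∈ Icc (0 : ℝ) 1) : firstPrim ρ a = 0 := by
  rw [firstPrim, intervalIntegral.integral_congr (g := fun _ => 0) fun s hs => ?_,
    intervalIntegral.integral_zero]
  rw [uIcc_of_le ha.1] at hs
  exact hz s ⟨hs.1, hs.2.trans ha.2⟩

theorem secondPrim_eq_zero_of_eqOn_zero (hz : ∀ a ∈ Icc (0 : ℝ) 1, ρ a = 0) {a : ℝ}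
    (ha : a ∈ Icc (0 : ℝ) 1) : secondPrim ρ a = 0 :=
  firstPrim_eq_zero_of_eqOn_zero (fun _ => firstPrim_eq_zero_of_eqOn_zero hz) ha

theorem mem_Icc_of_secondPrim_eq_zero (hρ : Continuous ρ) (h0 : ∀ a, 0 ≤ ρ a)
    (hpos : ∀ a ∉ Icc (0 : ℝ) 1, 0 < ρ a) {a : ℝ} (ha : secondPrim ρ a = 0) :
    a ∈ Icc (0 : ℝ) 1 := by
  have hmin : IsLocalMin (secondPrim ρ) a :=
    Eventually.of_forall fun b => ha.trans_le (secondPrim_nonneg hρ h0 b)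
  have hderiv : firstPrim ρ a = 0 :=
    hmin.hasDerivAt_eq_zero (hasDerivAt_firstPrim (continuous_firstPrim hρ) a)
  refine ⟨le_of_not_gt fun hneg => ?_, le_of_not_gt fun hgt => ?_⟩
  · have hlt : 0 < ∫ s in a..0, ρ s :=
      intervalIntegral.intervalIntegral_pos_of_pos_on (hρ.intervalIntegrable _ _)
        (fun s hs => hpos s fun h => hs.2.not_ge h.1) hneg
    rw [← firstPrim_sub hρ, firstPrim_zero, hderiv, sub_zero] at hlt
    exact hlt.false
  · have hlt : 0 < ∫ s in (1 : ℝ)..a, ρ s :=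
      intervalIntegral.intervalIntegral_pos_of_pos_on (hρ.intervalIntegrable _ _)
        (fun s hs => hpos s fun h => hs.1.not_ge h.2) hgt
    have hone := monotone_firstPrim hρ h0 zero_le_one
    rw [← firstPrim_sub hρ, hderiv] at hlt
    rw [firstPrim_zero] at hone
    linarith

theorem truncMobility_mul_eq_zero (hz : ∀ a ∈ Icc (0 : ℝ) 1, ρ a = 0) (a : ℝ) :
    truncMobility a * ρ a = 0 := by
  by_cases ha : a ∈ Icc (0 : ℝ) 1
  · rw [hz a ha, mul_zero]
  · rw [truncMobility_of_notMem ha, zero_mul]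

theorem boundaryFlux_mul_firstPrim_nonpos {ϱ D : ℝ} (hϱ : ϱ ∈ Icc (0 : ℝ) 1) (hD : 0 ≤ D)
    (hρ : Continuous ρ) (h0 : ∀ a, 0 ≤ ρ a) (hz : ∀ a ∈ Icc (0 : ℝ) 1, ρ a = 0) (a M : ℝ) :
    boundaryFlux ϱ D a M * firstPrim ρ a ≤ 0 := by
  have hcoeff : 0 ≤ ϱ * Real.exp M := mul_nonneg hϱ.1 (Real.exp_nonneg _)
  have hcoeff' : 0 ≤ (1 - ϱ) * Real.exp (-M) :=
    mul_nonneg (sub_nonneg.2 hϱ.2) (Real.exp_nonneg _)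
  have hmono := monotone_firstPrim hρ h0
  rw [boundaryFlux, mul_assoc]
  refine mul_nonpos_of_nonneg_of_nonpos (inv_nonneg.2 hD) ?_
  rcases le_total a 0 with ha | ha
  · have hprim : firstPrim ρ a ≤ 0 := firstPrim_zero (ρ := ρ) ▸ hmono ha
    exact mul_nonpos_of_nonneg_of_nonpos (by nlinarith) hprim
  · rcases le_total a 1 with ha1 | ha1
    · rw [firstPrim_eq_zero_of_eqOn_zero hz ⟨ha, ha1⟩, mul_zero]
    · have hprim : 0 ≤ firstPrim ρ a := firstPrim_zero (ρ := ρ) ▸ hmono ha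
      exact mul_nonpos_of_nonpos_of_nonneg (by nlinarith) hprim

/-- The distance to `[0,1]`, capped at `1`. Its second primitive is the convex function whose energy
inequality yields the maximum principle. -/
def excess (a : ℝ) : ℝ := min |a - unitClip a| 1

theorem continuous_excess : Continuous excess := by
  unfold excess; fun_prop

theorem excess_nonneg (a : ℝ) : 0 ≤ excess a := le_min (abs_nonneg _) zero_le_one

theorem excess_of_mem {a : ℝ} (ha : a ∈ Icc (0 : ℝ) 1) : excess a = 0 := by
  rw [excess, unitClip_of_mem ha, sub_self, abs_zero, min_eq_left zero_le_one]

theorem excess_pos_of_notMem {a : ℝ} (ha : a ∉ Icc (0 : ℝ) 1) : 0 < excess a :=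
  lt_min (abs_pos.2 (sub_ne_zero.2 fun h => ha (h ▸ unitClip_mem_Icc a))) one_pos

variable {α β A B T : ℝ} {H u g : ℝ → ℝ → ℝ} {γ : ℝ → ℝ}

theorem ae_mem_Icc_of_truncFlux (hα : α ∈ Icc (0 : ℝ) 1) (hβ : β ∈ Icc (0 : ℝ) 1) (hA : 0 ≤ A)
    (hB : 0 ≤ B) (hγ : ∀ x ∈ Icc (0 : ℝ) 1, γ x ∈ Icc (0 : ℝ) 1)
    (h : IsFluxSolution T u g (truncFlux H u g) (fun s => boundaryFlux α A (u s 0) (H s 0))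
      (fun s => boundaryFlux β B (u s 1) (H s 1)) γ) :
    ∀ᵐ p ∂((timeMeasure T).prod unitMeasure), u p.1 p.2 ∈ Icc (0 : ℝ) 1 := by
  have hz : ∀ a ∈ Icc (0 : ℝ) 1, excess a = 0 := fun _ => excess_of_mem
  have hbound : ∀ a, |excess a| ≤ 1 := fun a => by
    rw [abs_of_nonneg (excess_nonneg a)]; exact min_le_right _ _
  have hinit : ∀ᵐ x ∂unitMeasure, secondPrim excess (γ x) = 0 :=
    ae_unitMeasure_mem.mono fun x hx => secondPrim_eq_zero_of_eqOn_zero hz (hγ x hx)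
  refine (h.ae_secondPrim_eq_zero continuous_excess excess_nonneg hbound hinit le_rfl
    (Eventually.of_forall fun p => ?_)).mono fun p hp =>
      mem_Icc_of_secondPrim_eq_zero continuous_excess excess_nonneg
        (fun _ => excess_pos_of_notMem) hp
  have hright := boundaryFlux_mul_firstPrim_nonpos hβ hB continuous_excess excess_nonneg hz
    (u p.1 1) (H p.1 1)
  have hleft := boundaryFlux_mul_firstPrim_nonpos hα hA continuous_excess excess_nonneg hz
    (u p.1 0) (H p.1 0)
  have hdrift : truncFlux H u g p.1 p.2 * (excess (u p.1 p.2) * g p.1 p.2)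
      = excess (u p.1 p.2) * g p.1 p.2 ^ 2 := by
    rw [truncFlux]
    linear_combination (-2 * spaceDeriv H p.1 p.2 * g p.1 p.2)
      * truncMobility_mul_eq_zero hz (u p.1 p.2)
  rw [hdrift]
  linarith [mul_nonneg (excess_nonneg (u p.1 p.2)) (sq_nonneg (g p.1 p.2))]

end MaximumPrinciple

theorem inner_toLp_eq {α : Type*} [MeasurableSpace α] {μ : Measure α} {f g : α → ℝ}
    (hf : MemLp f 2 μ) (hg : MemLp g 2 μ) :
    inner ℝ (hf.toLp f) (hg.toLp g) = ∫ x, f x * g x ∂μ := by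
  rw [L2.inner_def]
  refine integral_congr_ae ?_
  filter_upwards [hf.coeFn_toLp, hg.coeFn_toLp] with x hfx hgx
  rw [hfx, hgx, real_inner_eq_re_inner, RCLike.inner_apply, conj_trivial, mul_comm]
  rfl

theorem norm_sq_toLp_eq {α : Type*} [MeasurableSpace α] {μ : Measure α} {f : α → ℝ}
    (hf : MemLp f 2 μ) : ‖hf.toLp f‖ ^ 2 = ∫ x, f x ^ 2 ∂μ := by
  rw [← real_inner_self_eq_norm_sq, inner_toLp_eq]
  simp_rw [sq]

section Slices

variable {T : ℝ}

/-- The space of test functions of class `C^{1,2}`. -/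
def testSpace (T : ℝ) (hT : 0 < T) : Submodule ℝ (ℝ → ℝ → ℝ) where
  carrier := {G | IsC T 1 2 G}
  add_mem' h h' := h.add hT h'
  zero_mem' := isC_zero
  smul_mem' c _ h := h.const_smul hT c

theorem IsC.memLp_slice {m n : ℕ} {G : ℝ → ℝ → ℝ} (hG : IsC T m n G) {t : ℝ} (ht : t ∈ Icc 0 T) :
    MemLp (G t) 2 unitMeasure :=
  memLp_restrict_of_continuousOn isCompact_Icc (continuousOn_slice_left hG.continuousOn ht)

/-- Evaluation of a test function at the time `t`, as a linear map into `L²`. -/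
def sliceMap (hT : 0 < T) {t : ℝ} (ht : t ∈ Icc 0 T) :
    testSpace T hT →ₗ[ℝ] Lp ℝ 2 unitMeasure where
  toFun G := (IsC.memLp_slice G.2 ht).toLp (G.1 t)
  map_add' _ _ := rfl
  map_smul' _ _ := rfl

theorem continuousOn_integral_sq {m n : ℕ} {G : ℝ → ℝ → ℝ} (hG : IsC T m n G) :
    ContinuousOn (fun t => ∫ x, G t x ^ 2 ∂unitMeasure) (Icc 0 T) := by
  obtain ⟨C, -, hC⟩ := exists_bound_of_continuousOn_cylinder hG.continuousOn
  refine continuousOn_of_dominated (bound := fun _ => C ^ 2)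
    (fun t ht => (hG.memLp_slice ht).1.pow 2) (fun t ht => ?_) (integrable_const _) ?_
  · filter_upwards [ae_unitMeasure_mem] with x hx
    rw [norm_pow]
    exact pow_le_pow_left₀ (norm_nonneg _) (hC (t, x) ⟨ht, hx⟩) 2
  · filter_upwards [ae_unitMeasure_mem] with x hx
    exact (continuousOn_slice_right hG.continuousOn hx).pow 2

theorem le_of_ae_le_of_continuousOn (hT : 0 < T) {a b : ℝ → ℝ} (ha : ContinuousOn a (Icc 0 T))
    (hb : ContinuousOn b (Icc 0 T)) (h : ∀ᵐ t ∂timeMeasure T, a t ≤ b t) {t : ℝ}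
    (ht : t ∈ Icc 0 T) : a t ≤ b t :=
  max_eq_right_iff.1 <| Measure.eqOn_Icc_of_ae_eq volume hT.ne (f := fun t => max (a t) (b t))
    (g := b) (h.mono fun _ => max_eq_right) (ha.sup hb) hb ht

theorem sq_integral_mul_le_of_mem_Icc {α : Type*} [MeasurableSpace α] {μ : Measure α}
    [IsProbabilityMeasure μ] {a φ : α → ℝ} (ham : AEStronglyMeasurable a μ)
    (ha : ∀ᵐ x ∂μ, a x ∈ Icc (0 : ℝ) 1) (hφ : MemLp φ 2 μ) :
    (∫ x, a x * φ x ∂μ) ^ 2 ≤ ∫ x, φ x ^ 2 ∂μ := by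
  have hmul : MemLp (fun x => a x * φ x) 2 μ := hφ.of_le (ham.mul hφ.1) (ha.mono fun x hx => by
    rw [norm_mul, Real.norm_of_nonneg hx.1]
    exact mul_le_of_le_one_left (norm_nonneg _) hx.2)
  refine (sq_integral_le_integral_sq hmul).trans (integral_mono_ae hmul.integrable_sq
    hφ.integrable_sq (ha.mono fun x hx => ?_))
  refine (mul_pow _ _ _).trans_le ?_
  exact mul_le_of_le_one_left (sq_nonneg _) (pow_le_one₀ hx.1 hx.2)

variable {u : ℝ → ℝ → ℝ} {Λ : (ℝ → ℝ → ℝ) → ℝ → ℝ}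
  (hT : 0 < T) (hu : MemLp (fun p : ℝ × ℝ => u p.1 p.2) 2 ((timeMeasure T).prod unitMeasure))
  (hcont : ∀ G, IsC T 1 2 G → ContinuousOn (Λ G) (Icc 0 T))
  (hΛ : ∀ G, IsC T 1 2 G → ∀ᵐ t ∂timeMeasure T, ∫ x, u t x * G t x ∂unitMeasure = Λ G t)
  {t : ℝ} (ht : t ∈ Icc 0 T)

include hT hu hcont hΛ ht in
theorem sq_continuousVersion_le
    (hI : ∀ᵐ p ∂((timeMeasure T).prod unitMeasure), u p.1 p.2 ∈ Icc (0 : ℝ) 1)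
    {G : ℝ → ℝ → ℝ} (hG : IsC T 1 2 G) : Λ G t ^ 2 ≤ ∫ x, G t x ^ 2 ∂unitMeasure := by
  refine le_of_ae_le_of_continuousOn hT ((hcont G hG).pow 2) (continuousOn_integral_sq hG) ?_ ht
  filter_upwards [hΛ G hG, ae_memLp_slice hu, Measure.ae_ae_of_ae_prod hI, ae_timeMeasure_mem T]
    with s hs hus hIs hsT
  rw [Pi.pow_apply, ← hs]
  exact sq_integral_mul_le_of_mem_Icc hus.1 hIs (hG.memLp_slice hsT)

/-- The linear functional `G ↦ Λ G t` on test functions, for a family of continuous versions `Λ G`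
of the pairings `∫ u_t G_t`. -/
def sliceFunctional : testSpace T hT →ₗ[ℝ] ℝ where
  toFun G := Λ G.1 t
  map_add' G G' := by
    refine Measure.eqOn_Icc_of_ae_eq volume hT.ne ?_ (hcont _ (G + G').2)
      ((hcont _ G.2).add (hcont _ G'.2)) ht
    filter_upwards [hΛ _ G.2, hΛ _ G'.2, hΛ _ (G + G').2, ae_memLp_slice hu, ae_timeMeasure_mem T]
      with s hG hG' hsum hus hs
    rw [Pi.add_apply, ← hG, ← hG', ← hsum]
    refine Eq.trans ?_ (integral_add (hus.integrable_mul (IsC.memLp_slice G.2 hs))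
      (hus.integrable_mul (IsC.memLp_slice G'.2 hs)))
    exact integral_congr_ae (Eventually.of_forall fun x => mul_add _ _ _)
  map_smul' c G := by
    refine Measure.eqOn_Icc_of_ae_eq volume hT.ne ?_ (hcont _ (c • G).2)
      (continuousOn_const.mul (hcont _ G.2)) ht
    filter_upwards [hΛ _ G.2, hΛ _ (c • G).2] with s hG hcG
    rw [← hcG, Pi.mul_apply, ← hG, ← integral_const_mul]
    exact integral_congr_ae (Eventually.of_forall fun x => mul_left_comm _ _ _)

include hT hu hcont hΛ ht in
theorem exists_memLp_integral_mul_eq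
    (hI : ∀ᵐ p ∂((timeMeasure T).prod unitMeasure), u p.1 p.2 ∈ Icc (0 : ℝ) 1) :
    ∃ v : ℝ → ℝ, MemLp v 2 unitMeasure ∧
      ∀ G, IsC T 1 2 G → ∫ x, v x * G t x ∂unitMeasure = Λ G t := by
  have hbound : ∀ G, ‖sliceFunctional hT hu hcont hΛ ht G‖ ≤ 1 * ‖sliceMap hT ht G‖ := fun G => by
    rw [one_mul]
    refine abs_le_of_sq_le_sq ?_ (norm_nonneg _)
    exact (sq_continuousVersion_le hT hu hcont hΛ ht hI G.2).trans_eq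
      (norm_sq_toLp_eq (IsC.memLp_slice G.2 ht)).symm
  obtain ⟨v, hv⟩ := exists_inner_eq_of_lipschitzWith (i := sliceMap hT ht) (N := 0) (C := 1)
    (fun G => by rw [NNReal.coe_one, one_mul]) hbound (LipschitzWith.const 0) (by simp)
  refine ⟨v, Lp.memLp v, fun G hG => ?_⟩
  rw [← inner_toLp_eq (Lp.memLp v) (hG.memLp_slice ht), Lp.toLp_coeFn]
  refine (hv ⟨G, hG⟩).trans ?_
  rw [Pi.zero_apply, inner_zero_left, add_zero]
  rfl

end Slices

section Modification

variable {T : ℝ} {u : ℝ → ℝ → ℝ} {Λ : (ℝ → ℝ → ℝ) → ℝ → ℝ}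

theorem ae_eq_of_moments_eq {f h : ℝ → ℝ} (hf : MemLp f 2 unitMeasure) (hh : MemLp h 2 unitMeasure)
    (hmoments : ∀ m : ℕ, ∫ x, f x * x ^ m ∂unitMeasure = ∫ x, h x * x ^ m ∂unitMeasure) :
    f =ᵐ[unitMeasure] h := by
  have key := ae_eq_zero_of_moments_eq_zero (a := 0) (b := 1) (h := fun x => f x - h x)
    ((hf.sub hh).integrable one_le_two) fun m => by
      simp_rw [mul_comm (_ ^ m)]
      exact (integral_sub_mul_of_memLp hf hh (memLp_pow m)).trans (sub_eq_zero.2 (hmoments m))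
  filter_upwards [key] with x hx using sub_eq_zero.1 hx

theorem exists_modification_integral_mul_eq (hT : 0 < T)
    (hu : MemLp (fun p : ℝ × ℝ => u p.1 p.2) 2 ((timeMeasure T).prod unitMeasure))
    (hcont : ∀ G, IsC T 1 2 G → ContinuousOn (Λ G) (Icc 0 T))
    (hΛ : ∀ G, IsC T 1 2 G → ∀ᵐ t ∂timeMeasure T, ∫ x, u t x * G t x ∂unitMeasure = Λ G t)
    (hI : ∀ᵐ p ∂((timeMeasure T).prod unitMeasure), u p.1 p.2 ∈ Icc (0 : ℝ) 1) :
    ∃ v : ℝ → ℝ → ℝ, (∀ᵐ t ∂timeMeasure T, v t = u t) ∧ ∀ t ∈ Icc 0 T,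
      MemLp (v t) 2 unitMeasure ∧ ∀ G, IsC T 1 2 G → ∫ x, v t x * G t x ∂unitMeasure = Λ G t := by
  classical
  choose! w hw hwΛ using fun t (ht : t ∈ Icc 0 T) =>
    exists_memLp_integral_mul_eq hT hu hcont hΛ ht hI
  have huw : ∀ᵐ t ∂timeMeasure T, u t =ᵐ[unitMeasure] w t := by
    filter_upwards [ae_all_iff.2 fun m => hΛ _ (isC_pow m), ae_memLp_slice hu,
      ae_timeMeasure_mem T] with t hmoments hut ht
    exact ae_eq_of_moments_eq hut (hw t ht) fun m =>
      (hmoments m).trans (hwΛ t ht _ (isC_pow m)).symm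
  let v : ℝ → ℝ → ℝ := fun t => if u t =ᵐ[unitMeasure] w t then u t else w t
  have hvw : ∀ t, v t =ᵐ[unitMeasure] w t := fun t => by
    simp only [v]
    split_ifs with h
    exacts [h, EventuallyEq.rfl]
  refine ⟨v, huw.mono fun t ht => if_pos ht, fun t ht => ⟨(hw t ht).ae_eq (hvw t).symm,
    fun G hG => (integral_congr_ae ?_).trans (hwΛ t ht G hG)⟩⟩
  filter_upwards [hvw t] with x hx
  rw [hx]

end Modification

section FromTruncated

/-- The weak rate of the problem with truncated mobility. -/
def truncRate (α β A B T : ℝ) (H u g : ℝ → ℝ → ℝ) (G : ℝ → ℝ → ℝ) : ℝ → ℝ :=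
  weakRate T u (truncFlux H u g) (fun s => boundaryFlux α A (u s 0) (H s 0))
    (fun s => boundaryFlux β B (u s 1) (H s 1)) G

/-- `u`, with space derivative `g`, solves the problem with truncated mobility, in the weak form
with test functions that vanish at the final time. -/
structure IsTruncatedSolution (α β A B T : ℝ) (H : ℝ → ℝ → ℝ) (γ : ℝ → ℝ) (u g : ℝ → ℝ → ℝ) :
    Prop where
  memLp : MemLp (fun p : ℝ × ℝ => u p.1 p.2) 2 ((timeMeasure T).prod unitMeasure)
  memLp_deriv : MemLp (fun p : ℝ × ℝ => g p.1 p.2) 2 ((timeMeasure T).prod unitMeasure)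
  eq_primitive : ∀ᵐ t ∂timeMeasure T, ∀ x ∈ Icc (0 : ℝ) 1, u t x = u t 0 + primitive (g t) x
  weak : ∀ G, IsC T 1 2 G → (∀ x ∈ Icc (0 : ℝ) 1, G T x = 0) →
    -(∫ x, γ x * G 0 x ∂unitMeasure) = ∫ s in (0 : ℝ)..T, truncRate α β A B T H u g G s

variable {α β A B T : ℝ} {H u v g : ℝ → ℝ → ℝ} {γ : ℝ → ℝ}

theorem truncRate_congr {s : ℝ} (h : v s = u s) (G : ℝ → ℝ → ℝ) :
    truncRate α β A B T H v g G s = truncRate α β A B T H u g G s := by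
  simp only [truncRate, weakRate, truncFlux, h]

theorem truncRate_eq_weakRate_driftFlux {s : ℝ}
    (h : ∀ᵐ x ∂unitMeasure, u s x ∈ Icc (0 : ℝ) 1) (G : ℝ → ℝ → ℝ) :
    truncRate α β A B T H u g G s
      = weakRate T u (driftFlux H u g) (fun s => boundaryFlux α A (u s 0) (H s 0))
        (fun s => boundaryFlux β B (u s 1) (H s 1)) G s := by
  have hflux : ∫ x, truncFlux H u g s x * spaceDeriv G s x ∂unitMeasure
      = ∫ x, driftFlux H u g s x * spaceDeriv G s x ∂unitMeasure :=
    integral_congr_ae (h.mono fun x hx => by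
      simp only [truncFlux, driftFlux, truncMobility_of_mem hx])
  rw [truncRate, weakRate, weakRate, hflux]

namespace IsTruncatedSolution

theorem congr (h : IsTruncatedSolution α β A B T H γ u g) (hT : 0 ≤ T)
    (hvu : ∀ᵐ t ∂timeMeasure T, v t = u t) : IsTruncatedSolution α β A B T H γ v g where
  memLp := h.memLp.ae_eq ((Measure.quasiMeasurePreserving_fst.ae hvu).mono fun p hp => by
    simp only [hp])
  memLp_deriv := h.memLp_deriv
  eq_primitive := by
    filter_upwards [h.eq_primitive, hvu] with t ht hvut
    rwa [hvut]
  weak G hG hGT := (h.weak G hG hGT).trans <|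
    intervalIntegral_congr_timeMeasure (right_mem_Icc.2 hT) <|
      hvu.mono fun _ hs => (truncRate_congr hs G).symm

variable (h : IsTruncatedSolution α β A B T H γ u g) (hH : IsC T 0 1 H)

include h hH

theorem memLp_boundaryFlux_left :
    MemLp (fun s => boundaryFlux α A (u s 0) (H s 0)) 2 (timeMeasure T) :=
  memLp_boundaryFlux (memLp_trace_zero h.memLp h.memLp_deriv h.eq_primitive)
    (continuousOn_slice_right hH.continuousOn (left_mem_Icc.2 zero_le_one))

theorem memLp_boundaryFlux_right :
    MemLp (fun s => boundaryFlux β B (u s 1) (H s 1)) 2 (timeMeasure T) :=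
  memLp_boundaryFlux (memLp_trace_one h.memLp h.memLp_deriv h.eq_primitive)
    (continuousOn_slice_right hH.continuousOn (right_mem_Icc.2 zero_le_one))

theorem integrable_truncRate {G : ℝ → ℝ → ℝ} (hG : IsC T 1 2 G) :
    Integrable (truncRate α β A B T H u g G) (timeMeasure T) :=
  integrable_weakRate h.memLp (memLp_truncFlux hH h.memLp h.memLp_deriv)
    (h.memLp_boundaryFlux_left hH) (h.memLp_boundaryFlux_right hH) hG

theorem ae_eq_intervalIntegral (hT : 0 < T) {G : ℝ → ℝ → ℝ} (hG : IsC T 1 2 G) :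
    ∀ᵐ t ∂timeMeasure T,
      (∫ x, u t x * G t x ∂unitMeasure) - (∫ x, γ x * G 0 x ∂unitMeasure)
        = ∫ s in (0 : ℝ)..t, truncRate α β A B T H u g G s :=
  ae_weakRate_of_forall_vanishing hT h.memLp (memLp_truncFlux hH h.memLp h.memLp_deriv)
    (h.memLp_boundaryFlux_left hH) (h.memLp_boundaryFlux_right hH) h.weak hG

theorem ae_mem_Icc (hα : α ∈ Icc (0 : ℝ) 1) (hβ : β ∈ Icc (0 : ℝ) 1) (hA : 0 ≤ A) (hB : 0 ≤ B)
    (hT : 0 < T) (hγ : ∀ x ∈ Icc (0 : ℝ) 1, γ x ∈ Icc (0 : ℝ) 1) (hγ2 : MemLp γ 2 unitMeasure) :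
    ∀ᵐ p ∂((timeMeasure T).prod unitMeasure), u p.1 p.2 ∈ Icc (0 : ℝ) 1 :=
  ae_mem_Icc_of_truncFlux hα hβ hA hB hγ <|
    isFluxSolution_of_weakRate h.memLp h.memLp_deriv (memLp_truncFlux hH h.memLp h.memLp_deriv)
      (h.memLp_boundaryFlux_left hH) (h.memLp_boundaryFlux_right hH) hγ2 h.eq_primitive
      fun _ => h.ae_eq_intervalIntegral hH hT

theorem isWeakSolution
    (hI : ∀ᵐ p ∂((timeMeasure T).prod unitMeasure), u p.1 p.2 ∈ Icc (0 : ℝ) 1)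
    (hslice : ∀ t ∈ Icc 0 T, MemLp (u t) 2 unitMeasure ∧ ∀ G, IsC T 1 2 G →
      (∫ x, u t x * G t x ∂unitMeasure) = (∫ x, γ x * G 0 x ∂unitMeasure)
        + ∫ s in (0 : ℝ)..t, truncRate α β A B T H u g G s) :
    IsWeakSolution α β A B T H γ u where
  memLp t ht := (hslice t ht).1
  mem_Icc := by rwa [restrict_cylinder]
  weak := by
    refine ⟨g, ⟨by rw [restrict_cylinder]; exact h.memLp,
      by rw [restrict_cylinder]; exact h.memLp_deriv, ?_⟩, fun t ht G hG => ?_⟩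
    · change ∀ᵐ t ∂timeMeasure T, _
      filter_upwards [h.eq_primitive, ae_memLp_slice h.memLp_deriv] with t ht hgt
      exact isH1_of_eq_primitive hgt ht
    · have htI := Ioc_subset_Icc_self ht
      rw [weakIdentity_iff h.memLp (memLp_driftFlux hH h.memLp h.memLp_deriv hI)
        (h.memLp_boundaryFlux_left hH) (h.memLp_boundaryFlux_right hH) hG htI,
        (hslice t htI).2 G hG, add_sub_cancel_left]
      exact intervalIntegral_congr_timeMeasure htI <| (Measure.ae_ae_of_ae_prod hI).mono
        fun s hs => truncRate_eq_weakRate_driftFlux hs G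

theorem exists_isWeakSolution (hα : α ∈ Icc (0 : ℝ) 1) (hβ : β ∈ Icc (0 : ℝ) 1) (hA : 0 ≤ A)
    (hB : 0 ≤ B) (hT : 0 < T) (hγ : ∀ x ∈ Icc (0 : ℝ) 1, γ x ∈ Icc (0 : ℝ) 1)
    (hγ2 : MemLp γ 2 unitMeasure) : ∃ v, IsWeakSolution α β A B T H γ v := by
  have hI := h.ae_mem_Icc hH hα hβ hA hB hT hγ hγ2
  obtain ⟨v, hvu, hv⟩ := exists_modification_integral_mul_eq (Λ := fun G t =>
      (∫ x, γ x * G 0 x ∂unitMeasure) + ∫ s in (0 : ℝ)..t, truncRate α β A B T H u g G s)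
    hT h.memLp
    (fun G hG => continuousOn_const.add
      (continuousOn_intervalIntegral hT.le (h.integrable_truncRate hH hG)))
    (fun G hG => (h.ae_eq_intervalIntegral hH hT hG).mono fun t ht => sub_eq_iff_eq_add'.1 ht) hI
  refine ⟨v, (h.congr hT.le hvu).isWeakSolution hH ?_ fun t ht => ⟨(hv t ht).1, fun G hG => ?_⟩⟩
  · filter_upwards [hI, Measure.quasiMeasurePreserving_fst.ae hvu] with p hp hvp
    rwa [hvp]
  · rw [(hv t ht).2 G hG]
    exact congrArg _ (intervalIntegral_congr_timeMeasure ht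
      (hvu.mono fun s hs => (truncRate_congr hs G).symm))

end IsTruncatedSolution

end FromTruncated

section HilbertSpace

variable {X : Type*} [MeasurableSpace X] {μ : Measure X} {ι : Type*}

/-- A family of square integrable functions, as an element of a product of `L²` spaces. -/
def familyToLp (f : ι → X → ℝ) (hf : ∀ j, MemLp (f j) 2 μ) : PiLp 2 fun _ : ι => Lp ℝ 2 μ :=
  WithLp.toLp 2 fun j => (hf j).toLp (f j)

theorem coeFn_familyToLp (f : ι → X → ℝ) (hf : ∀ j, MemLp (f j) 2 μ) (j : ι) :
    familyToLp f hf j =ᵐ[μ] f j := (hf j).coeFn_toLp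

theorem familyToLp_coeFn (e : PiLp 2 fun _ : ι => Lp ℝ 2 μ) :
    familyToLp (fun j => e j) (fun j => Lp.memLp (e j)) = e := by
  ext1 j
  exact Lp.toLp_coeFn (e j) (Lp.memLp (e j))

theorem inner_familyToLp [Fintype ι] {f g : ι → X → ℝ} (hf : ∀ j, MemLp (f j) 2 μ)
    (hg : ∀ j, MemLp (g j) 2 μ) :
    inner ℝ (familyToLp f hf) (familyToLp g hg) = ∫ x, ∑ j, f j x * g j x ∂μ := by
  rw [PiLp.inner_apply]
  refine Eq.trans (Finset.sum_congr rfl fun j _ => inner_toLp_eq (hf j) (hg j)) ?_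
  exact (integral_finsetSum _ fun j _ => (hf j).integrable_mul (hg j)).symm

theorem norm_sq_familyToLp [Fintype ι] {f : ι → X → ℝ} (hf : ∀ j, MemLp (f j) 2 μ) :
    ‖familyToLp f hf‖ ^ 2 = ∫ x, ∑ j, f j x ^ 2 ∂μ := by
  rw [← real_inner_self_eq_norm_sq, inner_familyToLp]
  simp_rw [sq]

/-- A linear family of square integrable functions, as a linear map to a product of `L²`
spaces. Linearity is only required almost everywhere. -/
def familyMap {Φ : Type*} [AddCommGroup Φ] [Module ℝ Φ] (a : Φ → ι → X → ℝ)
    (ha : ∀ φ j, MemLp (a φ j) 2 μ) (hadd : ∀ φ ψ j, a (φ + ψ) j =ᵐ[μ] a φ j + a ψ j)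
    (hsmul : ∀ (c : ℝ) φ j, a (c • φ) j =ᵐ[μ] c • a φ j) :
    Φ →ₗ[ℝ] PiLp 2 fun _ : ι => Lp ℝ 2 μ where
  toFun φ := familyToLp (a φ) (ha φ)
  map_add' φ ψ := by
    ext1 j
    exact (MemLp.toLp_congr (ha _ j) ((ha φ j).add (ha ψ j)) (hadd φ ψ j)).trans
      (MemLp.toLp_add (ha φ j) (ha ψ j))
  map_smul' c φ := by
    ext1 j
    exact (MemLp.toLp_congr (ha _ j) ((ha φ j).const_smul c) (hsmul c φ j)).trans
      (MemLp.toLp_const_smul c (ha φ j))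

theorem exists_continuousLinearMap_of_integral_sq_le (S : (X → ℝ) → X → ℝ)
    (hmem : ∀ f, MemLp f 2 μ → MemLp (S f) 2 μ)
    (hle : ∀ f, MemLp f 2 μ → ∫ x, S f x ^ 2 ∂μ ≤ ∫ x, f x ^ 2 ∂μ)
    (hcongr : ∀ f g, f =ᵐ[μ] g → S f =ᵐ[μ] S g)
    (hadd : ∀ f g, MemLp f 2 μ → MemLp g 2 μ → S (f + g) =ᵐ[μ] S f + S g)
    (hsmul : ∀ (c : ℝ) f, S (c • f) =ᵐ[μ] c • S f) :
    ∃ L : Lp ℝ 2 μ →L[ℝ] Lp ℝ 2 μ, ∀ f, L f =ᵐ[μ] S f := by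
  have hm : ∀ f : Lp ℝ 2 μ, MemLp (S f) 2 μ := fun f => hmem f (Lp.memLp f)
  let L₀ : Lp ℝ 2 μ →ₗ[ℝ] Lp ℝ 2 μ :=
    { toFun := fun f => (hm f).toLp (S f)
      map_add' := fun f g => by
        refine (MemLp.toLp_congr (hm _) ((hm f).add (hm g)) ?_).trans (MemLp.toLp_add _ _)
        exact (hcongr _ _ (Lp.coeFn_add f g)).trans (hadd _ _ (Lp.memLp f) (Lp.memLp g))
      map_smul' := fun c f => by
        refine (MemLp.toLp_congr (hm _) ((hm f).const_smul c) ?_).trans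
          (MemLp.toLp_const_smul c _)
        exact (hcongr _ _ (Lp.coeFn_smul c f)).trans (hsmul c _) }
  refine ⟨L₀.mkContinuous 1 fun f => ?_, fun f => (hm f).coeFn_toLp⟩
  rw [one_mul]
  refine le_of_sq_le_sq ?_ (norm_nonneg _)
  calc ‖(hm f).toLp (S f)‖ ^ 2 = ∫ x, S f x ^ 2 ∂μ := norm_sq_toLp_eq (hm f)
    _ ≤ ∫ x, f x ^ 2 ∂μ := hle f (Lp.memLp f)
    _ = ‖(Lp.memLp f).toLp f‖ ^ 2 := (norm_sq_toLp_eq (Lp.memLp f)).symm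
    _ = ‖f‖ ^ 2 := by rw [Lp.toLp_coeFn]

end HilbertSpace

section Operators

variable {T : ℝ}

theorem ae_slice_eq {f g : ℝ × ℝ → ℝ} (h : f =ᵐ[(timeMeasure T).prod unitMeasure] g) :
    ∀ᵐ p ∂((timeMeasure T).prod unitMeasure), ∀ᵐ y ∂unitMeasure, f (p.1, y) = g (p.1, y) :=
  Measure.quasiMeasurePreserving_fst.ae (Measure.ae_ae_of_ae_prod h)

theorem ae_memLp_slice_fst {f : ℝ × ℝ → ℝ} (h : MemLp f 2 ((timeMeasure T).prod unitMeasure)) :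
    ∀ᵐ p ∂((timeMeasure T).prod unitMeasure), MemLp (fun y => f (p.1, y)) 2 unitMeasure :=
  Measure.quasiMeasurePreserving_fst.ae (ae_memLp_slice h)

theorem exists_spaceIntegral_continuousLinearMap (T : ℝ) :
    ∃ L : Lp ℝ 2 ((timeMeasure T).prod unitMeasure) →L[ℝ] Lp ℝ 2 ((timeMeasure T).prod unitMeasure),
      ∀ f, L f =ᵐ[(timeMeasure T).prod unitMeasure] fun p => ∫ y, f (p.1, y) ∂unitMeasure := by
  refine exists_continuousLinearMap_of_integral_sq_le
    (fun f p => ∫ y, f (p.1, y) ∂unitMeasure) (fun f hf => ?_) (fun f hf => ?_) (fun f g h => ?_)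
    (fun f g hf hg => ?_) (fun c f => Eventually.of_forall fun p => integral_const_mul c _)
  · exact (memLp_integral_of_memLp (F := fun t y => f (t, y)) hf).comp_fst unitMeasure
  · have hm := memLp_integral_of_memLp (F := fun t y => f (t, y)) hf
    refine le_trans (le_of_eq ?_) (integral_sq_integral_le (F := fun t y => f (t, y)) hf)
    rw [integral_prod _ (hm.comp_fst unitMeasure).integrable_sq]
    simp
  · filter_upwards [ae_slice_eq h] with p hp using integral_congr_ae hp
  · filter_upwards [ae_memLp_slice_fst hf, ae_memLp_slice_fst hg] with p h1 h2
    exact integral_add (h1.integrable one_le_two) (h2.integrable one_le_two)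

theorem exists_primitive_continuousLinearMap (T : ℝ) :
    ∃ L : Lp ℝ 2 ((timeMeasure T).prod unitMeasure) →L[ℝ] Lp ℝ 2 ((timeMeasure T).prod unitMeasure),
      ∀ f, L f =ᵐ[(timeMeasure T).prod unitMeasure]
        fun p => primitive (fun y => f (p.1, y)) p.2 := by
  refine exists_continuousLinearMap_of_integral_sq_le
    (fun f p => primitive (fun y => f (p.1, y)) p.2)
    (fun f hf => memLp_primitive (F := fun t y => f (t, y)) hf)
    (fun f hf => integral_sq_primitive_le (F := fun t y => f (t, y)) hf) (fun f g h => ?_)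
    (fun f g hf hg => ?_) (fun c f => Eventually.of_forall fun p => ?_)
  · filter_upwards [ae_slice_eq h] with p hp using primitive_congr hp _
  · filter_upwards [ae_memLp_slice_fst hf, ae_memLp_slice_fst hg] with p h1 h2
    simp only [primitive, Pi.add_apply, mul_add]
    exact integral_add (integrable_leKernel_mul (h1.integrable one_le_two) _)
      (integrable_leKernel_mul (h2.integrable one_le_two) _)
  · simp only [primitive, Pi.smul_apply, smul_eq_mul, mul_left_comm _ c]
    exact integral_const_mul c _

end Operators

section Jets

variable {T : ℝ}

/-- The test functions of class `C^{1,2}` that vanish at the final time. -/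
def vanishingSpace (T : ℝ) (hT : 0 < T) : Submodule ℝ (ℝ → ℝ → ℝ) where
  carrier := {G | IsC T 1 2 G ∧ ∀ x ∈ Icc (0 : ℝ) 1, G T x = 0}
  add_mem' h h' := ⟨h.1.add hT h'.1, fun x hx => by
    simp only [Pi.add_apply, h.2 x hx, h'.2 x hx, add_zero]⟩
  zero_mem' := ⟨isC_zero, fun _ _ => rfl⟩
  smul_mem' c _ h := ⟨h.1.const_smul hT c, fun x hx => by
    simp only [Pi.smul_apply, h.2 x hx, smul_zero]⟩

/-- The Hilbert space in which the parabolic problem is solved: a function on the cylinder, its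
space derivative, and its traces at `x = 1` and at `x = 0`. The traces, functions of time, are
regarded as functions on the cylinder that do not depend on space. -/
abbrev JetSpace (T : ℝ) : Type :=
  PiLp 2 fun _ : Fin 4 => Lp ℝ 2 ((timeMeasure T).prod unitMeasure)

/-- A function on the cylinder, scaled by `r`, with its space derivative and its traces. -/
def jet (r : ℝ) (G : ℝ → ℝ → ℝ) : Fin 4 → ℝ × ℝ → ℝ :=
  ![fun p => r * G p.1 p.2, fun p => spaceDeriv G p.1 p.2, fun p => G p.1 1, fun p => G p.1 0]

/-- The image of a test function under the formal adjoint of the parabolic operator with zeroth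
order term `r²` and Robin coefficients `c₀`, `c₁`, to be paired with `jet r`. -/
def dualJet (T r : ℝ) (c₀ c₁ : ℝ → ℝ) (G : ℝ → ℝ → ℝ) : Fin 4 → ℝ × ℝ → ℝ :=
  ![fun p => r⁻¹ * -timeDeriv T G p.1 p.2 + r * G p.1 p.2, fun p => spaceDeriv G p.1 p.2,
    fun p => c₁ p.1 * G p.1 1, fun p => c₀ p.1 * G p.1 0]

theorem IsC.memLp_trace {m n : ℕ} {G : ℝ → ℝ → ℝ} (hG : IsC T m n G) {x : ℝ}
    (hx : x ∈ Icc (0 : ℝ) 1) : MemLp (fun t => G t x) 2 (timeMeasure T) :=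
  memLp_restrict_of_continuousOn isCompact_Icc (continuousOn_slice_right hG.continuousOn hx)

theorem memLp_jet (r : ℝ) {G : ℝ → ℝ → ℝ} (hG : IsC T 1 2 G) (j : Fin 4) :
    MemLp (jet r G j) 2 ((timeMeasure T).prod unitMeasure) := by
  fin_cases j
  · exact (memLp_of_continuousOn_cylinder hG.continuousOn).const_mul r
  · exact memLp_of_continuousOn_cylinder (hG.continuousOn_spaceDeriv one_le_two)
  · exact (hG.memLp_trace (right_mem_Icc.2 zero_le_one)).comp_fst unitMeasure
  · exact (hG.memLp_trace (left_mem_Icc.2 zero_le_one)).comp_fst unitMeasure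

theorem memLp_dualJet (r : ℝ) {c₀ c₁ : ℝ → ℝ} (h₀ : ContinuousOn c₀ (Icc 0 T))
    (h₁ : ContinuousOn c₁ (Icc 0 T)) {G : ℝ → ℝ → ℝ} (hG : IsC T 1 2 G) (j : Fin 4) :
    MemLp (dualJet T r c₀ c₁ G j) 2 ((timeMeasure T).prod unitMeasure) := by
  fin_cases j
  · exact ((memLp_of_continuousOn_cylinder (hG.continuousOn_timeDeriv le_rfl)).neg.const_mul _).add
      ((memLp_of_continuousOn_cylinder hG.continuousOn).const_mul r)
  · exact memLp_of_continuousOn_cylinder (hG.continuousOn_spaceDeriv one_le_two)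
  · exact (memLp_continuousOn_mul h₁ (hG.memLp_trace (right_mem_Icc.2 zero_le_one))).comp_fst _
  · exact (memLp_continuousOn_mul h₀ (hG.memLp_trace (left_mem_Icc.2 zero_le_one))).comp_fst _

/-- `jet`, as a linear map to a Hilbert space. -/
def jetMap (hT : 0 < T) (r : ℝ) : vanishingSpace T hT →ₗ[ℝ] JetSpace T :=
  familyMap (fun G => jet r G.1) (fun G => memLp_jet r G.2.1)
    (fun G G' j => by
      filter_upwards [ae_prod_mem_cylinder T] with p hp
      have := spaceDeriv_add G.2.1 one_le_two G'.2.1 hp.1 hp.2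
      fin_cases j
      · exact mul_add r _ _
      · exact this
      · rfl
      · rfl)
    (fun c G j => by
      filter_upwards [ae_prod_mem_cylinder T] with p hp
      have := spaceDeriv_smul c G.2.1 one_le_two hp.1 hp.2
      fin_cases j
      · exact mul_left_comm r c _
      · exact this
      · rfl
      · rfl)

/-- `dualJet`, as a linear map to a Hilbert space. -/
def dualJetMap (hT : 0 < T) (r : ℝ) {c₀ c₁ : ℝ → ℝ} (h₀ : ContinuousOn c₀ (Icc 0 T))
    (h₁ : ContinuousOn c₁ (Icc 0 T)) : vanishingSpace T hT →ₗ[ℝ] JetSpace T :=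
  familyMap (fun G => dualJet T r c₀ c₁ G.1) (fun G => memLp_dualJet r h₀ h₁ G.2.1)
    (fun G G' j => by
      filter_upwards [ae_prod_mem_cylinder T] with p hp
      have hs := spaceDeriv_add G.2.1 one_le_two G'.2.1 hp.1 hp.2
      have ht := timeDeriv_add G.2.1 G'.2.1 hT hp.1 hp.2
      fin_cases j
      · change r⁻¹ * -timeDeriv T (G.1 + G'.1) p.1 p.2 + r * (G.1 p.1 p.2 + G'.1 p.1 p.2)
          = (r⁻¹ * -timeDeriv T G.1 p.1 p.2 + r * G.1 p.1 p.2)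
            + (r⁻¹ * -timeDeriv T G'.1 p.1 p.2 + r * G'.1 p.1 p.2)
        rw [ht]; ring
      · exact hs
      · exact mul_add (c₁ p.1) _ _
      · exact mul_add (c₀ p.1) _ _)
    (fun c G j => by
      filter_upwards [ae_prod_mem_cylinder T] with p hp
      have hs := spaceDeriv_smul c G.2.1 one_le_two hp.1 hp.2
      have ht := timeDeriv_smul c G.2.1 hT hp.1 hp.2
      fin_cases j
      · change r⁻¹ * -timeDeriv T (c • G.1) p.1 p.2 + r * (c * G.1 p.1 p.2)
          = c * (r⁻¹ * -timeDeriv T G.1 p.1 p.2 + r * G.1 p.1 p.2)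
        rw [ht]; ring
      · exact hs
      · exact mul_left_comm (c₁ p.1) c _
      · exact mul_left_comm (c₀ p.1) c _)

theorem integral_mul_neg_timeDeriv (hT : 0 ≤ T) {n : ℕ} {G : ℝ → ℝ → ℝ} (hG : IsC T 1 n G)
    (hGT : ∀ x ∈ Icc (0 : ℝ) 1, G T x = 0) :
    ∫ p : ℝ × ℝ, G p.1 p.2 * -timeDeriv T G p.1 p.2 ∂((timeMeasure T).prod unitMeasure)
      = (∫ x, G 0 x ^ 2 ∂unitMeasure) / 2 := by
  have hi := (memLp_of_continuousOn_cylinder hG.continuousOn).integrable_mul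
    (memLp_of_continuousOn_cylinder (hG.continuousOn_timeDeriv le_rfl)).neg
  refine (integral_prod_symm _ hi).trans ?_
  rw [← integral_div]
  refine integral_congr_ae (ae_unitMeasure_mem.mono fun x hx => ?_)
  change ∫ t, G t x * -timeDeriv T G t x ∂timeMeasure T = G 0 x ^ 2 / 2
  have hc := continuousOn_slice_right hG.continuousOn hx
  have hd := continuousOn_slice_right (hG.continuousOn_timeDeriv le_rfl) hx
  rw [integral_timeMeasure hT, intervalIntegral.integral_eq_sub_of_hasDerivAt_of_le hT
    (f := fun t => -(G t x ^ 2 / 2))]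
  · rw [hGT x hx]; ring
  · exact ((hc.pow 2).div_const 2).neg
  · intro t ht
    have := (hG.hasDerivWithinAt_time le_rfl (Ioo_subset_Icc_self ht) hx).hasDerivAt
      (Icc_mem_nhds ht.1 ht.2)
    refine (((this.pow 2).div_const 2).neg).congr_deriv ?_
    norm_num
    ring
  · refine ContinuousOn.intervalIntegrable ?_
    rw [uIcc_of_le hT]
    exact hc.mul hd.neg

theorem norm_sq_jetMap (hT : 0 < T) (r : ℝ) (G : vanishingSpace T hT) :
    ‖jetMap hT r G‖ ^ 2 = ∫ p, ∑ j, jet r G.1 j p ^ 2 ∂((timeMeasure T).prod unitMeasure) :=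
  norm_sq_familyToLp (memLp_jet r G.2.1)

theorem sum_jet_mul_dualJet {r : ℝ} (hr : r ≠ 0) (c₀ c₁ : ℝ → ℝ) (G : ℝ → ℝ → ℝ) (p : ℝ × ℝ) :
    ∑ j, jet r G j p * dualJet T r c₀ c₁ G j p
      = G p.1 p.2 * -timeDeriv T G p.1 p.2 + (jet r G 0 p ^ 2 + jet r G 1 p ^ 2
        + c₁ p.1 * jet r G 2 p ^ 2 + c₀ p.1 * jet r G 3 p ^ 2) := by
  refine (Fin.sum_univ_four _).trans ?_
  change r * G p.1 p.2 * (r⁻¹ * -timeDeriv T G p.1 p.2 + r * G p.1 p.2)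
      + spaceDeriv G p.1 p.2 * spaceDeriv G p.1 p.2 + G p.1 1 * (c₁ p.1 * G p.1 1)
      + G p.1 0 * (c₀ p.1 * G p.1 0)
    = G p.1 p.2 * -timeDeriv T G p.1 p.2 + ((r * G p.1 p.2) ^ 2
      + spaceDeriv G p.1 p.2 ^ 2 + c₁ p.1 * G p.1 1 ^ 2 + c₀ p.1 * G p.1 0 ^ 2)
  field_simp
  ring

theorem coercive_jetMap (hT : 0 < T) {r κ : ℝ} (hr : r ≠ 0) (hκ : κ ≤ 1) {c₀ c₁ : ℝ → ℝ}
    (h₀ : ContinuousOn c₀ (Icc 0 T)) (h₁ : ContinuousOn c₁ (Icc 0 T))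
    (hκ₀ : ∀ t ∈ Icc 0 T, κ ≤ c₀ t) (hκ₁ : ∀ t ∈ Icc 0 T, κ ≤ c₁ t) (G : vanishingSpace T hT) :
    (∫ x, G.1 0 x ^ 2 ∂unitMeasure) / 2 + κ * ‖jetMap hT r G‖ ^ 2
      ≤ inner ℝ (jetMap hT r G) (dualJetMap hT r h₀ h₁ G) := by
  have hG := G.2.1
  have hjet := memLp_jet r hG
  have hdual := memLp_dualJet r h₀ h₁ hG
  have htime := (memLp_of_continuousOn_cylinder hG.continuousOn).integrable_mul
    (memLp_of_continuousOn_cylinder (hG.continuousOn_timeDeriv le_rfl)).neg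
  have hsq : Integrable (fun p => κ * ∑ j, jet r G.1 j p ^ 2) ((timeMeasure T).prod unitMeasure) :=
    (integrable_finsetSum _ fun j _ => (hjet j).integrable_sq).const_mul κ
  have hprod : Integrable (fun p => ∑ j, jet r G.1 j p * dualJet T r c₀ c₁ G.1 j p)
      ((timeMeasure T).prod unitMeasure) :=
    integrable_finsetSum _ fun j _ => (hjet j).integrable_mul (hdual j)
  rw [← integral_mul_neg_timeDeriv hT.le hG G.2.2, norm_sq_jetMap, ← integral_const_mul]
  refine (integral_add htime hsq).symm.trans_le ?_
  refine le_of_le_of_eq ?_ (inner_familyToLp hjet hdual).symm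
  refine integral_mono_ae (htime.add hsq) hprod ?_
  filter_upwards [ae_prod_mem_cylinder T] with p hp
  change G.1 p.1 p.2 * -timeDeriv T G.1 p.1 p.2 + κ * ∑ j, jet r G.1 j p ^ 2
    ≤ ∑ j, jet r G.1 j p * dualJet T r c₀ c₁ G.1 j p
  rw [sum_jet_mul_dualJet hr, Fin.sum_univ_four]
  have hle_zero := mul_le_mul_of_nonneg_right hκ (sq_nonneg (jet r G.1 0 p))
  have hle_one := mul_le_mul_of_nonneg_right hκ (sq_nonneg (jet r G.1 1 p))
  have hle_two := mul_le_mul_of_nonneg_right (hκ₁ p.1 hp.1) (sq_nonneg (jet r G.1 2 p))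
  have hle_three := mul_le_mul_of_nonneg_right (hκ₀ p.1 hp.1) (sq_nonneg (jet r G.1 3 p))
  linarith

end Jets

section Closure

variable {T r : ℝ} {e : JetSpace T}

/-- `e` is the jet, scaled by `r`, of a function with a square integrable generalized space
derivative, which is thus determined by its derivative and its trace at `x = 0`. -/
structure IsJet (r : ℝ) (e : JetSpace T) : Prop where
  eq_primitive : ∀ᵐ p ∂((timeMeasure T).prod unitMeasure),
    e 0 p = r * (e 3 p + primitive (fun y => e 1 (p.1, y)) p.2)
  trace_one : ∀ᵐ p ∂((timeMeasure T).prod unitMeasure),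
    e 2 p = e 3 p + ∫ y, e 1 (p.1, y) ∂unitMeasure
  trace_zero : ∀ᵐ p ∂((timeMeasure T).prod unitMeasure), e 3 p = ∫ y, e 3 (p.1, y) ∂unitMeasure

theorem isJet_iff_of_ae_eq
    {P J : Lp ℝ 2 ((timeMeasure T).prod unitMeasure) →L[ℝ]
      Lp ℝ 2 ((timeMeasure T).prod unitMeasure)}
    (hP : ∀ f, P f =ᵐ[(timeMeasure T).prod unitMeasure]
      fun p => primitive (fun y => f (p.1, y)) p.2)
    (hJ : ∀ f, J f =ᵐ[(timeMeasure T).prod unitMeasure] fun p => ∫ y, f (p.1, y) ∂unitMeasure) :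
    IsJet r e ↔ e 0 = r • (e 3 + P (e 1)) ∧ e 2 = e 3 + J (e 1) ∧ e 3 = J (e 3) := by
  have hprim : r • (e 3 + P (e 1)) =ᵐ[(timeMeasure T).prod unitMeasure]
      fun p => r * (e 3 p + primitive (fun y => e 1 (p.1, y)) p.2) := by
    filter_upwards [hP (e 1), Lp.coeFn_smul r (e 3 + P (e 1)), Lp.coeFn_add (e 3) (P (e 1))]
      with p hPp hsmul hadd
    rw [hsmul, Pi.smul_apply, hadd, Pi.add_apply, hPp, smul_eq_mul]
  have hone : e 3 + J (e 1) =ᵐ[(timeMeasure T).prod unitMeasure]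
      fun p => e 3 p + ∫ y, e 1 (p.1, y) ∂unitMeasure := by
    filter_upwards [hJ (e 1), Lp.coeFn_add (e 3) (J (e 1))] with p hJp hadd
    rw [hadd, Pi.add_apply, hJp]
  constructor
  · rintro ⟨h0, h1, h3⟩
    exact ⟨Lp.ext (EventuallyEq.trans h0 hprim.symm), Lp.ext (EventuallyEq.trans h1 hone.symm),
      Lp.ext (EventuallyEq.trans h3 (hJ (e 3)).symm)⟩
  · rintro ⟨h0, h1, h3⟩
    exact ⟨(Lp.ext_iff.1 h0).trans hprim, (Lp.ext_iff.1 h1).trans hone,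
      (Lp.ext_iff.1 h3).trans (hJ (e 3))⟩

theorem isClosed_setOf_isJet (r : ℝ) : IsClosed {e : JetSpace T | IsJet r e} := by
  obtain ⟨P, hP⟩ := exists_primitive_continuousLinearMap T
  obtain ⟨J, hJ⟩ := exists_spaceIntegral_continuousLinearMap T
  simp_rw [isJet_iff_of_ae_eq hP hJ]
  exact (isClosed_eq (by fun_prop) (by fun_prop)).inter
    ((isClosed_eq (by fun_prop) (by fun_prop)).inter (isClosed_eq (by fun_prop) (by fun_prop)))

theorem isJet_jetMap (hT : 0 < T) (r : ℝ) (G : vanishingSpace T hT) : IsJet r (jetMap hT r G) := by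
  have hjet : ∀ j, jetMap hT r G j =ᵐ[(timeMeasure T).prod unitMeasure] jet r G.1 j :=
    coeFn_familyToLp _ (memLp_jet r G.2.1)
  have hrep : ∀ p ∈ cylinder T, ∀ x ∈ Icc (0 : ℝ) 1,
      G.1 p.1 x = G.1 p.1 0 + primitive (spaceDeriv G.1 p.1) x :=
    fun p hp => G.2.1.eq_primitive one_le_two hp.1
  refine ⟨?_, ?_, ?_⟩
  · filter_upwards [hjet 0, hjet 3, ae_slice_eq (hjet 1), ae_prod_mem_cylinder T]
      with p h0 h3 h1 hp
    rw [h0, h3, primitive_congr h1]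
    exact congrArg (r * ·) (hrep p hp p.2 hp.2)
  · filter_upwards [hjet 2, hjet 3, ae_slice_eq (hjet 1), ae_prod_mem_cylinder T]
      with p h2 h3 h1 hp
    rw [h2, h3, integral_congr_ae h1, ← primitive_one]
    exact hrep p hp 1 (right_mem_Icc.2 zero_le_one)
  · filter_upwards [hjet 3, ae_slice_eq (hjet 3)] with p h3 h3'
    rw [integral_congr_ae h3', h3]
    change G.1 p.1 0 = ∫ _, G.1 p.1 0 ∂unitMeasure
    simp

theorem isJet_of_mem_topologicalClosure (hT : 0 < T)
    (he : e ∈ (LinearMap.range (jetMap hT r)).topologicalClosure) : IsJet r e := by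
  have hrange : (LinearMap.range (jetMap hT r) : Set (JetSpace T)) ⊆ {e | IsJet r e} := by
    rintro _ ⟨G, rfl⟩
    exact isJet_jetMap hT r G
  exact closure_minimal hrange (isClosed_setOf_isJet r) he

theorem IsJet.exists_eq_jet (he : IsJet r e) : ∃ v g : ℝ → ℝ → ℝ,
    MemLp (fun p : ℝ × ℝ => v p.1 p.2) 2 ((timeMeasure T).prod unitMeasure) ∧
    (∀ t x, v t x = v t 0 + primitive (g t) x) ∧ (∀ p, e 1 p = g p.1 p.2) ∧
    ∀ᵐ p ∂((timeMeasure T).prod unitMeasure),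
      e 0 p = r * v p.1 p.2 ∧ e 2 p = v p.1 1 ∧ e 3 p = v p.1 0 := by
  let g : ℝ → ℝ → ℝ := fun t y => e 1 (t, y)
  let v : ℝ → ℝ → ℝ := fun t x => (∫ y, e 3 (t, y) ∂unitMeasure) + primitive (g t) x
  have hv0 : ∀ t, v t 0 = ∫ y, e 3 (t, y) ∂unitMeasure := fun t => by
    simp only [v, primitive_zero, add_zero]
  have hv1 : ∀ t, v t 1 = (∫ y, e 3 (t, y) ∂unitMeasure) + ∫ y, e 1 (t, y) ∂unitMeasure :=
    fun t => by simp only [v, primitive_one, g]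
  refine ⟨v, g, ?_, fun t x => by rw [hv0], fun _ => rfl, ?_⟩
  · exact ((memLp_integral_of_memLp (F := fun t y => e 3 (t, y)) (Lp.memLp (e 3))).comp_fst
      unitMeasure).add (memLp_primitive (F := g) (Lp.memLp (e 1)))
  · filter_upwards [he.eq_primitive, he.trace_one, he.trace_zero] with p h0 h2 h3
    exact ⟨by rw [h0, h3], by rw [hv1, h2, ← h3], by rw [hv0, ← h3]⟩

end Closure

section SemilinearProblem

variable {T r κ : ℝ} {q : ℝ≥0} {b : ℝ × ℝ → ℝ → ℝ} {c₀ c₁ F₀ F₁ γ : ℝ → ℝ}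

/-- The right-hand side of the semilinear problem: the nonlinearity `b` enters the flux, and `F₀`,
`F₁` are the sources at the boundary. -/
def sourceJet (b : ℝ × ℝ → ℝ → ℝ) (F₀ F₁ : ℝ → ℝ) (f : ℝ × ℝ → ℝ) : Fin 4 → ℝ × ℝ → ℝ :=
  ![fun _ => 0, fun p => b p (f p), fun p => F₁ p.1, fun p => F₀ p.1]

theorem memLp_sourceJet {f : ℝ × ℝ → ℝ}
    (hb : MemLp (fun p => b p (f p)) 2 ((timeMeasure T).prod unitMeasure))
    (hF₀ : MemLp F₀ 2 (timeMeasure T)) (hF₁ : MemLp F₁ 2 (timeMeasure T)) (j : Fin 4) :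
    MemLp (sourceJet b F₀ F₁ f j) 2 ((timeMeasure T).prod unitMeasure) := by
  fin_cases j
  · exact MemLp.zero
  · exact hb
  · exact hF₁.comp_fst unitMeasure
  · exact hF₀.comp_fst unitMeasure

theorem lipschitzWith_sourceJet
    (hmem : ∀ (e : JetSpace T) j,
      MemLp (sourceJet b F₀ F₁ (e 0) j) 2 ((timeMeasure T).prod unitMeasure))
    (hb : ∀ᵐ p ∂((timeMeasure T).prod unitMeasure), LipschitzWith q (b p)) :
    LipschitzWith q fun e : JetSpace T => familyToLp (sourceJet b F₀ F₁ (e 0)) (hmem e) := by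
  refine LipschitzWith.of_dist_le_mul fun e e' => ?_
  rw [dist_eq_norm, dist_eq_norm]
  set n : JetSpace T → JetSpace T := fun e => familyToLp (sourceJet b F₀ F₁ (e 0)) (hmem e)
  have hzero : n e 0 = n e' 0 := rfl
  have htwo : n e 2 = n e' 2 := rfl
  have hthree : n e 3 = n e' 3 := rfl
  have hnorm : ‖n e - n e'‖ = ‖n e 1 - n e' 1‖ := by
    rw [PiLp.norm_eq_of_L2, Fin.sum_univ_four]
    simp only [PiLp.sub_apply, hzero, htwo, hthree, sub_self, norm_zero]
    simp
  have hone : ‖n e 1 - n e' 1‖ ≤ q * ‖e 0 - e' 0‖ := by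
    refine Lp.norm_le_mul_norm_of_ae_le_mul ?_
    filter_upwards [Lp.coeFn_sub (n e 1) (n e' 1), Lp.coeFn_sub (e 0) (e' 0),
      coeFn_familyToLp _ (hmem e) 1, coeFn_familyToLp _ (hmem e') 1, hb] with p hn he hp hp' hbp
    rw [hn, he, Pi.sub_apply, Pi.sub_apply, hp, hp', ← dist_eq_norm, ← dist_eq_norm]
    exact hbp.dist_le_mul _ _
  calc ‖n e - n e'‖ = ‖n e 1 - n e' 1‖ := hnorm
    _ ≤ q * ‖e 0 - e' 0‖ := hone
    _ ≤ q * ‖e - e'‖ := mul_le_mul_of_nonneg_left (PiLp.norm_apply_le (e - e') 0) q.2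

/-- The functional `G ↦ ∫ γ G₀` through which the initial condition `γ` enters the problem. -/
def initialFunctional (hT : 0 < T) (hγ : MemLp γ 2 unitMeasure) : vanishingSpace T hT →ₗ[ℝ] ℝ :=
  (innerSL ℝ (hγ.toLp γ)).toLinearMap ∘ₗ sliceMap hT (left_mem_Icc.2 hT.le) ∘ₗ
    Submodule.inclusion fun _ h => h.1

theorem initialFunctional_apply (hT : 0 < T) (hγ : MemLp γ 2 unitMeasure)
    (G : vanishingSpace T hT) : initialFunctional hT hγ G = ∫ x, γ x * G.1 0 x ∂unitMeasure :=
  inner_toLp_eq hγ (G.2.1.memLp_slice (left_mem_Icc.2 hT.le))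

theorem initialFunctional_sq_le (hT : 0 < T) (hγ : MemLp γ 2 unitMeasure)
    (G : vanishingSpace T hT) : initialFunctional hT hγ G ^ 2
      ≤ (∫ x, γ x ^ 2 ∂unitMeasure) * ∫ x, G.1 0 x ^ 2 ∂unitMeasure := by
  have hG := G.2.1.memLp_slice (left_mem_Icc.2 hT.le)
  rw [← norm_sq_toLp_eq hγ, ← norm_sq_toLp_eq hG, ← mul_pow, ← sq_abs]
  exact pow_le_pow_left₀ (abs_nonneg _) (abs_real_inner_le_norm (hγ.toLp γ) (hG.toLp (G.1 0))) 2

theorem exists_isJet_inner_eq (hT : 0 < T) (hr : r ≠ 0) (hκ : κ ≤ 1) (hqκ : q < κ)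
    (h₀ : ContinuousOn c₀ (Icc 0 T)) (h₁ : ContinuousOn c₁ (Icc 0 T))
    (hκ₀ : ∀ t ∈ Icc 0 T, κ ≤ c₀ t) (hκ₁ : ∀ t ∈ Icc 0 T, κ ≤ c₁ t)
    (hγ : MemLp γ 2 unitMeasure) {N : JetSpace T → JetSpace T} (hN : LipschitzWith q N) :
    ∃ e : JetSpace T, IsJet r e ∧ ∀ G, inner ℝ e (dualJetMap hT r h₀ h₁ G)
      = initialFunctional hT hγ G + inner ℝ (N e) (jetMap hT r G) := by
  have hcoercive := coercive_jetMap hT hr hκ h₀ h₁ hκ₀ hκ₁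
  have hsq_nonneg : ∀ f : ℝ → ℝ, 0 ≤ ∫ x, f x ^ 2 ∂unitMeasure := fun f =>
    integral_nonneg fun x => sq_nonneg _
  obtain ⟨e, he, heq⟩ := exists_mem_closure_inner_eq_of_coercive (i := jetMap hT r)
    (k := dualJetMap hT r h₀ h₁) (l := initialFunctional hT hγ)
    (mul_nonneg zero_le_two (hsq_nonneg γ)) hqκ
    (fun G => by linarith [hcoercive G, hsq_nonneg (G.1 0)])
    (fun G => by
      have hinit : ∫ x, G.1 0 x ^ 2 ∂unitMeasure
          ≤ 2 * inner ℝ (jetMap hT r G) (dualJetMap hT r h₀ h₁ G) := by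
        linarith [hcoercive G, mul_nonneg (q.2.trans hqκ.le) (sq_nonneg ‖jetMap hT r G‖)]
      calc _ ≤ _ := initialFunctional_sq_le hT hγ G
        _ ≤ _ := mul_le_mul_of_nonneg_left hinit (hsq_nonneg γ)
        _ = _ := by ring) hN
  exact ⟨e, isJet_of_mem_topologicalClosure hT he, heq⟩

theorem inner_sub_inner_eq_integral (hT : 0 < T) (h₀ : ContinuousOn c₀ (Icc 0 T))
    (h₁ : ContinuousOn c₁ (Icc 0 T)) (e : JetSpace T) {f : Fin 4 → ℝ × ℝ → ℝ}
    (hf : ∀ j, MemLp (f j) 2 ((timeMeasure T).prod unitMeasure)) (G : vanishingSpace T hT) :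
    inner ℝ e (dualJetMap hT r h₀ h₁ G) - inner ℝ (familyToLp f hf) (jetMap hT r G)
      = ∫ p, (∑ j, e j p * dualJet T r c₀ c₁ G.1 j p - ∑ j, f j p * jet r G.1 j p)
        ∂((timeMeasure T).prod unitMeasure) := by
  have hdual := memLp_dualJet r h₀ h₁ G.2.1
  have hjet := memLp_jet r G.2.1
  have he : ∀ j, MemLp (e j) 2 ((timeMeasure T).prod unitMeasure) := fun j => Lp.memLp (e j)
  have hintegrable_dual : Integrable (fun p => ∑ j, e j p * dualJet T r c₀ c₁ G.1 j p)
      ((timeMeasure T).prod unitMeasure) :=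
    integrable_finsetSum _ fun j _ => (he j).integrable_mul (hdual j)
  have hintegrable_jet : Integrable (fun p => ∑ j, f j p * jet r G.1 j p)
      ((timeMeasure T).prod unitMeasure) :=
    integrable_finsetSum _ fun j _ => (hf j).integrable_mul (hjet j)
  rw [integral_sub hintegrable_dual hintegrable_jet, ← inner_familyToLp he hdual,
    ← inner_familyToLp hf hjet, familyToLp_coeFn e]
  rfl

theorem exists_weakSolution_of_lipschitz (hT : 0 < T) (hr : r ≠ 0) (hκ : κ ≤ 1) (hqκ : q < κ)
    (h₀ : ContinuousOn c₀ (Icc 0 T)) (h₁ : ContinuousOn c₁ (Icc 0 T))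
    (hκ₀ : ∀ t ∈ Icc 0 T, κ ≤ c₀ t) (hκ₁ : ∀ t ∈ Icc 0 T, κ ≤ c₁ t)
    (hb : ∀ f : ℝ × ℝ → ℝ, MemLp f 2 ((timeMeasure T).prod unitMeasure) →
      MemLp (fun p => b p (f p)) 2 ((timeMeasure T).prod unitMeasure))
    (hbq : ∀ᵐ p ∂((timeMeasure T).prod unitMeasure), LipschitzWith q (b p))
    (hF₀ : MemLp F₀ 2 (timeMeasure T)) (hF₁ : MemLp F₁ 2 (timeMeasure T))
    (hγ : MemLp γ 2 unitMeasure) :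
    ∃ v g : ℝ → ℝ → ℝ,
      MemLp (fun p : ℝ × ℝ => v p.1 p.2) 2 ((timeMeasure T).prod unitMeasure) ∧
      MemLp (fun p : ℝ × ℝ => g p.1 p.2) 2 ((timeMeasure T).prod unitMeasure) ∧
      (∀ t x, v t x = v t 0 + primitive (g t) x) ∧
      ∀ G, IsC T 1 2 G → (∀ x ∈ Icc (0 : ℝ) 1, G T x = 0) →
        ∫ p : ℝ × ℝ, (v p.1 p.2 * (-timeDeriv T G p.1 p.2 + r ^ 2 * G p.1 p.2)
            + (g p.1 p.2 - b p (r * v p.1 p.2)) * spaceDeriv G p.1 p.2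
            + (c₁ p.1 * v p.1 1 - F₁ p.1) * G p.1 1 + (c₀ p.1 * v p.1 0 - F₀ p.1) * G p.1 0)
            ∂((timeMeasure T).prod unitMeasure) = ∫ x, γ x * G 0 x ∂unitMeasure := by
  have hsource : ∀ (e : JetSpace T) j, MemLp (sourceJet b F₀ F₁ (e 0) j) 2
      ((timeMeasure T).prod unitMeasure) := fun e =>
    memLp_sourceJet (hb _ (Lp.memLp (e 0))) hF₀ hF₁
  obtain ⟨e, hjet, heq⟩ := exists_isJet_inner_eq hT hr hκ hqκ h₀ h₁ hκ₀ hκ₁ hγ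
    (lipschitzWith_sourceJet hsource hbq)
  obtain ⟨v, g, hv, hrep, hg, hev⟩ := hjet.exists_eq_jet
  refine ⟨v, g, hv, by simp_rw [← hg]; exact Lp.memLp (e 1), hrep, fun G hG hGT => ?_⟩
  refine Eq.trans ?_ (initialFunctional_apply hT hγ ⟨G, hG, hGT⟩)
  refine Eq.trans ?_ (sub_eq_iff_eq_add.2 (heq ⟨G, hG, hGT⟩))
  rw [inner_sub_inner_eq_integral]
  refine integral_congr_ae ?_
  filter_upwards [hev] with p ⟨h0, h2, h3⟩
  rw [Fin.sum_univ_four, Fin.sum_univ_four]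
  change _ = e 0 p * (r⁻¹ * -timeDeriv T G p.1 p.2 + r * G p.1 p.2)
      + e 1 p * spaceDeriv G p.1 p.2 + e 2 p * (c₁ p.1 * G p.1 1) + e 3 p * (c₀ p.1 * G p.1 0)
    - (0 * (r * G p.1 p.2) + b p (e 0 p) * spaceDeriv G p.1 p.2 + F₁ p.1 * G p.1 1
      + F₀ p.1 * G p.1 0)
  rw [h0, hg, h2, h3]
  field_simp
  ring

end SemilinearProblem

section Existence

variable {α β A B T r : ℝ} {H u f v g : ℝ → ℝ → ℝ} {γ q₀ q₁ : ℝ → ℝ}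

theorem integral_weakRate (hT : 0 ≤ T)
    (hu : MemLp (fun p : ℝ × ℝ => u p.1 p.2) 2 ((timeMeasure T).prod unitMeasure))
    (hf : MemLp (fun p : ℝ × ℝ => f p.1 p.2) 2 ((timeMeasure T).prod unitMeasure))
    (hq₀ : MemLp q₀ 2 (timeMeasure T)) (hq₁ : MemLp q₁ 2 (timeMeasure T))
    {G : ℝ → ℝ → ℝ} (hG : IsC T 1 2 G) :
    ∫ s in (0 : ℝ)..T, weakRate T u f q₀ q₁ G s
      = ∫ p : ℝ × ℝ, (u p.1 p.2 * timeDeriv T G p.1 p.2 - f p.1 p.2 * spaceDeriv G p.1 p.2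
        + (q₁ p.1 * G p.1 1 + q₀ p.1 * G p.1 0)) ∂((timeMeasure T).prod unitMeasure) := by
  have htime := integrable_mul_timeDeriv hu hG le_rfl
  have hspace := integrable_mul_spaceDeriv hf hG one_le_two
  have hboundary : Integrable (fun p : ℝ × ℝ => q₁ p.1 * G p.1 1 + q₀ p.1 * G p.1 0)
      ((timeMeasure T).prod unitMeasure) := (integrable_boundary hq₀ hq₁ hG).comp_fst unitMeasure
  rw [← integral_timeMeasure hT]
  refine Eq.trans ?_ (integral_prod _ ((htime.sub hspace).add hboundary)).symm
  refine integral_congr_ae ?_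
  filter_upwards [htime.prod_right_ae, hspace.prod_right_ae] with s hs_time hs_space
  refine Eq.trans ?_ (integral_add (hs_time.sub hs_space)
    (integrable_const (q₁ s * G s 1 + q₀ s * G s 0))).symm
  refine Eq.trans ?_ (congrArg (· + _) (integral_sub hs_time hs_space).symm)
  simp [weakRate]

theorem boundaryRate_pos {ϱ D : ℝ} (hϱ : ϱ ∈ Icc (0 : ℝ) 1) (hD : 0 < D) (M : ℝ) :
    0 < boundaryRate ϱ D M := by
  refine mul_pos (inv_pos.2 hD) ?_
  rcases hϱ.1.eq_or_lt with rfl | hϱ0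
  · simpa using Real.exp_pos (-M)
  · exact add_pos_of_pos_of_nonneg (mul_pos hϱ0 (Real.exp_pos M))
      (mul_nonneg (sub_nonneg.2 hϱ.2) (Real.exp_pos (-M)).le)

theorem exists_pos_le_boundaryRate {ϱ D : ℝ} (hϱ : ϱ ∈ Icc (0 : ℝ) 1) (hD : 0 < D) {M : ℝ → ℝ}
    (hM : ContinuousOn M (Icc 0 T)) :
    ∃ κ, 0 < κ ∧ ∀ t ∈ Icc 0 T, κ ≤ boundaryRate ϱ D (M t) :=
  isCompact_Icc.exists_forall_le' (continuousOn_boundaryRate hM)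
    fun t _ => boundaryRate_pos hϱ hD (M t)

theorem memLp_continuous_time_mul {k : ℝ → ℝ} (hk : Continuous k) {F : ℝ × ℝ → ℝ}
    (hF : MemLp F 2 ((timeMeasure T).prod unitMeasure)) :
    MemLp (fun p : ℝ × ℝ => k p.1 * F p) 2 ((timeMeasure T).prod unitMeasure) := by
  obtain ⟨C, hC⟩ := isCompact_Icc.exists_bound_of_continuousOn (hk.continuousOn (s := Icc 0 T))
  refine hF.of_le_mul (c := C)
    (AEStronglyMeasurable.mul (hk.comp continuous_fst).aestronglyMeasurable hF.1) ?_
  filter_upwards [ae_prod_mem_cylinder T] with p hp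
  rw [norm_mul]
  exact mul_le_mul_of_nonneg_right (hC p.1 hp.1) (norm_nonneg _)

theorem primitive_const_mul (c : ℝ) (g : ℝ → ℝ) (x : ℝ) :
    primitive (fun y => c * g y) x = c * primitive g x := by
  simp only [primitive, mul_left_comm _ c]
  exact integral_const_mul c _

/-- The drift `2 σ(u) ∇H`, with truncated mobility, after the substitution `u = e^{r² t} v`, divided
by `e^{r² t}` and written as a function of `x = r v`. -/
def rescaledDrift (H : ℝ → ℝ → ℝ) (r : ℝ) (p : ℝ × ℝ) (x : ℝ) : ℝ :=
  (Real.exp (r ^ 2 * p.1))⁻¹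
    * (2 * truncMobility (Real.exp (r ^ 2 * p.1) * x / r) * spaceDeriv H p.1 p.2)

theorem memLp_rescaledDrift (hH : IsC T 0 1 H) (r : ℝ) {φ : ℝ × ℝ → ℝ}
    (hφ : MemLp φ 2 ((timeMeasure T).prod unitMeasure)) :
    MemLp (fun p => rescaledDrift H r p (φ p)) 2 ((timeMeasure T).prod unitMeasure) := by
  have hdensity : MemLp (fun p : ℝ × ℝ => Real.exp (r ^ 2 * p.1) * r⁻¹ * φ p) 2
      ((timeMeasure T).prod unitMeasure) :=
    memLp_continuous_time_mul (k := fun t => Real.exp (r ^ 2 * t) * r⁻¹) (by fun_prop) hφ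
  have hflux := memLp_truncFlux (u := fun t x => Real.exp (r ^ 2 * t) * r⁻¹ * φ (t, x)) (g := 0)
    hH hdensity MemLp.zero
  have hdrift : ∀ p : ℝ × ℝ, -Real.exp (-(r ^ 2 * p.1)) * truncFlux H
      (fun t x => Real.exp (r ^ 2 * t) * r⁻¹ * φ (t, x)) 0 p.1 p.2
      = rescaledDrift H r p (φ p) := fun p => by
    have harg : Real.exp (r ^ 2 * p.1) * φ p / r = Real.exp (r ^ 2 * p.1) * r⁻¹ * φ p := by ring
    simp only [truncFlux, rescaledDrift, Real.exp_neg, Pi.zero_apply, harg]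
    ring
  simp_rw [← hdrift]
  exact memLp_continuous_time_mul (k := fun t => -Real.exp (-(r ^ 2 * t))) (by fun_prop) hflux

theorem lipschitzWith_rescaledDrift {p : ℝ × ℝ} {C : ℝ} (hr : 0 < r)
    (hC : |spaceDeriv H p.1 p.2| ≤ C) :
    LipschitzWith (2 * C / r).toNNReal (rescaledDrift H r p) := by
  refine LipschitzWith.of_dist_le_mul fun x y => ?_
  rw [Real.coe_toNNReal _ (by have := (abs_nonneg _).trans hC; positivity), Real.dist_eq,
    Real.dist_eq]
  set E := Real.exp (r ^ 2 * p.1)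
  have hE : 0 < E := Real.exp_pos _
  calc |rescaledDrift H r p x - rescaledDrift H r p y|
      = E⁻¹ * (2 * |truncMobility (E * x / r) - truncMobility (E * y / r)|
          * |spaceDeriv H p.1 p.2|) := by
        rw [rescaledDrift, rescaledDrift, ← mul_sub, ← sub_mul, ← mul_sub, abs_mul, abs_mul,
          abs_mul, abs_two, abs_of_pos (inv_pos.2 hE)]
    _ ≤ E⁻¹ * (2 * |E * x / r - E * y / r| * C) := by
        have := abs_truncMobility_sub_le (E * x / r) (E * y / r)
        gcongr
    _ = E⁻¹ * (2 * (E / r * |x - y|) * C) := by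
        rw [← sub_div, ← mul_sub, mul_div_right_comm, abs_mul, abs_of_pos (div_pos hE hr)]
    _ = 2 * C / r * |x - y| := by field_simp

theorem isTruncatedSolution_exp_mul (hT : 0 < T) (hr : r ≠ 0) (hH : IsC T 0 1 H)
    (hv : MemLp (fun p : ℝ × ℝ => v p.1 p.2) 2 ((timeMeasure T).prod unitMeasure))
    (hg : MemLp (fun p : ℝ × ℝ => g p.1 p.2) 2 ((timeMeasure T).prod unitMeasure))
    (hvg : ∀ t x, v t x = v t 0 + primitive (g t) x)
    (hweak : ∀ G, IsC T 1 2 G → (∀ x ∈ Icc (0 : ℝ) 1, G T x = 0) →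
      ∫ p : ℝ × ℝ, (v p.1 p.2 * (-timeDeriv T G p.1 p.2 + r ^ 2 * G p.1 p.2)
          + (g p.1 p.2 - rescaledDrift H r p (r * v p.1 p.2)) * spaceDeriv G p.1 p.2
          + (boundaryRate β B (H p.1 1) * v p.1 1
              - (Real.exp (r ^ 2 * p.1))⁻¹ * (B⁻¹ * β * Real.exp (H p.1 1))) * G p.1 1
          + (boundaryRate α A (H p.1 0) * v p.1 0
              - (Real.exp (r ^ 2 * p.1))⁻¹ * (A⁻¹ * α * Real.exp (H p.1 0))) * G p.1 0)
          ∂((timeMeasure T).prod unitMeasure) = ∫ x, γ x * G 0 x ∂unitMeasure) :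
    IsTruncatedSolution α β A B T H γ (fun t x => Real.exp (r ^ 2 * t) * v t x)
      (fun t x => Real.exp (r ^ 2 * t) * g t x) := by
  set E : ℝ → ℝ := fun t => Real.exp (r ^ 2 * t)
  have hE_ne : ∀ t, E t ≠ 0 := fun t => (Real.exp_pos _).ne'
  have hE_smooth : ContDiff ℝ ∞ E := by fun_prop
  have hE_deriv : ∀ t, deriv E t = r ^ 2 * E t := fun t => by
    have h : HasDerivAt E (E t * (r ^ 2 * 1)) t := ((hasDerivAt_id t).const_mul (r ^ 2)).exp
    rw [h.deriv, mul_one, mul_comm]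
  have hEv := memLp_continuous_time_mul hE_smooth.continuous hv
  have hEg := memLp_continuous_time_mul hE_smooth.continuous hg
  have hrep : ∀ᵐ t ∂timeMeasure T, ∀ x ∈ Icc (0 : ℝ) 1,
      E t * v t x = E t * v t 0 + primitive (fun y => E t * g t y) x :=
    Eventually.of_forall fun t x _ => by rw [primitive_const_mul, hvg t x, mul_add]
  have hH0 := continuousOn_slice_right hH.continuousOn (left_mem_Icc.2 zero_le_one)
  have hH1 := continuousOn_slice_right hH.continuousOn (right_mem_Icc.2 zero_le_one)
  refine ⟨hEv, hEg, hrep, fun G hG hGT => ?_⟩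
  have hEG := hweak _ (hG.mul_time hT hE_smooth) fun x hx => by rw [hGT x hx, mul_zero]
  have hinitial : ∫ x, γ x * (E 0 * G 0 x) ∂unitMeasure = ∫ x, γ x * G 0 x ∂unitMeasure := by
    simp [E]
  rw [truncRate, integral_weakRate hT.le hEv (memLp_truncFlux hH hEv hEg)
    (memLp_boundaryFlux (memLp_trace_zero hEv hEg hrep) hH0)
    (memLp_boundaryFlux (memLp_trace_one hEv hEg hrep) hH1) hG, ← hinitial, ← hEG, ← integral_neg]
  refine integral_congr_ae ?_
  filter_upwards [ae_prod_mem_cylinder T] with p hp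
  rw [timeDeriv_mul_time hG hE_smooth hT hp.1 hp.2, spaceDeriv_mul_time hG one_le_two E hp.1 hp.2,
    hE_deriv]
  have hEp := hE_ne p.1
  have harg : E p.1 * (r * v p.1 p.2) / r = E p.1 * v p.1 p.2 := by field_simp
  have hdrift : rescaledDrift H r p (r * v p.1 p.2)
      = (E p.1)⁻¹ * (2 * truncMobility (E p.1 * v p.1 p.2) * spaceDeriv H p.1 p.2) := by
    rw [← harg]; rfl
  simp only [hdrift, boundaryFlux_eq, truncFlux]
  field_simp
  ring

theorem exists_isTruncatedSolution (hα : α ∈ Icc (0 : ℝ) 1) (hβ : β ∈ Icc (0 : ℝ) 1)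
    (hA : 0 < A) (hB : 0 < B) (hT : 0 < T) (hH : IsC T 0 1 H) (hγ : MemLp γ 2 unitMeasure) :
    ∃ u g, IsTruncatedSolution α β A B T H γ u g := by
  have hH0 := continuousOn_slice_right hH.continuousOn (left_mem_Icc.2 zero_le_one)
  have hH1 := continuousOn_slice_right hH.continuousOn (right_mem_Icc.2 zero_le_one)
  obtain ⟨κ₀, hκ₀, hc₀⟩ := exists_pos_le_boundaryRate hα hA hH0
  obtain ⟨κ₁, hκ₁, hc₁⟩ := exists_pos_le_boundaryRate hβ hB hH1
  obtain ⟨C, hC0, hC⟩ := exists_bound_of_continuousOn_cylinder (hH.continuousOn_spaceDeriv le_rfl)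
  set κ := min 1 (min κ₀ κ₁)
  have hκ : 0 < κ := lt_min one_pos (lt_min hκ₀ hκ₁)
  have hκκ₀ : κ ≤ κ₀ := (min_le_right _ _).trans (min_le_left _ _)
  have hκκ₁ : κ ≤ κ₁ := (min_le_right _ _).trans (min_le_right _ _)
  -- The Lipschitz constant `2 C / r` of the rescaled drift has to beat the coercivity `κ`.
  set r := 2 * C / κ + 1
  have hr : 0 < r := by positivity
  have hCr : 2 * C / r < κ := by
    rw [div_lt_iff₀ hr, mul_add, mul_one, mul_div_cancel₀ _ hκ.ne']
    linarith
  have hexp : Continuous fun t => (Real.exp (r ^ 2 * t))⁻¹ :=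
    Continuous.inv₀ (by fun_prop) fun t => (Real.exp_pos _).ne'
  obtain ⟨v, g, hv, hg, hvg, hweak⟩ := exists_weakSolution_of_lipschitz hT hr.ne'
    (min_le_left _ _) (by rwa [Real.coe_toNNReal _ (by positivity)])
    (continuousOn_boundaryRate hH0) (continuousOn_boundaryRate hH1)
    (fun t ht => hκκ₀.trans (hc₀ t ht)) (fun t ht => hκκ₁.trans (hc₁ t ht))
    (fun _ => memLp_rescaledDrift hH r)
    ((ae_prod_mem_cylinder T).mono fun p hp => lipschitzWith_rescaledDrift hr (hC p hp))
    (F₀ := fun t => (Real.exp (r ^ 2 * t))⁻¹ * (A⁻¹ * α * Real.exp (H t 0)))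
    (F₁ := fun t => (Real.exp (r ^ 2 * t))⁻¹ * (B⁻¹ * β * Real.exp (H t 1)))
    (memLp_restrict_of_continuousOn isCompact_Icc (hexp.continuousOn.mul (by fun_prop)))
    (memLp_restrict_of_continuousOn isCompact_Icc (hexp.continuousOn.mul (by fun_prop))) hγ
  exact ⟨_, _, isTruncatedSolution_exp_mul hT hr.ne' hH hv hg hvg hweak⟩

end Existence

end RobinWASEP

end

theorem theoremB5_general (α β A B T : ℝ) (hα : α ∈ Icc (0 : ℝ) 1) (hβ : β ∈ Icc (0 : ℝ) 1)
    (hA : 0 < A) (hB : 0 < B) (hT : 0 < T)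
    (γ : ℝ → ℝ) (hγm : AEMeasurable γ (volume.restrict (Icc 0 1)))
    (hγ : ∀ x ∈ Icc (0 : ℝ) 1, γ x ∈ Icc (0 : ℝ) 1)
    (H : ℝ → ℝ → ℝ) (hH : RobinWASEP.IsC T 0 1 H) :
    (∃ u : ℝ → ℝ → ℝ, RobinWASEP.IsWeakSolution α β A B T H γ u) ∧
    (∀ u v : ℝ → ℝ → ℝ,
      RobinWASEP.IsWeakSolution α β A B T H γ u →
      RobinWASEP.IsWeakSolution α β A B T H γ v →
      ∀ t ∈ Ioc 0 T, ∀ᵐ x ∂(volume.restrict (Icc (0 : ℝ) 1)), u t x = v t x) := by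
  have hγ2 := RobinWASEP.memLp_of_forall_mem_Icc hγm hγ
  obtain ⟨u, g, hu⟩ := RobinWASEP.exists_isTruncatedSolution hα hβ hA hB hT hH hγ2
  exact ⟨hu.exists_isWeakSolution hH hα hβ hA.le hB.le hT hγ hγ2,
    fun _ _ hv hw => hv.ae_eq_at hα hβ hA.le hB.le hT hH hγ2 hw⟩

theorem theoremB5 (α β A B T : ℝ) (hα : 0 < α) (hαβ : α ≤ β) (hβ : β < 1)
    (hA : 0 < A) (hB : 0 < B) (hT : 0 < T)
    (γ : ℝ → ℝ) (hγm : AEMeasurable γ (volume.restrict (Icc 0 1)))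
    (hγ : ∀ x ∈ Icc (0 : ℝ) 1, γ x ∈ Icc (0 : ℝ) 1)
    (H : ℝ → ℝ → ℝ) (hH : RobinWASEP.IsC T 0 1 H) :
    (∃ u : ℝ → ℝ → ℝ, RobinWASEP.IsWeakSolution α β A B T H γ u) ∧
    (∀ u v : ℝ → ℝ → ℝ,
      RobinWASEP.IsWeakSolution α β A B T H γ u →
      RobinWASEP.IsWeakSolution α β A B T H γ v →
      ∀ t ∈ Ioc 0 T, ∀ᵐ x ∂(volume.restrict (Icc (0 : ℝ) 1)), u t x = v t x) :=
  theoremB5_general α β A B T ⟨hα.le, (hαβ.trans_lt hβ).le⟩ ⟨(hα.trans_le hαβ).le, hβ.le⟩ hA hB hT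
    γ hγm hγ H hH
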